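/- **Setting.** Time runs over $\mathbb Z_-=\{0,-1,-2,\dots\}$. *Data.* Let $(\xi^v_t,\xi^y_t)_{t\in\mathbb Z_-}$ be i.i.d. in $t$ with values in $\mathbb R^{q_v}\times\mathbb R^{q_y}$ and $\|\xi^v_t\|_2,\|\xi^y_t\|_2\le M_\xi$ almost surely ($\xi^v_t$ and $\xi^y_t$ may be dependent). The real-valued input and target are causal Bernoulli shifts $V_t=G^v(\dots,\xi^v_{t-1},\xi^v_t)$, $Y_t=G^y(\dots,\xi^y_{t-1},\xi^y_t)$, where for $I\in\{v,y\}$ the map $G^I$ is measurable and, on sequences bounded by $M_\xi$, satisfies $|G^I(u)-G^I(u')|\le L_I\sum_{k\ge0}w^I_k\|u_{-k}-u'_{-k}\|_2$ with $L_I\ge 0$ and $w^I:\mathbb N\to(0,1]$ decreasing, $D_{w^I}:=\sup_k w^I_{k+1}/w^I_k<1$. Put $\|w^I\|_1=\sum_k w^I_k$ and $C_I=2L_I\,\mathbb E\|\xi^I_0\|_2/(1-D_{w^I})$. Assume $V_t\in[0,1]$ almost surely for every $t$. The loss $\ell:\mathbb R^2\to\mathbb R$ satisfies $|\ell(x,y)-\ell(x',y')|\le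 L_\ell(|x-x'|+|y-y'|)$. *RRR class.* Let $\alpha_{\min}\in[0,1]$, $r_0,r_1\ge0$, and let $\Theta_{\rm RRR}$ be a finite set of parameters $\theta=(T_0,T_1,\alpha,\sigma)$, where $T_0,T_1$ are completely positive trace-preserving maps on $n$-qubit operators that are $r_0$- resp. $r_1$-Lipschitz on density matrices in the Hilbert–Schmidt norm, $\alpha\in[\alpha_{\min},1]$ is a reset rate and $\sigma$ is a density matrix. The reservoir map is $T_\theta(\rho,v)=(1-\alpha)\big(vT_0(\rho)+(1-v)T_1(\rho)\big)+\alpha\sigma$. A functional $H$ in $\mathcal H^{\rm RRR}=\mathcal H^{\rm RRR}_{n,R_{\max},C_{\max}}$ is $H(v)=h(\rho_0)$, where $(\rho_t)_{t\le0}$ are density matrices with $\rho_t=T_\theta(\rho_{t-1},v_t)$, and $h(\rho)=p\big(\mathrm{Tr}(Z_1\rho),\dots,\mathrm{Tr}(Z_n\rho)\big)$, with $Z_i$ the Pauli-$Z$ operator on qubit $i$ and $p$ a real polynomial in $n$ variables of total degree at most $R_{\max}$, constant term in $[-C_{\max},C_{\max}]$ and all other coefficients in $[-1,1]$. *Risks.*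 $R(H)=\mathbb E[\ell(H(V),Y_0)]$ and $\hat R_m(H)=\frac1m\sum_{i=0}^{m-1}\ell\big(H(V_{-i}^{-m+1}),Y_{-i}\big)$ with $V_{-i}^{-m+1}=(\dots,0,0,V_{-m+1},\dots,V_{-i})$. **Theorem.** Consider one of the two cases (a) $r_0=r_1=r_{0,1}$ and $(1-\alpha_{\min})r_{0,1}<1$; put $r:=(1-\alpha_{\min})r_{0,1}$; (b) $r_0>r_1$, and $\epsilon_{\rm RRR}>0$ is such that almost surely $(1-\alpha_{\min})\big(V_t r_0+(1-V_t)r_1\big)\le 1-\epsilon_{\rm RRR}$ for every $t$; put $r:=1-\epsilon_{\rm RRR}$. Let $\zeta_{\max}=\max(r,D_{w^y},D_{w^v})$, $N=\binom{n+R_{\max}}{R_{\max}}-1$ and $\bar L_h=R_{\max}\,n\,\sqrt{2^n}\,N$. Then for all $m\in\mathbb N^+$ with $\log m<m\log\zeta_{\max}^{-1}$ and all $\delta\in(0,1)$, with probability at least $1-\delta$, $$\sup_{H\in\mathcal H^{\rm RRR}}|R(H)-\hat R_m(H)|\le\frac{C_0+C_1}{m}+C_2\frac{\log m}{m}+C_3\sqrt{\frac{\log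 m}{m}}+C_4\sqrt{\frac{\log(4/\delta)}{2m}},$$ where $$C_0=2L_\ell\bar L_h\frac{(1-r^m)\,r}{1-r},\qquad C_1=\frac{L_\ell(2\bar L_h+C_y)}{\zeta_{\max}},$$ $$C_2=\frac{2\big(L_\ell\bar L_h+\mathbb E|\ell(0,Y_0)|+C_{\max}L_\ell\big)}{\log\zeta_{\max}^{-1}}+\frac{2(1-\alpha_{\min})L_\ell\bar L_hC_v}{\zeta_{\max}\log\zeta_{\max}^{-1}},$$ $$C_3=\frac{2L_\ell\big(|\Theta_{\rm RRR}|\,R_{\max}N+C_{\max}\big)}{\sqrt{\log\zeta_{\max}^{-1}}},$$ $$C_4=2L_\ell\Big(\frac{\bar L_h}{1-r}\big(r+2(1-\alpha_{\min})M_\xi L_v\|w^v\|_1\big)+M_\xi L_y\|w^y\|_1\Big).$$ In particular the right-hand side is $O\big(\frac1m+\frac{\log m}m+\sqrt{\frac{\log m}m}+\sqrt{\frac{\log(1/\delta)}m}\big)$, with an implied constant independent of these $m$ and of $\delta$. -/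

import Mathlib

open MeasureTheory ProbabilityTheory
open scoped ComplexOrder

noncomputable section

namespace QRC

/-! ### Quantum states and channels on `n` qubits -/

/-- Complex matrices on the `n`-qubit space, indexed by the computational basis. -/
abbrev QMat (n : ℕ) : Type := Matrix (Fin n → Fin 2) (Fin n → Fin 2) ℂ

/-- Density matrices: positive semidefinite of trace one. -/
def IsDensity {n : ℕ} (ρ : QMat n) : Prop :=
  ρ.PosSemidef ∧ ρ.trace = 1

/-- The Hilbert-Schmidt (Schatten 2) norm. -/
def hsNorm {n : ℕ} (A : QMat n) : ℝ :=
  Real.sqrt ((A.conjTranspose * A).trace.re)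

/-- Complete positivity: every amplification `T ⊗ id_k` preserves positive semidefiniteness. -/
def IsCompletelyPositive {n : ℕ} (T : QMat n →ₗ[ℂ] QMat n) : Prop :=
  ∀ (k : ℕ) (X : Matrix ((Fin n → Fin 2) × Fin k) ((Fin n → Fin 2) × Fin k) ℂ),
    X.PosSemidef →
      (Matrix.of fun a b : (Fin n → Fin 2) × Fin k =>
        T (Matrix.of fun i j => X (i, a.2) (j, b.2)) a.1 b.1).PosSemidef

/-- Quantum channels: completely positive trace-preserving linear maps. -/
def IsChannel {n : ℕ} (T : QMat n →ₗ[ℂ] QMat n) : Prop :=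
  IsCompletelyPositive T ∧ ∀ X, (T X).trace = X.trace

/-- `T` is `r`-Lipschitz on density matrices in the Hilbert-Schmidt norm. -/
def HasRate {n : ℕ} (T : QMat n →ₗ[ℂ] QMat n) (r : ℝ) : Prop :=
  ∀ ρ σ : QMat n, IsDensity ρ → IsDensity σ →
    hsNorm (T ρ - T σ) ≤ r * hsNorm (ρ - σ)

/-- The Pauli `Z` operator acting on qubit `i` and trivially on the others. -/
def pauliZ {n : ℕ} (i : Fin n) : QMat n :=
  Matrix.diagonal fun b => if b i = 0 then 1 else -1

/-- The expectation `⟨Z_i⟩ = Tr (Z_i ρ)`. -/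
def zExp {n : ℕ} (ρ : QMat n) (i : Fin n) : ℝ :=
  ((pauliZ i * ρ).trace).re

/-! ### Reset-rate reservoirs with polynomial readouts -/

/-- The parameters of one reset-rate reservoir. -/
structure RRRParam (n : ℕ) where
  T0 : QMat n →ₗ[ℂ] QMat n
  T1 : QMat n →ₗ[ℂ] QMat n
  α : ℝ
  σ : QMat n

/-- Two channels, a reset rate in `[α_min, 1]` and a density matrix to which one resets. -/
structure RRRParam.Valid {n : ℕ} (θ : RRRParam n) (αmin : ℝ) : Prop where
  channel0 : IsChannel θ.T0
  channel1 : IsChannel θ.T1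
  le_reset : αmin ≤ θ.α
  reset_le : θ.α ≤ 1
  density : IsDensity θ.σ

/-- The reservoir map `T(ρ, v) = (1 - α) (v T₀(ρ) + (1 - v) T₁(ρ)) + α σ`. -/
def RRRParam.step {n : ℕ} (θ : RRRParam n) (ρ : QMat n) (v : ℝ) : QMat n :=
  (1 - θ.α) • (v • θ.T0 ρ + (1 - v) • θ.T1 ρ) + θ.α • θ.σ

/-- Time runs over the non-positive integers; index `k : ℕ` stands for time `-k`.
A trajectory is a sequence of density matrices with `ρ_t = T(ρ_{t-1}, v_t)` for all `t ≤ 0`. -/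
def RRRParam.IsTrajectory {n : ℕ} (θ : RRRParam n) (v : ℕ → ℝ) (x : ℕ → QMat n) : Prop :=
  ∀ k, IsDensity (x k) ∧ x k = θ.step (x (k + 1)) (v k)

open Classical in
/-- The trajectory driven by the input `v`. It is the only one whenever the reservoir map is a
strict contraction along the input; the value `0` is used for inputs that admit none. -/
def RRRParam.state {n : ℕ} (θ : RRRParam n) (v : ℕ → ℝ) : ℕ → QMat n :=
  if h : ∃ x, θ.IsTrajectory v x then h.choose else fun _ => 0

/-- Polynomials in `n` variables of total degree at most `R_max`, with constant term in
`[-C_max, C_max]` and all other coefficients in `[-1, 1]`. -/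
def IsReadoutPoly {n : ℕ} (Rmax : ℕ) (Cmax : ℝ) (p : MvPolynomial (Fin n) ℝ) : Prop :=
  p.totalDegree ≤ Rmax ∧ |p.coeff 0| ≤ Cmax ∧ ∀ a : Fin n →₀ ℕ, a ≠ 0 → |p.coeff a| ≤ 1

/-- The class of functionals `v ↦ h(ρ_0)`, where `h(ρ) = p(⟨Z_1⟩, …, ⟨Z_n⟩)`. -/
def rrrClass {n : ℕ} (Θ : Finset (RRRParam n)) (Rmax : ℕ) (Cmax : ℝ) : Set ((ℕ → ℝ) → ℝ) :=
  {H | ∃ θ ∈ Θ, ∃ p : MvPolynomial (Fin n) ℝ, IsReadoutPoly Rmax Cmax p ∧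
    H = fun v => MvPolynomial.eval (zExp (θ.state v 0)) p}

/-! ### Input and target processes: causal Bernoulli shifts -/

/-- A causal functional of the innovations, with a weighting sequence and a Lipschitz constant. -/
structure Shift (q : ℕ) where
  G : (ℕ → EuclideanSpace ℝ (Fin q)) → ℝ
  w : ℕ → ℝ
  L : ℝ

/-- The decay rate `D_w = sup_k w_{k+1} / w_k`. -/
def Shift.D {q : ℕ} (S : Shift q) : ℝ := ⨆ k, S.w (k + 1) / S.w k

/-- The weighted norm bound `‖w‖₁`. -/
def Shift.w1 {q : ℕ} (S : Shift q) : ℝ := ∑' k, S.w k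

/-- `w` is a decreasing sequence in `(0, 1]` with `D_w < 1`, and `G` is measurable and `L`-Lipschitz
for the `w`-weighted `ℓ¹` distance on innovation sequences bounded by `M`. -/
structure Shift.Valid {q : ℕ} (S : Shift q) (M : ℝ) : Prop where
  measurable : Measurable S.G
  w_pos : ∀ k, 0 < S.w k
  w_le_one : ∀ k, S.w k ≤ 1
  w_anti : Antitone S.w
  D_lt_one : S.D < 1
  L_nonneg : 0 ≤ S.L
  lipschitz : ∀ u u' : ℕ → EuclideanSpace ℝ (Fin q), (∀ k, ‖u k‖ ≤ M) → (∀ k, ‖u' k‖ ≤ M) →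
    |S.G u - S.G u'| ≤ S.L * ∑' k, S.w k * ‖u k - u' k‖

variable {Ω : Type*} [MeasurableSpace Ω]

/-- The process `I_{-t} = G(ξ_{-t}, ξ_{-t-1}, …)`. -/
def Shift.process {q : ℕ} (S : Shift q) (ξ : ℕ → Ω → EuclideanSpace ℝ (Fin q))
    (t : ℕ) (ω : Ω) : ℝ :=
  S.G fun k => ξ (t + k) ω

/-- The constant `C_I = 2 L_I E‖ξ_0‖ / (1 - D_w)`. -/
def Shift.depConst {q : ℕ} (S : Shift q) (μ : Measure Ω)
    (ξ : ℕ → Ω → EuclideanSpace ℝ (Fin q)) : ℝ :=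
  2 * S.L * (∫ ω, ‖ξ 0 ω‖ ∂μ) / (1 - S.D)

/-- The pairs `(ξ^v_t, ξ^y_t)` are i.i.d. in `t`, and both components are bounded by `M`
(the two components at one time may depend on each other). -/
structure IsInnovation {qv qy : ℕ} (μ : Measure Ω) (ξv : ℕ → Ω → EuclideanSpace ℝ (Fin qv))
    (ξy : ℕ → Ω → EuclideanSpace ℝ (Fin qy)) (M : ℝ) : Prop where
  measurable_v : ∀ t, Measurable (ξv t)
  measurable_y : ∀ t, Measurable (ξy t)
  indep : iIndepFun (fun t ω => (ξv t ω, ξy t ω)) μ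
  ident : ∀ t, IdentDistrib (fun ω => (ξv t ω, ξy t ω)) (fun ω => (ξv 0 ω, ξy 0 ω)) μ μ
  bound_v : ∀ t, ∀ᵐ ω ∂μ, ‖ξv t ω‖ ≤ M
  bound_y : ∀ t, ∀ᵐ ω ∂μ, ‖ξy t ω‖ ≤ M

/-! ### Risks -/

/-- The statistical risk `R(H) = E[ℓ(H(V), Y_0)]`. -/
def risk (μ : Measure Ω) (loss : ℝ → ℝ → ℝ) (V Y : ℕ → Ω → ℝ) (H : (ℕ → ℝ) → ℝ) : ℝ :=
  ∫ ω, loss (H fun k => V k ω) (Y 0 ω) ∂μ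

/-- The empirical risk `(1/m) ∑_{i<m} ℓ(H(V_{-i}^{-m+1}), Y_{-i})`, where
`V_{-i}^{-m+1} = (…, 0, 0, V_{-m+1}, …, V_{-i})` is the observed input padded by zeros. -/
def empRisk (loss : ℝ → ℝ → ℝ) (V Y : ℕ → Ω → ℝ) (m : ℕ) (H : (ℕ → ℝ) → ℝ) (ω : Ω) : ℝ :=
  (1 / (m : ℝ)) * ∑ i ∈ Finset.range m,
    loss (H fun k => if i + k < m then V (i + k) ω else 0) (Y i ω)

/-! ### The constants of the bound -/

/-- The number of non-constant monomials, `(n+R choose R) - 1`. -/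
def numMonomials (n Rmax : ℕ) : ℝ := ((n + Rmax).choose Rmax : ℝ) - 1

/-- The Lipschitz constant `R_max n √(2^n) ((n+R choose R) - 1)` of the readouts. -/
def lipPoly (n Rmax : ℕ) : ℝ :=
  (Rmax : ℝ) * (n : ℝ) * Real.sqrt (2 ^ n) * numMonomials n Rmax

/-- `ζ_max = max (r, D_{w^y}, D_{w^v})`. -/
def zetaMax (r Dy Dv : ℝ) : ℝ := max r (max Dy Dv)

def constC0 (Lℓ Lh r : ℝ) (m : ℕ) : ℝ :=
  2 * Lℓ * Lh * ((1 - r ^ m) * r / (1 - r))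

def constC1 (Lℓ Lh Cy ζ : ℝ) : ℝ :=
  Lℓ * (2 * Lh + Cy) / ζ

def constC2 (Lℓ Lh ℓ0 Cmax αmin Cv ζ : ℝ) : ℝ :=
  2 * (Lℓ * Lh + ℓ0 + Cmax * Lℓ) / Real.log ζ⁻¹
    + 2 * (1 - αmin) * Lℓ * Lh * Cv / (ζ * Real.log ζ⁻¹)

def constC3 (n Rmax card : ℕ) (Lℓ Cmax ζ : ℝ) : ℝ :=
  2 * Lℓ * ((card : ℝ) * Rmax * numMonomials n Rmax + Cmax) / Real.sqrt (Real.log ζ⁻¹)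

def constC4 (Lℓ Lh αmin r M Lv wv1 Ly wy1 : ℝ) : ℝ :=
  2 * Lℓ * (Lh / (1 - r) * (r + 2 * (1 - αmin) * M * Lv * wv1) + M * Ly * wy1)

/-- The right-hand side of the risk bound, for the contraction rate `r`. -/
def riskBound {qv qy : ℕ} (μ : Measure Ω) (ξv : ℕ → Ω → EuclideanSpace ℝ (Fin qv))
    (ξy : ℕ → Ω → EuclideanSpace ℝ (Fin qy)) (Sv : Shift qv) (Sy : Shift qy) (M : ℝ)
    (loss : ℝ → ℝ → ℝ) (Lℓ : ℝ) (n Rmax card : ℕ) (Cmax αmin r : ℝ) (m : ℕ) (δ : ℝ) : ℝ :=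
  let ζ := zetaMax r Sy.D Sv.D
  let Lh := lipPoly n Rmax
  let ℓ0 := ∫ ω, |loss 0 (Sy.process ξy 0 ω)| ∂μ
  (constC0 Lℓ Lh r m + constC1 Lℓ Lh (Sy.depConst μ ξy) ζ) * (1 / (m : ℝ))
    + constC2 Lℓ Lh ℓ0 Cmax αmin (Sv.depConst μ ξv) ζ * (Real.log m / m)
    + constC3 n Rmax card Lℓ Cmax ζ * Real.sqrt (Real.log m / m)
    + constC4 Lℓ Lh αmin r M Sv.L Sv.w1 Sy.L Sy.w1 * Real.sqrt (Real.log (4 / δ) / (2 * m))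

/-- The order of the bound: `1/m + log m / m + √(log m / m) + √(log (1/δ) / m)`. -/
def boundOrder (m : ℕ) (δ : ℝ) : ℝ :=
  1 / (m : ℝ) + Real.log m / m + Real.sqrt (Real.log m / m) + Real.sqrt (Real.log (1 / δ) / m)

/-- The generalisation bound with a right-hand side `B m δ`, for sample sizes `m ≥ 1` with
`log m < m log ζ⁻¹`: with probability at least `1 - δ`, the supremum over the class of
`|R(H) - R̂_m(H)|` is at most `B m δ`; and `B m δ = O(boundOrder m δ)`, with one
constant for all these `m` and all `δ`. -/
def GeneralisationBound (μ : Measure Ω) (loss : ℝ → ℝ → ℝ) (V Y : ℕ → Ω → ℝ)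
    (𝓗 : Set ((ℕ → ℝ) → ℝ)) (ζ : ℝ) (B : ℕ → ℝ → ℝ) : Prop :=
  (∀ m : ℕ, 1 ≤ m → Real.log m < m * Real.log ζ⁻¹ → ∀ δ : ℝ, 0 < δ → δ < 1 →
    ENNReal.ofReal (1 - δ) ≤
      μ {ω | (⨆ H ∈ 𝓗, ((|risk μ loss V Y H - empRisk loss V Y m H ω| : ℝ) : EReal))
        ≤ ((B m δ : ℝ) : EReal)}) ∧
  ∃ K : ℝ, ∀ m : ℕ, 1 ≤ m → Real.log m < m * Real.log ζ⁻¹ → ∀ δ : ℝ, 0 < δ → δ < 1 →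
    B m δ ≤ K * boundOrder m δ

end QRC

end

noncomputable section

namespace QRC

/-! ### The Hilbert-Schmidt norm -/

section HilbertSchmidt

variable {n : ℕ}

/-! The proof combines blocking with a bounded differences inequality, both applied directly to the
i.i.d. innovations.

Along admissible inputs each reservoir contracts density matrices at rate `r` in the Hilbert-Schmidt
norm, and a change of one input moves the next state by at most `2 * (1 - αmin)` times that change.
Hence the state is within `r ^ k` of the result of running `k` steps from the maximally mixed state
(`RRRParam.Contracts.state_sub_run_le`). All estimates are made for these finite runs, which are
continuous in finitely many inputs; the true and empirical risks are compared with them at a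
geometric cost.

For the expected supremum of the gap, the innovations are truncated after `τ` entries, which costs
order `τ * ζ ^ τ` in mean (`Setup.integral_padErr_le`). Truncated windows whose positions agree
modulo `τ` are disjoint, hence independent. On each residue class symmetrisation and contraction are
done one summand at a time, on a class of convex functionals stable under averaging
(`IsContractive.centredStep_le_signedStep`). A readout is linear in the constant feature and the
Pauli monomials of all reservoirs, so the resulting signed average is at most the sum of the
coefficient bounds times a square root (`iterate_signedStep_iSup_le`). Cauchy-Schwarz over the
residues gives `√(τ / m)`, and `τ = ⌊log m / log ζ⁻¹⌋` balances the terms.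

For the deviation from the mean, the supremum is viewed as a function of the whole innovation
sequence. The influences of the single coordinates are at most `T / m` each and sum to at most `T`,
where `T` is `Setup.totalInfluence`; so their squares sum to at most `T ^ 2 / m`. The bounded
differences inequality for infinitely many coordinates (`measure_gt_le_of_hasBoundedDiff`) follows
by averaging out the first `l` coordinates and letting `l` tend to infinity. Replacing the loss by
its negative gives the other side.

These bounds do not depend on the size of the finite family of readouts. They pass to countable
families by monotone limits, and to the full class because the risks are continuous in the
coefficients (`generalisationBound_of_contracts`). Almost sure bounds on the data are turned into
sure ones by clipping innovations and clamping inputs. -/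

/-- The matrix entries as a Euclidean vector. -/
def hsVec (A : QMat n) : EuclideanSpace ℂ ((Fin n → Fin 2) × (Fin n → Fin 2)) :=
  WithLp.toLp 2 fun p => A p.1 p.2

theorem trace_conjTranspose_mul_self_re (A : QMat n) :
    (A.conjTranspose * A).trace.re = ∑ i, ∑ j, ‖A i j‖ ^ 2 := by
  simp only [Matrix.trace, Matrix.diag, Matrix.mul_apply, Matrix.conjTranspose_apply,
    Complex.re_sum]
  rw [Finset.sum_comm]
  refine Finset.sum_congr rfl fun i _ => Finset.sum_congr rfl fun j _ => ?_
  rw [← Complex.normSq_eq_norm_sq, Complex.normSq_apply]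
  simp

theorem hsNorm_sq (A : QMat n) : hsNorm A ^ 2 = ∑ i, ∑ j, ‖A i j‖ ^ 2 := by
  rw [hsNorm, Real.sq_sqrt, trace_conjTranspose_mul_self_re]
  rw [trace_conjTranspose_mul_self_re]
  positivity

theorem hsNorm_eq_norm_hsVec (A : QMat n) : hsNorm A = ‖hsVec A‖ := by
  rw [hsNorm, trace_conjTranspose_mul_self_re, EuclideanSpace.norm_eq, Fintype.sum_prod_type]
  rfl

theorem hsNorm_nonneg (A : QMat n) : 0 ≤ hsNorm A := Real.sqrt_nonneg _

theorem hsNorm_add_le (A B : QMat n) : hsNorm (A + B) ≤ hsNorm A + hsNorm B := by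
  simp only [hsNorm_eq_norm_hsVec]
  exact norm_add_le (hsVec A) (hsVec B)

theorem hsNorm_smul (c : ℝ) (A : QMat n) : hsNorm (c • A) = |c| * hsNorm A := by
  simp only [hsNorm_eq_norm_hsVec]
  have : hsVec (c • A) = (c : ℂ) • hsVec A := by
    ext p
    simp [hsVec]
  rw [this, norm_smul]
  simp

theorem hsNorm_sub_le (A B : QMat n) : hsNorm (A - B) ≤ hsNorm A + hsNorm B := by
  simp only [hsNorm_eq_norm_hsVec]
  exact norm_sub_le (hsVec A) (hsVec B)

/-- `|Tr (Z_i A)| ≤ √(2^n) ‖A‖`. -/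
theorem abs_zExp_le (A : QMat n) (i : Fin n) :
    |((pauliZ i * A).trace).re| ≤ Real.sqrt (2 ^ n) * hsNorm A := by
  have h1 : |((pauliZ i * A).trace).re| ≤ ∑ b, ‖A b b‖ := by
    refine (Complex.abs_re_le_norm _).trans ?_
    rw [Matrix.trace]
    refine (norm_sum_le _ _).trans (Finset.sum_le_sum fun b _ => ?_)
    rw [pauliZ, Matrix.diag_apply, Matrix.diagonal_mul]
    split_ifs <;> simp
  refine h1.trans (Real.le_sqrt_of_sq_le ?_ |>.trans
    (le_of_eq (by rw [Real.sqrt_mul (by positivity), Real.sqrt_sq (hsNorm_nonneg A)] :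
      Real.sqrt (2 ^ n * hsNorm A ^ 2) = Real.sqrt (2 ^ n) * hsNorm A)))
  have h2 := sq_sum_le_card_mul_sum_sq (s := (Finset.univ : Finset (Fin n → Fin 2)))
    (f := fun b => ‖A b b‖)
  refine h2.trans ?_
  rw [hsNorm_sq]
  have : ((Finset.univ : Finset (Fin n → Fin 2)).card : ℝ) = 2 ^ n := by simp
  rw [this]
  refine mul_le_mul_of_nonneg_left (Finset.sum_le_sum fun b _ => ?_) (by positivity)
  exact Finset.single_le_sum (f := fun j => ‖A b j‖ ^ 2) (fun j _ => by positivity)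
    (Finset.mem_univ b)

theorem zExp_sub (A B : QMat n) (i : Fin n) :
    zExp A i - zExp B i = ((pauliZ i * (A - B)).trace).re := by
  simp [zExp, Matrix.mul_sub, Matrix.trace_sub]

theorem abs_zExp_sub_le (A B : QMat n) (i : Fin n) :
    |zExp A i - zExp B i| ≤ Real.sqrt (2 ^ n) * hsNorm (A - B) := by
  rw [zExp_sub]
  exact abs_zExp_le _ _

end HilbertSchmidt

/-! ### Density matrices -/

section Density

variable {n : ℕ}

/-- The principal 2×2 minor on the indices `i` and `j` has nonnegative determinant. -/
theorem PosSemidef.norm_apply_sq_le {m : Type*} [Fintype m] {A : Matrix m m ℂ}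
    (hA : A.PosSemidef) (i j : m) : ‖A i j‖ ^ 2 ≤ (A i i).re * (A j j).re := by
  classical
  by_cases hij : i = j
  · subst hij
    have h := (Complex.nonneg_iff.1 (hA.diag_nonneg (i := i)))
    have : A i i = ((A i i).re : ℂ) := by
      apply Complex.ext <;> simp [← h.2]
    rw [this]
    simp [sq]
  · have hB := hA.submatrix ![i, j]
    have hd := hB.det_nonneg
    rw [Matrix.det_fin_two] at hd
    simp only [Matrix.submatrix_apply, Matrix.cons_val_zero, Matrix.cons_val_one] at hd
    have hji : A j i = star (A i j) := (hA.1.apply j i).symm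
    have hi := Complex.nonneg_iff.1 (hA.diag_nonneg (i := i))
    have hj := Complex.nonneg_iff.1 (hA.diag_nonneg (i := j))
    have h1 := (Complex.nonneg_iff.1 hd).1
    rw [hji] at h1
    have h2 : (A i j * star (A i j)).re = ‖A i j‖ ^ 2 := by
      rw [← Complex.normSq_eq_norm_sq, Complex.normSq_apply]; simp
    rw [Complex.sub_re, h2, Complex.mul_re, ← hi.2, ← hj.2] at h1
    linarith

theorem IsDensity.sum_diag {ρ : QMat n} (h : IsDensity ρ) : ∑ i, (ρ i i).re = 1 := by
  have := congrArg Complex.re h.2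
  simpa [Matrix.trace] using this

theorem IsDensity.hsNorm_sq_le {ρ : QMat n} (h : IsDensity ρ) : hsNorm ρ ^ 2 ≤ 1 := by
  rw [hsNorm_sq]
  calc ∑ i, ∑ j, ‖ρ i j‖ ^ 2 ≤ ∑ i, ∑ j, (ρ i i).re * (ρ j j).re :=
        Finset.sum_le_sum fun i _ => Finset.sum_le_sum fun j _ => PosSemidef.norm_apply_sq_le h.1 i j
    _ = 1 := by simp [← Finset.mul_sum, h.sum_diag]

theorem IsDensity.hsNorm_le {ρ : QMat n} (h : IsDensity ρ) : hsNorm ρ ≤ 1 := by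
  have := h.hsNorm_sq_le
  nlinarith [hsNorm_nonneg ρ]

theorem IsDensity.abs_zExp_le_one {ρ : QMat n} (h : IsDensity ρ) (i : Fin n) :
    |zExp ρ i| ≤ 1 := by
  refine (Complex.abs_re_le_norm _).trans ?_
  rw [Matrix.trace, ← h.sum_diag]
  refine (norm_sum_le _ _).trans (Finset.sum_le_sum fun b _ => ?_)
  have hb := Complex.nonneg_iff.1 (h.1.diag_nonneg (i := b))
  have : ρ b b = ((ρ b b).re : ℂ) := by
    apply Complex.ext <;> simp [← hb.2]
  rw [pauliZ, Matrix.diag_apply, Matrix.diagonal_mul, this]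
  split_ifs <;> simp [abs_of_nonneg hb.1]

theorem IsDensity.convex {ρ σ : QMat n} (hρ : IsDensity ρ) (hσ : IsDensity σ) {a b : ℝ}
    (ha : 0 ≤ a) (hb : 0 ≤ b) (hab : a + b = 1) : IsDensity (a • ρ + b • σ) := by
  constructor
  · exact (hρ.1.smul ha).add (hσ.1.smul hb)
  · rw [Matrix.trace_add, Matrix.trace_smul, Matrix.trace_smul, hρ.2, hσ.2]
    simp only [Complex.real_smul, mul_one]
    exact_mod_cast hab

/-- The maximally mixed state. -/
def maxMixed (n : ℕ) : QMat n := ((2 ^ n : ℝ)⁻¹) • (1 : QMat n)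

theorem isDensity_maxMixed : IsDensity (maxMixed n) := by
  constructor
  · exact Matrix.PosSemidef.one.smul (by positivity)
  · rw [maxMixed, Matrix.trace_smul, Matrix.trace_one]
    simp

/-- Expanding the square gives `‖ρ‖² - 2⁻ⁿ`, since the cross term only sees the trace. Starting all
runs at the maximally mixed state thus gives the factor 1 in front of `r ^ k`, where two arbitrary
states would give 2 by the triangle inequality. -/
theorem IsDensity.hsNorm_sub_maxMixed_le {ρ : QMat n} (h : IsDensity ρ) :
    hsNorm (ρ - maxMixed n) ≤ 1 := by
  have key : hsNorm (ρ - maxMixed n) ^ 2 ≤ 1 := by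
    have h1 : ∀ i j, ‖(ρ - maxMixed n) i j‖ ^ 2 =
        ‖ρ i j‖ ^ 2 + (if i = j then -2 * (2 ^ n : ℝ)⁻¹ * (ρ i i).re + ((2 ^ n : ℝ)⁻¹) ^ 2
          else 0) := by
      intro i j
      by_cases hij : i = j
      · subst hij
        simp only [maxMixed, Matrix.sub_apply, Matrix.smul_apply, Matrix.one_apply_eq, if_true]
        rw [← Complex.normSq_eq_norm_sq, ← Complex.normSq_eq_norm_sq, Complex.normSq_apply,
          Complex.normSq_apply]
        simp only [Complex.sub_re, Complex.sub_im, Complex.real_smul, mul_one, Complex.ofReal_re,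
          Complex.ofReal_im]
        ring
      · simp [maxMixed, Matrix.sub_apply, Matrix.smul_apply, hij]
    have h2 := h.hsNorm_sq_le
    rw [hsNorm_sq] at h2 ⊢
    simp only [h1, Finset.sum_add_distrib]
    simp only [Finset.sum_ite_eq, Finset.mem_univ, if_true, Finset.sum_add_distrib,
      ← Finset.mul_sum, h.sum_diag]
    have h3 : (∑ _i : Fin n → Fin 2, ((2 ^ n : ℝ)⁻¹) ^ 2) = (2 ^ n : ℝ)⁻¹ := by
      simp only [Finset.sum_const, nsmul_eq_mul]
      have : ((Finset.univ : Finset (Fin n → Fin 2)).card : ℝ) = 2 ^ n := by simp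
      rw [this]
      field_simp
    rw [h3]
    have : (0 : ℝ) ≤ (2 ^ n : ℝ)⁻¹ := by positivity
    linarith
  nlinarith [hsNorm_nonneg (ρ - maxMixed n)]

/-- The amplification by a one-dimensional space is the map itself. -/
theorem IsCompletelyPositive.posSemidef {T : QMat n →ₗ[ℂ] QMat n} (hT : IsCompletelyPositive T)
    {A : QMat n} (hA : A.PosSemidef) : (T A).PosSemidef := by
  have h := hT 1 (A.submatrix Prod.fst Prod.fst) (hA.submatrix _)
  have h2 := h.submatrix (fun i : Fin n → Fin 2 => (i, (0 : Fin 1)))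
  exact h2

theorem IsChannel.isDensity {T : QMat n →ₗ[ℂ] QMat n} (hT : IsChannel T) {ρ : QMat n}
    (h : IsDensity ρ) : IsDensity (T ρ) :=
  ⟨hT.1.posSemidef h.1, (hT.2 ρ).trans h.2⟩

end Density
/-! ### The reservoir map and its iterates -/

section Run

variable {n : ℕ} {θ : RRRParam n} {αmin r0 r1 b r : ℝ}

theorem RRRParam.Valid.step_isDensity (hθ : θ.Valid αmin) (hα : 0 ≤ αmin) {ρ : QMat n}
    (hρ : IsDensity ρ) {v : ℝ} (hv : v ∈ Set.Icc (0 : ℝ) 1) : IsDensity (θ.step ρ v) :=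
  ((hθ.channel0.isDensity hρ).convex (hθ.channel1.isDensity hρ) hv.1 (by linarith [hv.2])
    (by ring)).convex hθ.density (by linarith [hθ.reset_le]) (by linarith [hθ.le_reset]) (by ring)

/-- The reservoir map contracts density matrices with rate `r` for inputs in `[0, b]`. -/
structure RRRParam.Contracts (θ : RRRParam n) (αmin b r : ℝ) : Prop where
  valid : θ.Valid αmin
  α_nonneg : 0 ≤ αmin
  b_le_one : b ≤ 1
  r_nonneg : 0 ≤ r
  r_lt_one : r < 1
  contract : ∀ v ∈ Set.Icc (0 : ℝ) b, ∀ ρ σ : QMat n, IsDensity ρ → IsDensity σ →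
    hsNorm (θ.step ρ v - θ.step σ v) ≤ r * hsNorm (ρ - σ)

/-- The reset state cancels in the difference, which leaves a convex combination of the two channels
scaled by `1 - θ.α ≤ 1 - αmin`. -/
theorem RRRParam.Valid.contract (hθ : θ.Valid αmin)
    (h0 : HasRate θ.T0 r0) (h1 : HasRate θ.T1 r1) (hr0 : 0 ≤ r0) (hr1 : 0 ≤ r1) {v : ℝ}
    (hv : v ∈ Set.Icc (0 : ℝ) 1) (hr : (1 - αmin) * (v * r0 + (1 - v) * r1) ≤ r)
    {ρ σ : QMat n} (hρ : IsDensity ρ) (hσ : IsDensity σ) :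
    hsNorm (θ.step ρ v - θ.step σ v) ≤ r * hsNorm (ρ - σ) := by
  have e : θ.step ρ v - θ.step σ v =
      (1 - θ.α) • (v • (θ.T0 ρ - θ.T0 σ) + (1 - v) • (θ.T1 ρ - θ.T1 σ)) := by
    simp only [RRRParam.step, smul_add, smul_sub]
    abel
  have hα : 0 ≤ 1 - θ.α := by linarith [hθ.reset_le]
  have hv1 : 0 ≤ 1 - v := by linarith [hv.2]
  have hn := hsNorm_nonneg (ρ - σ)
  rw [e, hsNorm_smul, abs_of_nonneg hα]
  have h2 : hsNorm (v • (θ.T0 ρ - θ.T0 σ) + (1 - v) • (θ.T1 ρ - θ.T1 σ)) ≤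
      (v * r0 + (1 - v) * r1) * hsNorm (ρ - σ) := by
    refine (hsNorm_add_le _ _).trans ?_
    rw [hsNorm_smul, hsNorm_smul, abs_of_nonneg hv.1, abs_of_nonneg hv1]
    have := mul_le_mul_of_nonneg_left (h0 ρ σ hρ hσ) hv.1
    have := mul_le_mul_of_nonneg_left (h1 ρ σ hρ hσ) hv1
    linarith
  have h3 : 0 ≤ v * r0 + (1 - v) * r1 := add_nonneg (mul_nonneg hv.1 hr0) (mul_nonneg hv1 hr1)
  calc (1 - θ.α) * hsNorm (v • (θ.T0 ρ - θ.T0 σ) + (1 - v) • (θ.T1 ρ - θ.T1 σ))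
      ≤ (1 - θ.α) * ((v * r0 + (1 - v) * r1) * hsNorm (ρ - σ)) :=
        mul_le_mul_of_nonneg_left h2 hα
    _ ≤ (1 - αmin) * ((v * r0 + (1 - v) * r1) * hsNorm (ρ - σ)) :=
        mul_le_mul_of_nonneg_right (by linarith [hθ.le_reset]) (mul_nonneg h3 hn)
    _ = ((1 - αmin) * (v * r0 + (1 - v) * r1)) * hsNorm (ρ - σ) := by ring
    _ ≤ r * hsNorm (ρ - σ) := mul_le_mul_of_nonneg_right hr hn

/-- The map is affine in the input with slope `(1 - θ.α) • (θ.T0 ρ - θ.T1 ρ)`, a scaled difference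
of two density matrices, each of norm at most 1. -/
theorem RRRParam.Valid.step_sub_input (hθ : θ.Valid αmin) {ρ : QMat n}
    (hρ : IsDensity ρ) (v v' : ℝ) :
    hsNorm (θ.step ρ v - θ.step ρ v') ≤ 2 * (1 - αmin) * |v - v'| := by
  have e : θ.step ρ v - θ.step ρ v' =
      ((1 - θ.α) * (v - v')) • (θ.T0 ρ - θ.T1 ρ) := by
    simp only [RRRParam.step, smul_add, smul_sub, sub_smul, mul_smul, one_smul]
    abel
  have hα : 0 ≤ 1 - θ.α := by linarith [hθ.reset_le]
  rw [e, hsNorm_smul, abs_mul, abs_of_nonneg hα]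
  have h2 : hsNorm (θ.T0 ρ - θ.T1 ρ) ≤ 2 := by
    refine (hsNorm_sub_le _ _).trans ?_
    linarith [(hθ.channel0.isDensity hρ).hsNorm_le, (hθ.channel1.isDensity hρ).hsNorm_le]
  calc (1 - θ.α) * |v - v'| * hsNorm (θ.T0 ρ - θ.T1 ρ) ≤ (1 - θ.α) * |v - v'| * 2 :=
        mul_le_mul_of_nonneg_left h2 (by positivity)
    _ ≤ (1 - αmin) * |v - v'| * 2 := by
        have := abs_nonneg (v - v')
        gcongr
        exact hθ.le_reset
    _ = 2 * (1 - αmin) * |v - v'| := by ring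

/-- The state after `k` steps from `ρ` at time `-k` under the inputs `v_{k-1}, …, v_0`. -/
def RRRParam.run (θ : RRRParam n) (ρ : QMat n) : ℕ → (ℕ → ℝ) → QMat n
  | 0, _ => ρ
  | k + 1, v => θ.step (RRRParam.run θ ρ k fun t => v (t + 1)) (v 0)

theorem RRRParam.Contracts.step_isDensity (h : θ.Contracts αmin b r) {ρ : QMat n}
    (hρ : IsDensity ρ) {v : ℝ} (hv : v ∈ Set.Icc (0 : ℝ) b) : IsDensity (θ.step ρ v) :=
  h.valid.step_isDensity h.α_nonneg hρ ⟨hv.1, hv.2.trans h.b_le_one⟩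

theorem RRRParam.Contracts.run_isDensity (h : θ.Contracts αmin b r) {ρ : QMat n}
    (hρ : IsDensity ρ) (k : ℕ) :
    ∀ {v : ℕ → ℝ}, (∀ t, v t ∈ Set.Icc (0 : ℝ) b) → IsDensity (θ.run ρ k v) := by
  induction k with
  | zero => exact fun _ => hρ
  | succ k ih => exact fun hv => h.step_isDensity (ih fun t => hv (t + 1)) (hv 0)

theorem RRRParam.run_add (θ : RRRParam n) (ρ : QMat n) (k l : ℕ) :
    ∀ v : ℕ → ℝ, θ.run ρ (k + l) v = θ.run (θ.run ρ l fun t => v (t + k)) k v := by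
  induction k with
  | zero => intro v; simp [RRRParam.run]
  | succ k ih =>
    intro v
    rw [Nat.add_right_comm]
    simp only [RRRParam.run]
    rw [ih]
    congr 3

/-- Induction on the latest step: first the states differ under a common input (contraction), then
the inputs differ at a common state. An input `s` steps back has since been damped `s` times. -/
theorem RRRParam.Contracts.run_sub_le (h : θ.Contracts αmin b r) {ρ ρ' : QMat n}
    (hρ : IsDensity ρ) (hρ' : IsDensity ρ') (k : ℕ) :
    ∀ {v v' : ℕ → ℝ}, (∀ t, v t ∈ Set.Icc (0 : ℝ) b) → (∀ t, v' t ∈ Set.Icc (0 : ℝ) b) →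
    hsNorm (θ.run ρ k v - θ.run ρ' k v') ≤ r ^ k * hsNorm (ρ - ρ') +
      2 * (1 - αmin) * ∑ s ∈ Finset.range k, r ^ s * |v s - v' s| := by
  induction k with
  | zero => intro v v' _ _; simp [RRRParam.run]
  | succ k ih =>
    intro v v' hv hv'
    have hd := h.run_isDensity hρ k fun t => hv (t + 1)
    have hd' := h.run_isDensity hρ' k fun t => hv' (t + 1)
    have h1 := h.contract _ (hv 0) _ _ hd hd'
    have h2 := h.valid.step_sub_input hd' (v 0) (v' 0)
    have h3 := mul_le_mul_of_nonneg_left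
      (ih (fun t => hv (t + 1)) (fun t => hv' (t + 1))) h.r_nonneg
    have h4 : hsNorm (θ.run ρ (k + 1) v - θ.run ρ' (k + 1) v') ≤
        hsNorm (θ.step (θ.run ρ k fun t => v (t + 1)) (v 0) -
          θ.step (θ.run ρ' k fun t => v' (t + 1)) (v 0)) +
        hsNorm (θ.step (θ.run ρ' k fun t => v' (t + 1)) (v 0) -
          θ.step (θ.run ρ' k fun t => v' (t + 1)) (v' 0)) := by
      refine le_trans (le_of_eq ?_) (hsNorm_add_le _ _)
      simp [RRRParam.run]
    refine h4.trans ((add_le_add (h1.trans h3) h2).trans (le_of_eq ?_))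
    rw [Finset.sum_range_succ', mul_add, mul_add, Finset.mul_sum, Finset.mul_sum, Finset.mul_sum]
    simp only [pow_succ, pow_zero, one_mul]
    have : ∀ i, r * (2 * (1 - αmin) * (r ^ i * |v (i + 1) - v' (i + 1)|)) =
        2 * (1 - αmin) * (r ^ i * r * |v (i + 1) - v' (i + 1)|) := fun i => by ring
    simp only [this]
    ring

theorem RRRParam.IsTrajectory.eq_run {v : ℕ → ℝ} {x : ℕ → QMat n} (hx : θ.IsTrajectory v x)
    (k : ℕ) : ∀ j, x j = θ.run (x (j + k)) k fun t => v (t + j) := by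
  induction k with
  | zero => intro j; simp [RRRParam.run]
  | succ k ih =>
    intro j
    rw [(hx j).2, ih (j + 1), RRRParam.run]
    simp only [Nat.zero_add]
    congr 2
    · congr 1; omega
    · funext t; congr 1; omega

theorem RRRParam.continuous_step (θ : RRRParam n) {X : Type*} [TopologicalSpace X]
    {f : X → QMat n} {g : X → ℝ} (hf : Continuous f) (hg : Continuous g) :
    Continuous fun x => θ.step (f x) (g x) := by
  have h0 : Continuous θ.T0 := LinearMap.continuous_of_finiteDimensional _
  have h1 : Continuous θ.T1 := LinearMap.continuous_of_finiteDimensional _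
  have h2 : Continuous fun x => θ.T0 (f x) := h0.comp hf
  have h3 : Continuous fun x => θ.T1 (f x) := h1.comp hf
  unfold RRRParam.step
  have h4 : Continuous fun x => g x • θ.T0 (f x) := hg.smul h2
  have h5 : Continuous fun x => (1 - g x) • θ.T1 (f x) := (continuous_const.sub hg).smul h3
  exact ((h4.add h5).const_smul (1 - θ.α)).add continuous_const

theorem RRRParam.continuous_run (θ : RRRParam n) (ρ : QMat n) (k : ℕ) :
    Continuous fun v => θ.run ρ k v := by
  induction k with
  | zero => exact continuous_const
  | succ k ih =>
    have : Continuous fun v : ℕ → ℝ => fun t => v (t + 1) := by fun_prop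
    simp only [RRRParam.run]
    exact θ.continuous_step (ih.comp this) (continuous_apply 0)

theorem isClosed_isDensity : IsClosed {ρ : QMat n | IsDensity ρ} := by
  have : {ρ : QMat n | IsDensity ρ} = {ρ | ρ.PosSemidef} ∩ {ρ | ρ.trace = 1} := rfl
  rw [this]
  refine IsClosed.inter ?_ (isClosed_eq (by fun_prop) continuous_const)
  simp only [Matrix.posSemidef_iff_dotProduct_mulVec, Set.ofPred_and, Set.ofPred_forall]
  refine IsClosed.inter ?_ (isClosed_iInter fun x => ?_)
  · exact isClosed_eq (by fun_prop) (by fun_prop)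
  · exact isClosed_le continuous_const (by fun_prop)

/-- By `RRRParam.run_add`, the run of length `k + 1` is a run of length `k` from another density
matrix, so consecutive runs differ by at most `r ^ k`. -/
theorem RRRParam.Contracts.exists_limit (h : θ.Contracts αmin b r) {v : ℕ → ℝ}
    (hv : ∀ t, v t ∈ Set.Icc (0 : ℝ) b) :
    ∃ ρ : QMat n, Filter.Tendsto (fun k => θ.run (maxMixed n) k v) Filter.atTop (nhds ρ) := by
  have hc : CauchySeq fun k => hsVec (θ.run (maxMixed n) k v) := by
    refine cauchySeq_of_le_geometric r 1 h.r_lt_one fun k => ?_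
    rw [θ.run_add _ k 1, dist_comm, dist_eq_norm]
    have h1 := h.run_sub_le (h.run_isDensity isDensity_maxMixed 1 fun t => hv (t + k))
      isDensity_maxMixed k hv hv
    have h2 := (h.run_isDensity isDensity_maxMixed 1
      fun t => hv (t + k)).hsNorm_sub_maxMixed_le
    rw [hsNorm_eq_norm_hsVec] at h1
    refine h1.trans ?_
    have := mul_le_mul_of_nonneg_left h2 (pow_nonneg h.r_nonneg k)
    simpa using this
  obtain ⟨a, ha⟩ := cauchySeq_tendsto_of_complete hc
  refine ⟨Matrix.of fun i j => a (i, j), tendsto_pi_nhds.2 fun i => tendsto_pi_nhds.2 fun j => ?_⟩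
  exact ((EuclideanSpace.proj (𝕜 := ℂ) (i, j)).continuous.tendsto a).comp ha

/-- The state at time `-k` is the limit of ever longer runs along the inputs up to that time.
Continuity of the step carries the recursion to the limit, and density matrices form a closed set.
-/
theorem RRRParam.Contracts.exists_isTrajectory (h : θ.Contracts αmin b r) {v : ℕ → ℝ}
    (hv : ∀ t, v t ∈ Set.Icc (0 : ℝ) b) : ∃ x, θ.IsTrajectory v x := by
  choose x hx using fun k => h.exists_limit (v := fun t => v (t + k)) fun t => hv (t + k)
  refine ⟨x, fun k => ⟨?_, ?_⟩⟩
  · exact isClosed_isDensity.mem_of_tendsto (hx k)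
      (Filter.Eventually.of_forall fun l =>
        h.run_isDensity isDensity_maxMixed l fun t => hv (t + k))
  · have h1 := (hx k).comp (Filter.tendsto_add_atTop_nat 1)
    have h2 : Continuous fun ρ : QMat n => θ.step ρ (v k) :=
      θ.continuous_step continuous_id continuous_const
    have h3 := (h2.tendsto (x (k + 1))).comp (hx (k + 1))
    refine tendsto_nhds_unique h1 (h3.congr fun l => ?_)
    simp only [Function.comp, RRRParam.run, Nat.zero_add]
    congr 2
    funext t; congr 1; omega

theorem RRRParam.Contracts.isTrajectory_state (h : θ.Contracts αmin b r) {v : ℕ → ℝ}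
    (hv : ∀ t, v t ∈ Set.Icc (0 : ℝ) b) : θ.IsTrajectory v (θ.state v) := by
  have hex := h.exists_isTrajectory hv
  rw [RRRParam.state, dif_pos hex]
  exact hex.choose_spec

/-- Unrolled `k` steps, the state is a run from its own value at time `-k`. This applies to
whichever trajectory `RRRParam.state` selects, so uniqueness of the trajectory is not needed. -/
theorem RRRParam.Contracts.state_sub_run_le (h : θ.Contracts αmin b r) {v v' : ℕ → ℝ}
    (hv : ∀ t, v t ∈ Set.Icc (0 : ℝ) b) (hv' : ∀ t, v' t ∈ Set.Icc (0 : ℝ) b) (k : ℕ) :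
    hsNorm (θ.state v 0 - θ.run (maxMixed n) k v') ≤ r ^ k +
      2 * (1 - αmin) * ∑ s ∈ Finset.range k, r ^ s * |v s - v' s| := by
  have ht := h.isTrajectory_state hv
  have h1 := h.run_sub_le (ht k).1 isDensity_maxMixed k hv hv'
  have h2 := mul_le_mul_of_nonneg_left (ht k).1.hsNorm_sub_maxMixed_le (pow_nonneg h.r_nonneg k)
  have h3 := ht.eq_run k 0
  simp only [Nat.zero_add, Nat.add_zero] at h3
  rw [← h3] at h1
  linarith

theorem RRRParam.Contracts.run_sub_run_le (h : θ.Contracts αmin b r) {v v' : ℕ → ℝ}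
    (hv : ∀ t, v t ∈ Set.Icc (0 : ℝ) b) (hv' : ∀ t, v' t ∈ Set.Icc (0 : ℝ) b) (k l : ℕ) :
    hsNorm (θ.run (maxMixed n) (k + l) v - θ.run (maxMixed n) k v') ≤ r ^ k +
      2 * (1 - αmin) * ∑ s ∈ Finset.range k, r ^ s * |v s - v' s| := by
  have hd := h.run_isDensity isDensity_maxMixed l fun t => hv (t + k)
  have h1 := h.run_sub_le hd isDensity_maxMixed k hv hv'
  have h2 := mul_le_mul_of_nonneg_left hd.hsNorm_sub_maxMixed_le (pow_nonneg h.r_nonneg k)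
  rw [← θ.run_add] at h1
  linarith

end Run
/-! ### Polynomial readouts -/

section Readout

variable {n R : ℕ}

/-- The non-zero exponents of total degree at most `R`. -/
def expSet (n R : ℕ) : Finset (Fin n →₀ ℕ) :=
  ((Finset.range (R + 1)).biUnion fun d => Finset.finsuppAntidiag Finset.univ d).erase 0

theorem mem_expSet {a : Fin n →₀ ℕ} : a ∈ expSet n R ↔ a ≠ 0 ∧ ∑ i, a i ≤ R := by
  simp [expSet, Finset.mem_finsuppAntidiag]

/-- Stars and bars in each degree, summed by Pascal's rule. -/
theorem sum_card_finsuppAntidiag_le (n R : ℕ) :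
    ∑ d ∈ Finset.range (R + 1), (Finset.finsuppAntidiag (Finset.univ : Finset (Fin n)) d).card
      ≤ (n + R).choose R := by
  induction R with
  | zero => simp
  | succ R ih =>
    rw [Finset.sum_range_succ]
    refine (Nat.add_le_add_right ih _).trans ?_
    rw [Finset.card_finsuppAntidiag_nat_eq_choose, Finset.card_univ, Fintype.card_fin,
      show n + (R + 1) - 1 = n + R by omega, ← Nat.choose_succ_succ]
    rfl

theorem card_expSet_le (n R : ℕ) : ((expSet n R).card : ℝ) ≤ numMonomials n R := by
  have h0 : (0 : Fin n →₀ ℕ) ∈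
      (Finset.range (R + 1)).biUnion fun d => Finset.finsuppAntidiag Finset.univ d := by
    simp [Finset.mem_finsuppAntidiag]
  have h1 := Finset.card_erase_add_one h0
  have h2 : (expSet n R).card + 1 ≤ (n + R).choose R :=
    (le_of_eq h1).trans (Finset.card_biUnion_le.trans (sum_card_finsuppAntidiag_le n R))
  have h3 : ((expSet n R).card : ℝ) + 1 ≤ ((n + R).choose R : ℝ) := by exact_mod_cast h2
  rw [numMonomials]
  linarith

theorem numMonomials_nonneg (n R : ℕ) : 0 ≤ numMonomials n R :=
  le_trans (Nat.cast_nonneg _) (card_expSet_le n R)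

theorem numMonomials_zero_right (n : ℕ) : numMonomials n 0 = 0 := by simp [numMonomials]

theorem lipPoly_nonneg (n R : ℕ) : 0 ≤ lipPoly n R := by
  have := numMonomials_nonneg n R
  unfold lipPoly
  positivity

theorem numMonomials_le_mul (n R : ℕ) : numMonomials n R ≤ R * numMonomials n R := by
  rcases Nat.eq_zero_or_pos R with rfl | hR
  · simp [numMonomials_zero_right]
  · have : (1 : ℝ) ≤ R := by exact_mod_cast hR
    nlinarith [numMonomials_nonneg n R]

/-- The monomial function with exponent `a`. -/
def monoVal (z : Fin n → ℝ) (a : Fin n →₀ ℕ) : ℝ := ∏ i, z i ^ a i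

/-- Telescoping: the factors are exchanged one at a time, and all the others are bounded by 1. -/
theorem abs_prod_sub_prod_le {ι : Type*} (s : Finset ι) {x y : ι → ℝ}
    (hx : ∀ i, |x i| ≤ 1) (hy : ∀ i, |y i| ≤ 1) :
    |∏ i ∈ s, x i - ∏ i ∈ s, y i| ≤ ∑ i ∈ s, |x i - y i| := by
  classical
  induction s using Finset.induction_on with
  | empty => simp
  | insert i s hi ih =>
    rw [Finset.prod_insert hi, Finset.prod_insert hi, Finset.sum_insert hi]
    have e : x i * ∏ j ∈ s, x j - y i * ∏ j ∈ s, y j =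
        (x i - y i) * ∏ j ∈ s, x j + y i * (∏ j ∈ s, x j - ∏ j ∈ s, y j) := by ring
    have h1 : |∏ j ∈ s, x j| ≤ 1 := by
      rw [Finset.abs_prod]
      exact Finset.prod_le_one (fun _ _ => abs_nonneg _) fun j _ => hx j
    rw [e]
    refine (abs_add_le _ _).trans ?_
    rw [abs_mul, abs_mul]
    have h2 := mul_le_mul_of_nonneg_left h1 (abs_nonneg (x i - y i))
    have h3 := mul_le_mul_of_nonneg_right (hy i) (abs_nonneg (∏ j ∈ s, x j - ∏ j ∈ s, y j))
    linarith

theorem abs_pow_sub_pow_le {x y : ℝ} (hx : |x| ≤ 1) (hy : |y| ≤ 1) (k : ℕ) :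
    |x ^ k - y ^ k| ≤ k * |x - y| := by
  have := abs_prod_sub_prod_le (Finset.range k) (x := fun _ => x) (y := fun _ => y)
    (fun _ => hx) (fun _ => hy)
  simpa using this

theorem abs_monoVal_le {z : Fin n → ℝ} (hz : ∀ i, |z i| ≤ 1) (a : Fin n →₀ ℕ) :
    |monoVal z a| ≤ 1 := by
  rw [monoVal, Finset.abs_prod]
  refine Finset.prod_le_one (fun _ _ => abs_nonneg _) fun i _ => ?_
  rw [abs_pow]
  exact pow_le_one₀ (abs_nonneg _) (hz i)

theorem abs_monoVal_sub_le {z z' : Fin n → ℝ} (hz : ∀ i, |z i| ≤ 1) (hz' : ∀ i, |z' i| ≤ 1)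
    {D : ℝ} (hD0 : 0 ≤ D) (hD : ∀ i, |z i - z' i| ≤ D) {a : Fin n →₀ ℕ} (ha : ∑ i, a i ≤ R) :
    |monoVal z a - monoVal z' a| ≤ R * D := by
  have hp : ∀ {w : Fin n → ℝ}, (∀ i, |w i| ≤ 1) → ∀ i, |w i ^ a i| ≤ 1 := fun hw i => by
    rw [abs_pow]; exact pow_le_one₀ (abs_nonneg _) (hw i)
  refine (abs_prod_sub_prod_le Finset.univ (hp hz) (hp hz')).trans ?_
  calc ∑ i, |z i ^ a i - z' i ^ a i| ≤ ∑ i, (a i : ℝ) * D :=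
        Finset.sum_le_sum fun i _ => (abs_pow_sub_pow_le (hz i) (hz' i) (a i)).trans
          (mul_le_mul_of_nonneg_left (hD i) (Nat.cast_nonneg _))
    _ = ((∑ i, a i : ℕ) : ℝ) * D := by rw [← Finset.sum_mul]; push_cast; rfl
    _ ≤ R * D := mul_le_mul_of_nonneg_right (by exact_mod_cast ha) hD0

/-- Coefficients of a readout polynomial: the constant term and the others. -/
abbrev Coef (n R : ℕ) : Type := ℝ × (expSet n R → ℝ)

/-- The bounds on the coefficients. -/
def Coef.Bounded (c : Coef n R) (Cmax : ℝ) : Prop := |c.1| ≤ Cmax ∧ ∀ a, |c.2 a| ≤ 1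

/-- The polynomial function with given coefficients. -/
def Coef.val (c : Coef n R) (z : Fin n → ℝ) : ℝ := c.1 + ∑ a, c.2 a * monoVal z a.1

/-- Readouts become points of a finite-dimensional space. This makes them linear in finitely many
features and gives a separable parameter space for the final density argument. -/
theorem IsReadoutPoly.exists_coef {Cmax : ℝ} {p : MvPolynomial (Fin n) ℝ}
    (hp : IsReadoutPoly R Cmax p) :
    ∃ c : Coef n R, c.Bounded Cmax ∧ ∀ z, MvPolynomial.eval z p = c.val z := by
  refine ⟨(p.coeff 0, fun a => p.coeff a.1), ⟨hp.2.1, fun a => hp.2.2 _ (mem_expSet.1 a.2).1⟩,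
    fun z => ?_⟩
  have hs : p.support ⊆ insert 0 (expSet n R) := by
    intro a ha
    rw [Finset.mem_insert, mem_expSet]
    by_cases h0 : a = 0
    · exact Or.inl h0
    · refine Or.inr ⟨h0, ?_⟩
      have h1 := (MvPolynomial.le_totalDegree ha).trans hp.1
      rwa [Finsupp.sum_fintype _ _ (fun _ => rfl)] at h1
  rw [MvPolynomial.eval_eq', Finset.sum_subset hs, Finset.sum_insert]
  · simp only [Coef.val, monoVal]
    congr 1
    · simp
    · exact (Finset.sum_coe_sort (expSet n R) fun a => p.coeff a * ∏ i, z i ^ a i).symm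
  · simp [mem_expSet]
  · intro a _ ha
    rw [MvPolynomial.notMem_support_iff.1 ha, zero_mul]

theorem Coef.Bounded.abs_val_sub_le {c : Coef n R} {Cmax : ℝ} (hc : c.Bounded Cmax)
    {ρ σ : QMat n} (hρ : IsDensity ρ) (hσ : IsDensity σ) :
    |c.val (zExp ρ) - c.val (zExp σ)| ≤ lipPoly n R * hsNorm (ρ - σ) := by
  -- With no qubits `lipPoly` vanishes, but so does the left side, as there are no non-constant
  -- monomials. For `n ≥ 1` the factor `n` in `lipPoly` only enlarges the bound.
  rcases Nat.eq_zero_or_pos n with rfl | hn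
  · have : IsEmpty (expSet 0 R) :=
      ⟨fun a => (mem_expSet.1 a.2).1 (by ext i; exact i.elim0)⟩
    simp [Coef.val, lipPoly]
  have hD : ∀ i, |zExp ρ i - zExp σ i| ≤ Real.sqrt (2 ^ n) * hsNorm (ρ - σ) :=
    abs_zExp_sub_le ρ σ
  have hD0 : 0 ≤ Real.sqrt (2 ^ n) * hsNorm (ρ - σ) :=
    mul_nonneg (Real.sqrt_nonneg _) (hsNorm_nonneg _)
  have e : c.val (zExp ρ) - c.val (zExp σ) =
      ∑ a, c.2 a * (monoVal (zExp ρ) a.1 - monoVal (zExp σ) a.1) := by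
    simp [Coef.val, mul_sub, Finset.sum_sub_distrib]
  rw [e]
  have hnn : (1 : ℝ) ≤ n := by exact_mod_cast hn
  calc |∑ a, c.2 a * (monoVal (zExp ρ) a.1 - monoVal (zExp σ) a.1)|
      ≤ ∑ a : expSet n R, R * (Real.sqrt (2 ^ n) * hsNorm (ρ - σ)) := by
        refine (Finset.abs_sum_le_sum_abs _ _).trans (Finset.sum_le_sum fun a _ => ?_)
        rw [abs_mul]
        have h1 := abs_monoVal_sub_le hρ.abs_zExp_le_one hσ.abs_zExp_le_one hD0 hD
          (mem_expSet.1 a.2).2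
        have h2 := mul_le_mul_of_nonneg_right (hc.2 a)
          (abs_nonneg (monoVal (zExp ρ) a.1 - monoVal (zExp σ) a.1))
        linarith
    _ = (expSet n R).card * (R * (Real.sqrt (2 ^ n) * hsNorm (ρ - σ))) := by simp
    _ ≤ numMonomials n R * (R * (Real.sqrt (2 ^ n) * hsNorm (ρ - σ))) :=
        mul_le_mul_of_nonneg_right (card_expSet_le n R) (by positivity)
    _ ≤ n * (numMonomials n R * (R * (Real.sqrt (2 ^ n) * hsNorm (ρ - σ)))) := by
        have : 0 ≤ numMonomials n R * (R * (Real.sqrt (2 ^ n) * hsNorm (ρ - σ))) :=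
          mul_nonneg (numMonomials_nonneg n R) (by positivity)
        nlinarith
    _ = lipPoly n R * hsNorm (ρ - σ) := by rw [lipPoly]; ring

theorem Coef.abs_val_sub_val_le (c c' : Coef n R) {z : Fin n → ℝ} (hz : ∀ i, |z i| ≤ 1) :
    |c.val z - c'.val z| ≤ |c.1 - c'.1| + ∑ a, |c.2 a - c'.2 a| := by
  have e : c.val z - c'.val z = (c.1 - c'.1) + ∑ a, (c.2 a - c'.2 a) * monoVal z a.1 := by
    simp only [Coef.val, sub_mul, Finset.sum_sub_distrib]; ring
  rw [e]
  refine (abs_add_le _ _).trans (add_le_add le_rfl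
    ((Finset.abs_sum_le_sum_abs _ _).trans (Finset.sum_le_sum fun a _ => ?_)))
  rw [abs_mul]
  have := mul_le_mul_of_nonneg_left (abs_monoVal_le hz a.1) (abs_nonneg (c.2 a - c'.2 a))
  linarith

end Readout
/-! ### Symmetrisation and contraction for finite suprema -/

section Rademacher

variable {ι : Type*} [Fintype ι] {S : Type*} [MeasurableSpace S] {ν : Measure S}
  [IsProbabilityMeasure ν]

/-- Convex `1`-Lipschitz functionals that satisfy the contraction inequality of Rademacher
averages. -/
structure IsContractive (Ψ : (ι → ℝ) → ℝ) : Prop where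
  convex : ConvexOn ℝ Set.univ Ψ
  lipschitz : LipschitzWith 1 Ψ
  contract : ∀ A u v : ι → ℝ, (∀ j l, |u j - u l| ≤ |v j - v l|) →
    Ψ (A + u) + Ψ (A - u) ≤ Ψ (A + v) + Ψ (A - v)

theorem le_iSup_fintype (A : ι → ℝ) (j : ι) : A j ≤ ⨆ l, A l :=
  le_ciSup (Set.finite_range A).bddAbove j

theorem isContractive_iSup [Nonempty ι] : IsContractive fun A : ι → ℝ => ⨆ j, A j where
  convex := by
    refine ⟨convex_univ, fun A _ B _ a b ha hb _ => ciSup_le fun j => ?_⟩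
    simp only [Pi.add_apply, Pi.smul_apply, smul_eq_mul]
    exact add_le_add (mul_le_mul_of_nonneg_left (le_iSup_fintype A j) ha)
      (mul_le_mul_of_nonneg_left (le_iSup_fintype B j) hb)
  lipschitz := by
    refine LipschitzWith.of_le_add fun A B => ciSup_le fun j => ?_
    have h1 := le_iSup_fintype B j
    have h2 := dist_le_pi_dist A B j
    rw [Real.dist_eq] at h2
    linarith [le_abs_self (A j - B j)]
  contract := by
    intro A u v huv
    -- Let `j` and `l` attain the two suprema on the left. The gap `u j - u l` is at most `|v j - v
    -- l|`, so one of the assignments of `j`, `l` to `A + v`, `A - v` does at least as well,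
    -- according to the sign of `v j - v l`.
    obtain ⟨j, hj⟩ := exists_eq_ciSup_of_finite (f := A + u)
    obtain ⟨l, hl⟩ := exists_eq_ciSup_of_finite (f := A - u)
    have h1 := le_iSup_fintype (A + v) j
    have h2 := le_iSup_fintype (A - v) j
    have h3 := le_iSup_fintype (A + v) l
    have h4 := le_iSup_fintype (A - v) l
    have h5 := (le_abs_self _).trans (huv j l)
    simp only [Pi.add_apply, Pi.sub_apply] at h1 h2 h3 h4 hj hl ⊢
    rw [← hj, ← hl]
    rcases abs_cases (v j - v l) with ⟨h, _⟩ | ⟨h, _⟩ <;> rw [h] at h5 <;> linarith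

theorem IsContractive.half_add {Ψ Φ : (ι → ℝ) → ℝ} (hΨ : IsContractive Ψ)
    (hΦ : IsContractive Φ) : IsContractive fun A => (Ψ A + Φ A) / 2 where
  convex := by
    refine ⟨convex_univ, fun A hA B hB a b ha hb hab => ?_⟩
    have h1 := hΨ.convex.2 hA hB ha hb hab
    have h2 := hΦ.convex.2 hA hB ha hb hab
    simp only [smul_eq_mul] at h1 h2 ⊢
    linarith
  lipschitz := by
    refine LipschitzWith.of_le_add fun A B => ?_
    have h1 := hΨ.lipschitz.le_add_mul A B
    have h2 := hΦ.lipschitz.le_add_mul A B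
    simp only [NNReal.coe_one, one_mul] at h1 h2
    linarith
  contract A u v huv := by
    have h1 := hΨ.contract A u v huv
    have h2 := hΦ.contract A u v huv
    linarith

theorem IsContractive.integrable {Ψ : (ι → ℝ) → ℝ} (hΨ : IsContractive Ψ) {B : S → ι → ℝ}
    (hB : Measurable B) {K : ℝ} (hK : ∀ x, ‖B x‖ ≤ K) (A : ι → ℝ) :
    Integrable (fun x => Ψ (A + B x)) ν := by
  refine Integrable.of_bound (C := |Ψ A| + K)
    (hΨ.lipschitz.continuous.measurable.comp (measurable_const.add hB)).aestronglyMeasurable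
    (Filter.Eventually.of_forall fun x => ?_)
  have h1 := hΨ.lipschitz.dist_le_mul (A + B x) A
  rw [Real.dist_eq, NNReal.coe_one, one_mul, dist_eq_norm, add_sub_cancel_left] at h1
  rw [Real.norm_eq_abs]
  have h2 := abs_sub_abs_le_abs_sub (Ψ (A + B x)) (Ψ A)
  linarith [hK x]

/-- All three properties survive averaging over random translations. Independent summands can
therefore be integrated one by one, the result being again a functional of the same kind. -/
theorem IsContractive.average {Ψ : (ι → ℝ) → ℝ} (hΨ : IsContractive Ψ) {B : S → ι → ℝ}
    (hB : Measurable B) {K : ℝ} (hK : ∀ x, ‖B x‖ ≤ K) :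
    IsContractive fun A => ∫ x, Ψ (A + B x) ∂ν where
  convex := by
    refine ⟨convex_univ, fun A _ A' _ a b ha hb hab => ?_⟩
    simp only [smul_eq_mul]
    rw [← integral_const_mul, ← integral_const_mul, ← integral_add
      ((hΨ.integrable hB hK A).const_mul a) ((hΨ.integrable hB hK A').const_mul b)]
    refine integral_mono (hΨ.integrable hB hK _)
      (((hΨ.integrable hB hK A).const_mul a).add ((hΨ.integrable hB hK A').const_mul b))
      fun x => ?_
    have := hΨ.convex.2 (Set.mem_univ (A + B x)) (Set.mem_univ (A' + B x)) ha hb hab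
    simp only [smul_eq_mul] at this
    refine le_trans (le_of_eq ?_) this
    congr 1
    rw [smul_add, smul_add, add_add_add_comm, ← add_smul, hab, one_smul]
  lipschitz := by
    refine LipschitzWith.of_le_add fun A A' => ?_
    have : ∫ x, Ψ (A' + B x) ∂ν + dist A A' = ∫ x, (Ψ (A' + B x) + dist A A') ∂ν := by
      rw [integral_add (hΨ.integrable hB hK A') (integrable_const _)]
      simp
    rw [this]
    refine integral_mono (hΨ.integrable hB hK A)
      ((hΨ.integrable hB hK A').add (integrable_const _)) fun x => ?_
    have h1 := hΨ.lipschitz.le_add_mul (A + B x) (A' + B x)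
    simpa using h1
  contract A u v huv := by
    rw [← integral_add (hΨ.integrable hB hK _) (hΨ.integrable hB hK _),
      ← integral_add (hΨ.integrable hB hK _) (hΨ.integrable hB hK _)]
    refine integral_mono ((hΨ.integrable hB hK _).add (hΨ.integrable hB hK _))
      ((hΨ.integrable hB hK _).add (hΨ.integrable hB hK _)) fun x => ?_
    have := hΨ.contract (A + B x) u v huv
    rw [add_right_comm, add_right_comm A (B x) v, add_sub_right_comm,
      add_sub_right_comm A (B x) v] at this
    exact this

variable (ν) in
/-- Averaging over one centred summand. -/
def centredStep (f : S → ι → ℝ) (Ψ : (ι → ℝ) → ℝ) (A : ι → ℝ) : ℝ :=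
  ∫ x, Ψ (A + (∫ y, f y ∂ν - f x)) ∂ν

variable (ν) in
/-- Averaging over one symmetrised summand. -/
def signedStep (L : ℝ) (h : S → ι → ℝ) (Ψ : (ι → ℝ) → ℝ) (A : ι → ℝ) : ℝ :=
  (∫ x, Ψ (A + (2 * L) • h x) ∂ν + ∫ x, Ψ (A + -((2 * L) • h x)) ∂ν) / 2

variable {f h : S → ι → ℝ} {K L : ℝ}

theorem norm_centred_le (hK : ∀ x, ‖f x‖ ≤ K) (x : S) : ‖∫ y, f y ∂ν - f x‖ ≤ K + K := by
  refine (norm_sub_le _ _).trans (add_le_add ?_ (hK x))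
  have := norm_integral_le_of_norm_le_const (μ := ν) (Filter.Eventually.of_forall hK)
  simpa using this

omit [MeasurableSpace S] in
theorem norm_smul_le_of_le (hK : ∀ x, ‖h x‖ ≤ K) (a : ℝ) (x : S) : ‖a • h x‖ ≤ |a| * K := by
  rw [norm_smul, Real.norm_eq_abs]
  exact mul_le_mul_of_nonneg_left (hK x) (abs_nonneg a)

theorem IsContractive.centredStep {Ψ : (ι → ℝ) → ℝ} (hΨ : IsContractive Ψ)
    (hf : Measurable f) (hK : ∀ x, ‖f x‖ ≤ K) : IsContractive (centredStep ν f Ψ) :=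
  hΨ.average (measurable_const.sub hf) (norm_centred_le hK)

theorem IsContractive.signedStep {Ψ : (ι → ℝ) → ℝ} (hΨ : IsContractive Ψ)
    (hh : Measurable h) (hK : ∀ x, ‖h x‖ ≤ K) : IsContractive (signedStep ν L h Ψ) :=
  (hΨ.average (hh.const_smul (2 * L)) (norm_smul_le_of_le hK _)).half_add
    (hΨ.average (hh.const_smul (2 * L)).neg (K := |2 * L| * K) fun x => by
      simpa using norm_smul_le_of_le hK (2 * L) x)

/-- Symmetrisation without a ghost sample. Convexity splits the centred summand into the halves `2 •
∫ f` and `-2 • f`; Jensen's inequality replaces the first by an average of `2 • f`. The contraction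
property then exchanges `±2 • f` for `±(2 * L) • h` at each `x`. -/
theorem IsContractive.centredStep_le_signedStep {Ψ : (ι → ℝ) → ℝ} (hΨ : IsContractive Ψ)
    (hf : Measurable f) (hK : ∀ x, ‖f x‖ ≤ K) (hh : Measurable h) (hK' : ∀ x, ‖h x‖ ≤ K)
    (hL : 0 ≤ L) (hfh : ∀ x j l, |f x j - f x l| ≤ L * |h x j - h x l|) (A : ι → ℝ) :
    QRC.centredStep ν f Ψ A ≤ QRC.signedStep ν L h Ψ A := by
  have hif : Integrable f ν := Integrable.of_bound hf.aestronglyMeasurable K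
    (Filter.Eventually.of_forall hK)
  have i1 : Integrable (fun x => Ψ (A + (2 : ℝ) • f x)) ν :=
    hΨ.integrable (hf.const_smul (2 : ℝ)) (norm_smul_le_of_le hK 2) A
  have i2 : Integrable (fun x => Ψ (A - (2 : ℝ) • f x)) ν := by
    simp only [sub_eq_add_neg]
    exact hΨ.integrable (hf.const_smul (2 : ℝ)).neg (K := |2| * K)
      (fun x => by simpa using norm_smul_le_of_le hK 2 x) A
  have i3 : Integrable (fun x => Ψ (A + (2 * L) • h x)) ν :=
    hΨ.integrable (hh.const_smul (2 * L)) (norm_smul_le_of_le hK' (2 * L)) A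
  have i4 : Integrable (fun x => Ψ (A + -((2 * L) • h x))) ν :=
    hΨ.integrable (hh.const_smul (2 * L)).neg (K := |2 * L| * K)
      (fun x => by simpa using norm_smul_le_of_le hK' (2 * L) x) A
  have hif2 : Integrable (fun x => (2 : ℝ) • f x) ν := hif.smul (2 : ℝ)
  have hJ : Ψ (A + (2 : ℝ) • ∫ y, f y ∂ν) ≤ ∫ x, Ψ (A + (2 : ℝ) • f x) ∂ν := by
    have h1 := hΨ.convex.map_integral_le (μ := ν) (f := fun x => A + (2 : ℝ) • f x)
      hΨ.lipschitz.continuous.continuousOn isClosed_univ (by simp)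
      ((integrable_const A).add hif2) i1
    rwa [integral_add (integrable_const A) hif2, integral_smul, integral_const,
      probReal_univ, one_smul] at h1
  have h1 : QRC.centredStep ν f Ψ A ≤
      ∫ x, (Ψ (A + (2 : ℝ) • ∫ y, f y ∂ν) + Ψ (A - (2 : ℝ) • f x)) / 2 ∂ν := by
    refine integral_mono (hΨ.integrable (measurable_const.sub hf) (norm_centred_le hK) A)
      (((integrable_const _).add i2).div_const 2) fun x => ?_
    have := hΨ.convex.2 (Set.mem_univ (A + (2 : ℝ) • ∫ y, f y ∂ν))
      (Set.mem_univ (A - (2 : ℝ) • f x)) (by norm_num : (0 : ℝ) ≤ 1 / 2)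
      (by norm_num : (0 : ℝ) ≤ 1 / 2) (by norm_num)
    simp only [smul_eq_mul] at this
    have e : (1 / 2 : ℝ) • (A + (2 : ℝ) • ∫ y, f y ∂ν) + (1 / 2 : ℝ) • (A - (2 : ℝ) • f x) =
        A + (∫ y, f y ∂ν - f x) := by
      ext j
      simp only [Pi.add_apply, Pi.sub_apply, Pi.smul_apply, smul_eq_mul]
      ring
    rw [e] at this
    linarith
  have h2 : ∫ x, (Ψ (A + (2 : ℝ) • ∫ y, f y ∂ν) + Ψ (A - (2 : ℝ) • f x)) / 2 ∂ν ≤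
      ∫ x, (Ψ (A + (2 : ℝ) • f x) + Ψ (A - (2 : ℝ) • f x)) / 2 ∂ν := by
    rw [integral_div, integral_div, integral_add (integrable_const _) i2, integral_add i1 i2]
    simp only [integral_const, probReal_univ, one_smul]
    linarith
  refine (h1.trans h2).trans ?_
  rw [QRC.signedStep, ← integral_add i3 i4, ← integral_div]
  refine integral_mono ((i1.add i2).div_const 2) ((i3.add i4).div_const 2) fun x => ?_
  have := hΨ.contract A ((2 : ℝ) • f x) ((2 * L) • h x) fun j l => by
    simp only [Pi.smul_apply, smul_eq_mul, ← mul_sub, abs_mul, abs_two, abs_of_nonneg hL]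
    linarith [hfh x j l]
  simp only [← sub_eq_add_neg]
  linarith

theorem IsContractive.iterate {T : ((ι → ℝ) → ℝ) → (ι → ℝ) → ℝ}
    (hT : ∀ Ψ, IsContractive Ψ → IsContractive (T Ψ)) {Ψ : (ι → ℝ) → ℝ} (hΨ : IsContractive Ψ)
    (k : ℕ) : IsContractive (T^[k] Ψ) := by
  induction k with
  | zero => exact hΨ
  | succ k ih => rw [Function.iterate_succ_apply']; exact hT _ ih

/-- The induction hypothesis is used under the outer centred average, and only then is that average
replaced by a signed one. This is why the iterated signed functional has to stay contractive. -/
theorem IsContractive.iterate_centredStep_le {Ψ : (ι → ℝ) → ℝ} (hΨ : IsContractive Ψ)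
    (hf : Measurable f) (hK : ∀ x, ‖f x‖ ≤ K) (hh : Measurable h) (hK' : ∀ x, ‖h x‖ ≤ K)
    (hL : 0 ≤ L) (hfh : ∀ x j l, |f x j - f x l| ≤ L * |h x j - h x l|) (k : ℕ) :
    ∀ A, (QRC.centredStep ν f)^[k] Ψ A ≤ (QRC.signedStep ν L h)^[k] Ψ A := by
  induction k with
  | zero => exact fun A => le_rfl
  | succ k ih =>
    intro A
    have c1 : IsContractive ((QRC.centredStep ν f)^[k] Ψ) :=
      IsContractive.iterate (fun Φ hΦ => hΦ.centredStep hf hK) hΨ k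
    have c2 : IsContractive ((QRC.signedStep ν L h)^[k] Ψ) :=
      IsContractive.iterate (fun Φ hΦ => hΦ.signedStep hh hK') hΨ k
    rw [Function.iterate_succ_apply', Function.iterate_succ_apply']
    refine le_trans ?_ (c2.centredStep_le_signedStep hf hK hh hK' hL hfh A)
    exact integral_mono (c1.integrable (measurable_const.sub hf) (norm_centred_le hK) A)
      (c2.integrable (measurable_const.sub hf) (norm_centred_le hK) A) fun x => ih _

/-- The mean of two numbers is at most their quadratic mean, and the cross terms `±2ab` cancel in
the mean of the squares. -/
theorem half_sqrt_add_sqrt_le {a b t c : ℝ} (hb : |b| ≤ c) (ht : 0 ≤ t) :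
    (Real.sqrt ((a + b) ^ 2 + t) + Real.sqrt ((a - b) ^ 2 + t)) / 2 ≤
      Real.sqrt (a ^ 2 + (t + c ^ 2)) := by
  apply Real.le_sqrt_of_sq_le
  have h1 := Real.sq_sqrt (show 0 ≤ (a + b) ^ 2 + t by positivity)
  have h2 := Real.sq_sqrt (show 0 ≤ (a - b) ^ 2 + t by positivity)
  have h3 : b ^ 2 ≤ c ^ 2 := sq_le_sq' (by linarith [neg_abs_le b]) ((le_abs_self b).trans hb)
  nlinarith [sq_nonneg (Real.sqrt ((a + b) ^ 2 + t) - Real.sqrt ((a - b) ^ 2 + t))]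

/-- As `h` is linear in the features, the argument of the functional keeps the form `∑ q, c j q * a
q`, and only the vector `a` moves. A signed step shifts each `a q` symmetrically by at most `2 * L`,
which adds at most `(2 * L) ^ 2` under the root. Neither the size of `ι` nor any independence
between features enters. -/
theorem iterate_signedStep_iSup_le [Nonempty ι] {Q : Type*} [Fintype Q] {c : ι → Q → ℝ}
    {C : Q → ℝ} (hC : ∀ j q, |c j q| ≤ C q) {g : S → Q → ℝ} (hg : ∀ x q, |g x q| ≤ 1)
    (hh : Measurable h) (hK : ∀ x, ‖h x‖ ≤ K) (hhg : ∀ x j, h x j = ∑ q, c j q * g x q)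
    (hL : 0 ≤ L) (k : ℕ) :
    ∀ a : Q → ℝ, (signedStep ν L h)^[k] (fun A : ι → ℝ => ⨆ j, A j) (fun j => ∑ q, c j q * a q) ≤
      ∑ q, C q * Real.sqrt (a q ^ 2 + k * (2 * L) ^ 2) := by
  have hC0 : ∀ q, 0 ≤ C q := fun q => (abs_nonneg _).trans (hC (Classical.arbitrary ι) q)
  induction k with
  | zero =>
    refine fun a => ciSup_le fun j => Finset.sum_le_sum fun q _ => ?_
    rw [Nat.cast_zero, zero_mul, add_zero, Real.sqrt_sq_eq_abs]
    refine (le_abs_self _).trans ?_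
    rw [abs_mul]
    exact mul_le_mul_of_nonneg_right (hC j q) (abs_nonneg _)
  | succ k ih =>
    intro a
    rw [Function.iterate_succ_apply']
    have hcon : IsContractive ((signedStep ν L h)^[k] (fun A : ι → ℝ => ⨆ j, A j)) :=
      IsContractive.iterate (fun Φ hΦ => hΦ.signedStep hh hK) isContractive_iSup k
    set Ψ := (signedStep ν L h)^[k] (fun A : ι → ℝ => ⨆ j, A j)
    have i3 : Integrable (fun x => Ψ ((fun j => ∑ q, c j q * a q) + (2 * L) • h x)) ν :=
      hcon.integrable (hh.const_smul (2 * L)) (norm_smul_le_of_le hK _) _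
    have i4 : Integrable (fun x => Ψ ((fun j => ∑ q, c j q * a q) + -((2 * L) • h x))) ν :=
      hcon.integrable (hh.const_smul (2 * L)).neg (K := |2 * L| * K)
        (fun x => by simpa using norm_smul_le_of_le hK (2 * L) x) _
    rw [signedStep, ← integral_add i3 i4, ← integral_div]
    refine (integral_mono ((i3.add i4).div_const 2) (integrable_const
      (∑ q, C q * Real.sqrt (a q ^ 2 + (k + 1 : ℕ) * (2 * L) ^ 2))) fun x => ?_).trans
        (by simp)
    have e1 : (fun j => ∑ q, c j q * a q) + (2 * L) • h x =
        fun j => ∑ q, c j q * (a q + 2 * L * g x q) := by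
      ext j
      simp only [Pi.add_apply, Pi.smul_apply, smul_eq_mul, hhg, Finset.mul_sum,
        ← Finset.sum_add_distrib]
      exact Finset.sum_congr rfl fun q _ => by ring
    have e2 : (fun j => ∑ q, c j q * a q) + -((2 * L) • h x) =
        fun j => ∑ q, c j q * (a q - 2 * L * g x q) := by
      ext j
      simp only [Pi.add_apply, Pi.neg_apply, Pi.smul_apply, smul_eq_mul, hhg, Finset.mul_sum,
        ← Finset.sum_neg_distrib, ← Finset.sum_add_distrib]
      exact Finset.sum_congr rfl fun q _ => by ring
    rw [Pi.add_apply, e1, e2]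
    have h1 := ih fun q => a q + 2 * L * g x q
    have h2 := ih fun q => a q - 2 * L * g x q
    have h3 : ∀ q, C q * Real.sqrt ((a q + 2 * L * g x q) ^ 2 + k * (2 * L) ^ 2) +
        C q * Real.sqrt ((a q - 2 * L * g x q) ^ 2 + k * (2 * L) ^ 2) ≤
        2 * (C q * Real.sqrt (a q ^ 2 + (k + 1 : ℕ) * (2 * L) ^ 2)) := by
      intro q
      have hb : |2 * L * g x q| ≤ 2 * L := by
        rw [abs_mul, abs_of_nonneg (by positivity : 0 ≤ 2 * L)]
        exact mul_le_of_le_one_right (by positivity) (hg x q)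
      have := mul_le_mul_of_nonneg_left (half_sqrt_add_sqrt_le (a := a q) hb
        (by positivity : (0 : ℝ) ≤ k * (2 * L) ^ 2)) (hC0 q)
      rw [show (k : ℝ) * (2 * L) ^ 2 + (2 * L) ^ 2 = (k + 1 : ℕ) * (2 * L) ^ 2 by
        push_cast; ring] at this
      linarith
    have h4 := Finset.sum_le_sum fun q (_ : q ∈ Finset.univ) => h3 q
    rw [Finset.sum_add_distrib, ← Finset.mul_sum] at h4
    linarith

variable {Ω : Type*} [MeasurableSpace Ω] {μ : Measure Ω} [IsProbabilityMeasure μ]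

theorem integral_comp_of_indepFun {S' : Type*} [MeasurableSpace S'] {X : Ω → S'} {W : Ω → S}
    (hX : Measurable X) (hW : Measurable W) (hind : IndepFun X W μ) {F : S' × S → ℝ}
    (hF : Measurable F) (hFi : Integrable (fun ω => F (X ω, W ω)) μ) :
    ∫ ω, F (X ω, W ω) ∂μ = ∫ ω, ∫ w, F (X ω, w) ∂(μ.map W) ∂μ := by
  have hm := (indepFun_iff_map_prod_eq_prod_map_map hX.aemeasurable hW.aemeasurable).1 hind
  have : IsProbabilityMeasure (μ.map W) := Measure.isProbabilityMeasure_map hW.aemeasurable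
  have : IsProbabilityMeasure (μ.map X) := Measure.isProbabilityMeasure_map hX.aemeasurable
  have h1 : ∫ ω, F (X ω, W ω) ∂μ = ∫ p, F p ∂(μ.map fun ω => (X ω, W ω)) :=
    (integral_map (hX.prodMk hW).aemeasurable hF.aestronglyMeasurable).symm
  have hi : Integrable F ((μ.map X).prod (μ.map W)) := by
    rw [← hm]
    exact (integrable_map_measure hF.aestronglyMeasurable (hX.prodMk hW).aemeasurable).2 hFi
  rw [h1, hm, integral_prod _ hi,
    integral_map hX.aemeasurable hF.stronglyMeasurable.integral_prod_right'.aestronglyMeasurable]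

/-- Fubini for one block at a time. The statement quantifies over `Ψ` because integrating out a
block turns `Ψ` into `centredStep ν f Ψ`, to which the induction hypothesis is applied. -/
theorem integral_centred_sum_eq (hf : Measurable f) (hK : ∀ x, ‖f x‖ ≤ K)
    {W : ℕ → Ω → S} (hW : ∀ i, Measurable (W i)) (hlaw : ∀ i, μ.map (W i) = ν) (J : Finset ℕ)
    (hind : ∀ J' ⊆ J, ∀ i ∈ J, i ∉ J' →
      IndepFun (fun ω => ∑ l ∈ J', (∫ y, f y ∂ν - f (W l ω))) (W i) μ) :
    ∀ Ψ : (ι → ℝ) → ℝ, IsContractive Ψ →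
    ∫ ω, Ψ (∑ l ∈ J, (∫ y, f y ∂ν - f (W l ω))) ∂μ = (centredStep ν f)^[J.card] Ψ 0 := by
  induction J using Finset.induction_on with
  | empty => intro Ψ _; simp
  | insert i J hi ih =>
    intro Ψ hΨ
    rw [Finset.card_insert_of_notMem hi, Function.iterate_succ_apply,
      ← ih (fun J' hJ' l hl => hind J' (hJ'.trans (Finset.subset_insert _ _)) l
        (Finset.mem_insert_of_mem hl)) _ (hΨ.centredStep hf hK)]
    have hm : Measurable fun ω => ∑ l ∈ J, (∫ y, f y ∂ν - f (W l ω)) :=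
      Finset.measurable_sum _ fun l _ => measurable_const.sub (hf.comp (hW l))
    have hF : Measurable fun p : (ι → ℝ) × S => Ψ (p.1 + (∫ y, f y ∂ν - f p.2)) :=
      hΨ.lipschitz.continuous.measurable.comp
        (measurable_fst.add (measurable_const.sub (hf.comp measurable_snd)))
    have hb : ∀ ω, ‖∑ l ∈ insert i J, (∫ y, f y ∂ν - f (W l ω))‖ ≤
        ∑ l ∈ insert i J, (K + K) := fun ω =>
      (norm_sum_le _ _).trans (Finset.sum_le_sum fun l _ => norm_centred_le hK _)
    have hI := hΨ.integrable (ν := μ) (B := fun ω => ∑ l ∈ insert i J, (∫ y, f y ∂ν - f (W l ω)))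
      (Finset.measurable_sum _ fun l _ => measurable_const.sub (hf.comp (hW l))) hb 0
    simp only [zero_add] at hI
    have e : ∀ ω, ∑ l ∈ insert i J, (∫ y, f y ∂ν - f (W l ω)) =
        ∑ l ∈ J, (∫ y, f y ∂ν - f (W l ω)) + (∫ y, f y ∂ν - f (W i ω)) := fun ω => by
      rw [Finset.sum_insert hi, add_comm]
    simp only [e] at hI ⊢
    rw [integral_comp_of_indepFun hm (hW i) (hind J (Finset.subset_insert _ _) i
      (Finset.mem_insert_self _ _) hi) hF hI, hlaw i]
    rfl

/-- The expected supremum of a centred sum over independent blocks, for losses that are Lipschitz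
in a readout that is linear in bounded features. -/
theorem integral_iSup_centred_sum_le [Nonempty ι] {Q : Type*} [Fintype Q] {c : ι → Q → ℝ}
    {C : Q → ℝ} (hC : ∀ j q, |c j q| ≤ C q) {g : S → Q → ℝ} (hg : ∀ x q, |g x q| ≤ 1)
    (hf : Measurable f) (hK : ∀ x, ‖f x‖ ≤ K) (hh : Measurable h) (hK' : ∀ x, ‖h x‖ ≤ K)
    (hhg : ∀ x j, h x j = ∑ q, c j q * g x q)
    (hL : 0 ≤ L) (hfh : ∀ x j l, |f x j - f x l| ≤ L * |h x j - h x l|)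
    {W : ℕ → Ω → S} (hW : ∀ i, Measurable (W i)) (hlaw : ∀ i, μ.map (W i) = ν) (J : Finset ℕ)
    (hind : ∀ J' ⊆ J, ∀ i ∈ J, i ∉ J' →
      IndepFun (fun ω => ∑ l ∈ J', (∫ y, f y ∂ν - f (W l ω))) (W i) μ) :
    ∫ ω, ⨆ j, (∑ l ∈ J, (∫ y, f y ∂ν - f (W l ω))) j ∂μ ≤
      2 * L * (∑ q, C q) * Real.sqrt J.card := by
  have h1 := integral_centred_sum_eq hf hK hW hlaw J hind _ isContractive_iSup
  rw [h1]
  refine (isContractive_iSup.iterate_centredStep_le hf hK hh hK' hL hfh _ _).trans ?_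
  have h2 := iterate_signedStep_iSup_le (ν := ν) hC hg hh hK' hhg hL J.card 0
  simp only [Pi.zero_apply, mul_zero, Finset.sum_const_zero] at h2
  refine h2.trans (le_of_eq ?_)
  rw [Finset.mul_sum, Finset.sum_mul]
  refine Finset.sum_congr rfl fun q _ => ?_
  rw [zero_pow two_ne_zero, zero_add, Real.sqrt_mul (Nat.cast_nonneg _),
    Real.sqrt_sq (by positivity)]
  ring

end Rademacher
/-! ### The bounded differences inequality for infinitely many independent variables -/

section BoundedDifferences

variable {E : Type*}

open Classical in
/-- The total weight of the coordinates from `l` on at which two sequences differ. -/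
def diffWeight (c : ℕ → ℝ) (l : ℕ) (x x' : ℕ → E) : ℝ :=
  ∑' t, if l ≤ t ∧ x t ≠ x' t then c t else 0

/-- `F` does not depend on the first `l` coordinates, and changes by at most `c t` with
coordinate `t`. -/
def HasBoundedDiff (F : (ℕ → E) → ℝ) (c : ℕ → ℝ) (l : ℕ) : Prop :=
  ∀ x x', |F x - F x'| ≤ diffWeight c l x x'

variable {c : ℕ → ℝ}

theorem summable_ite (hc : ∀ t, 0 ≤ c t) (hs : Summable c) (p : ℕ → Prop) [DecidablePred p] :
    Summable fun t => if p t then c t else 0 :=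
  Summable.of_nonneg_of_le (fun t => by split_ifs <;> simp [hc t])
    (fun t => by split_ifs <;> simp [hc t]) hs

theorem diffWeight_le (hc : ∀ t, 0 ≤ c t) (hs : Summable c) (l : ℕ) (x x' : ℕ → E) :
    diffWeight c l x x' ≤ ∑' t, if l ≤ t then c t else 0 := by
  classical
  refine Summable.tsum_le_tsum (fun t => ?_) (summable_ite hc hs _) (summable_ite hc hs _)
  by_cases h : l ≤ t <;> by_cases h' : x t = x' t <;> simp [h, h', hc t]

theorem diffWeight_le_tsum (hc : ∀ t, 0 ≤ c t) (hs : Summable c) (l : ℕ) (x x' : ℕ → E) :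
    diffWeight c l x x' ≤ ∑' t, c t :=
  (diffWeight_le hc hs l x x').trans
    (Summable.tsum_le_tsum (fun t => by split_ifs <;> simp [hc t]) (summable_ite hc hs _) hs)

theorem diffWeight_update (l : ℕ) (x x' : ℕ → E) (e : E) :
    diffWeight c l (Function.update x l e) (Function.update x' l e) =
      diffWeight c (l + 1) x x' := by
  classical
  refine tsum_congr fun t => ?_
  rcases eq_or_ne t l with rfl | h
  · simp
  · simp [h, lt_iff_le_and_ne, h.symm]

theorem diffWeight_update_same (l : ℕ) (x : ℕ → E) (e e' : E) (hc : ∀ t, 0 ≤ c t) :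
    diffWeight c l (Function.update x l e) (Function.update x l e') ≤ c l := by
  classical
  rw [diffWeight, tsum_eq_single l]
  · split_ifs
    · exact le_rfl
    · exact hc l
  · intro t ht
    simp [ht]

variable [MeasurableSpace E] {Ω : Type*} [MeasurableSpace Ω] {μ : Measure Ω}
  [IsProbabilityMeasure μ] {X : ℕ → Ω → E} {F : (ℕ → E) → ℝ}

omit [MeasurableSpace E] in
theorem HasBoundedDiff.exists_bound {l : ℕ} (h : HasBoundedDiff F c l) (hc : ∀ t, 0 ≤ c t)
    (hs : Summable c) : ∃ K, ∀ x, |F x| ≤ K := by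
  rcases isEmpty_or_nonempty E with hE | ⟨⟨e⟩⟩
  · exact ⟨0, fun x => isEmptyElim (x 0)⟩
  · refine ⟨|F fun _ => e| + ∑' t, c t, fun x => ?_⟩
    have h1 := (h x fun _ => e).trans (diffWeight_le_tsum hc hs l _ _)
    have h2 := abs_sub_abs_le_abs_sub (F x) (F fun _ => e)
    linarith

theorem integrable_of_abs_le {Ω' : Type*} [MeasurableSpace Ω'] {μ' : Measure Ω'}
    [IsFiniteMeasure μ'] {Y : Ω' → ℝ} (hY : Measurable Y) {K : ℝ} (hK : ∀ ω, |Y ω| ≤ K) :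
    Integrable Y μ' :=
  Integrable.of_bound hY.aestronglyMeasurable K (Filter.Eventually.of_forall hK)

/-- Averaging out coordinate `l`. -/
def averageOut (ν : Measure E) (l : ℕ) (F : (ℕ → E) → ℝ) (x : ℕ → E) : ℝ :=
  ∫ e, F (Function.update x l e) ∂ν

theorem measurable_averageOut {ν : Measure E} [SFinite ν] (l : ℕ) (hF : Measurable F) :
    Measurable (averageOut ν l F) :=
  (hF.comp measurable_update').stronglyMeasurable.integral_prod_right'.measurable

theorem measurable_update_const (x : ℕ → E) (l : ℕ) : Measurable fun e => Function.update x l e :=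
  measurable_update x

/-- Giving both sequences the same entry at `l` removes that coordinate from the comparison, for
every value of the entry and hence also on average. -/
theorem HasBoundedDiff.averageOut {ν : Measure E} [IsProbabilityMeasure ν] {l : ℕ}
    (hF : Measurable F) (h : HasBoundedDiff F c l) (hc : ∀ t, 0 ≤ c t) (hs : Summable c) :
    HasBoundedDiff (averageOut ν l F) c (l + 1) := by
  intro x x'
  obtain ⟨K, hK⟩ := h.exists_bound hc hs
  have hi : ∀ y : ℕ → E, Integrable (fun e => F (Function.update y l e)) ν := fun y =>
    integrable_of_abs_le (hF.comp (measurable_update_const y l)) fun e => hK _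
  rw [QRC.averageOut, QRC.averageOut, ← integral_sub (hi x) (hi x')]
  have := norm_integral_le_of_norm_le_const (μ := ν) (C := diffWeight c (l + 1) x x')
    (f := fun e => F (Function.update x l e) - F (Function.update x' l e))
    (Filter.Eventually.of_forall fun e => by
      rw [Real.norm_eq_abs, ← diffWeight_update l x x' e]
      exact h _ _)
  simpa using this

omit [IsProbabilityMeasure μ] in
theorem indepFun_update (hX : ∀ t, Measurable (X t)) (hind : iIndepFun X μ) (l : ℕ) (e₀ : E) :
    IndepFun (fun ω => Function.update (fun t => X t ω) l e₀) (X l) μ := by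
  have h1 : Indep (⨆ t ∈ ({l}ᶜ : Set ℕ), MeasurableSpace.comap (X t) inferInstance)
      (⨆ t ∈ ({l} : Set ℕ), MeasurableSpace.comap (X t) inferInstance) μ :=
    indep_iSup_of_disjoint (fun t => (hX t).comap_le)
      ((iIndepFun_iff_iIndep _ _ _).1 hind) disjoint_compl_left
  rw [IndepFun_iff_Indep]
  refine indep_of_indep_of_le_left (indep_of_indep_of_le_right h1 ?_) ?_
  · exact le_iSup₂_of_le l rfl le_rfl
  · rw [← measurable_iff_comap_le]
    refine @measurable_pi_lambda _ _ _ (_) _ _ fun t => ?_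
    rcases eq_or_ne t l with rfl | h
    · simp only [Function.update_self]
      exact measurable_const
    · simp only [Function.update_of_ne h]
      rw [measurable_iff_comap_le]
      exact le_iSup₂_of_le (f := fun t (_ : t ∈ ({l}ᶜ : Set ℕ)) =>
        MeasurableSpace.comap (X t) inferInstance) t h le_rfl

theorem integral_eq_integral_averageOut (hX : ∀ t, Measurable (X t)) (hind : iIndepFun X μ)
    (l : ℕ) (hF : Measurable F) {K : ℝ} (hK : ∀ x, |F x| ≤ K) :
    ∫ ω, F (fun t => X t ω) ∂μ = ∫ ω, averageOut (μ.map (X l)) l F (fun t => X t ω) ∂μ := by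
  obtain ⟨ω₀⟩ := nonempty_of_isProbabilityMeasure μ
  have hm : Measurable fun ω t => X t ω := measurable_pi_lambda _ hX
  -- Coordinate `l` is overwritten by a constant, which makes the sequence independent of `X l`;
  -- updating again at `l` with `X l` restores it.
  have hu : Measurable fun ω => Function.update (fun t => X t ω) l (X l ω₀) :=
    measurable_update'.comp (hm.prodMk measurable_const)
  have h1 := integral_comp_of_indepFun (F := fun p => F (Function.update p.1 l p.2)) hu (hX l)
    (indepFun_update hX hind l (X l ω₀)) (hF.comp measurable_update')
    (by
      simp only [Function.update_idem, Function.update_eq_self]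
      exact integrable_of_abs_le (hF.comp hm) fun ω => hK _)
  simpa [averageOut] using h1

/-- Hoeffding's lemma in one coordinate: with the others frozen, `F` takes values in an interval of
length `c l` that starts at its infimum. -/
theorem hoeffding_update {ν : Measure E} [IsProbabilityMeasure ν] {l : ℕ}
    (hF : Measurable F) (h : HasBoundedDiff F c l) (hc : ∀ t, 0 ≤ c t) (hs : Summable c)
    (x : ℕ → E) (s : ℝ) :
    ∫ e, Real.exp (s * F (Function.update x l e)) ∂ν ≤
      Real.exp (s ^ 2 * c l ^ 2 / 8) * Real.exp (s * averageOut ν l F x) := by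
  obtain ⟨K, hK⟩ := h.exists_bound hc hs
  obtain ⟨e₀⟩ := nonempty_of_isProbabilityMeasure ν
  have : Nonempty E := ⟨e₀⟩
  have hb : BddBelow (Set.range fun e => F (Function.update x l e)) := by
    refine ⟨-K, ?_⟩
    rintro _ ⟨e, rfl⟩
    exact neg_le_of_abs_le (hK _)
  have hmem : ∀ e, F (Function.update x l e) ∈ Set.Icc (⨅ e, F (Function.update x l e))
      ((⨅ e, F (Function.update x l e)) + c l) := by
    refine fun e => ⟨ciInf_le hb e, ?_⟩
    rw [← sub_le_iff_le_add]
    refine le_ciInf fun e' => ?_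
    have := (le_abs_self _).trans ((h (Function.update x l e) (Function.update x l e')).trans
      (diffWeight_update_same l x e e' hc))
    linarith
  have hsub := hasSubgaussianMGF_of_mem_Icc (μ := ν)
    (hF.comp (measurable_update_const x l)).aemeasurable (Filter.Eventually.of_forall hmem)
  have hmgf := hsub.mgf_le s
  simp only [mgf] at hmgf
  have e1 : ∫ e, Real.exp (s * F (Function.update x l e)) ∂ν =
      (∫ e, Real.exp (s * (F (Function.update x l e) - averageOut ν l F x)) ∂ν) *
        Real.exp (s * averageOut ν l F x) := by
    rw [← integral_mul_const]
    refine integral_congr_ae (Filter.Eventually.of_forall fun e => ?_)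
    simp only
    rw [← Real.exp_add]
    congr 1
    ring
  rw [e1]
  refine mul_le_mul_of_nonneg_right (hmgf.trans (le_of_eq ?_)) (Real.exp_nonneg _)
  congr 1
  simp only [add_sub_cancel_left, NNReal.coe_pow, NNReal.coe_div, coe_nnnorm, Real.norm_eq_abs,
    abs_of_nonneg (hc l), NNReal.coe_ofNat]
  ring

/-- The function with the first `l` coordinates averaged out. -/
def averagedOut (μ : Measure Ω) (X : ℕ → Ω → E) (F : (ℕ → E) → ℝ) : ℕ → (ℕ → E) → ℝ
  | 0 => F
  | l + 1 => averageOut (μ.map (X l)) l (averagedOut μ X F l)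

theorem averagedOut_spec (hX : ∀ t, Measurable (X t)) (hind : iIndepFun X μ)
    (hF : Measurable F) (h : HasBoundedDiff F c 0) (hc : ∀ t, 0 ≤ c t) (hs : Summable c)
    (s : ℝ) (l : ℕ) :
    Measurable (averagedOut μ X F l) ∧ HasBoundedDiff (averagedOut μ X F l) c l ∧
    ∫ ω, F (fun t => X t ω) ∂μ = ∫ ω, averagedOut μ X F l (fun t => X t ω) ∂μ ∧
    ∫ ω, Real.exp (s * F (fun t => X t ω)) ∂μ ≤
      Real.exp (s ^ 2 * (∑ t ∈ Finset.range l, c t ^ 2) / 8) *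
        ∫ ω, Real.exp (s * averagedOut μ X F l (fun t => X t ω)) ∂μ := by
  have hm : Measurable fun ω t => X t ω := measurable_pi_lambda _ hX
  induction l with
  | zero => exact ⟨hF, h, rfl, by simp [averagedOut]⟩
  | succ l ih =>
    obtain ⟨i1, i2, i3, i4⟩ := ih
    have : IsProbabilityMeasure (μ.map (X l)) :=
      Measure.isProbabilityMeasure_map (hX l).aemeasurable
    obtain ⟨K, hK⟩ := i2.exists_bound hc hs
    have j1 : Measurable (averagedOut μ X F (l + 1)) := measurable_averageOut l i1
    have j2 : HasBoundedDiff (averagedOut μ X F (l + 1)) c (l + 1) := i2.averageOut i1 hc hs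
    obtain ⟨K', hK'⟩ := j2.exists_bound hc hs
    have hexp : ∀ (G : (ℕ → E) → ℝ) (C : ℝ), (∀ x, |G x| ≤ C) → ∀ x,
        |Real.exp (s * G x)| ≤ Real.exp (|s| * C) := fun G C hG x => by
      rw [Real.abs_exp]
      refine Real.exp_le_exp.2 ((le_abs_self _).trans ?_)
      rw [abs_mul]
      exact mul_le_mul_of_nonneg_left (hG x) (abs_nonneg s)
    have hme : Measurable fun x => Real.exp (s * averagedOut μ X F l x) :=
      (i1.const_mul s).exp
    refine ⟨j1, j2, i3.trans (integral_eq_integral_averageOut hX hind l i1 hK), i4.trans ?_⟩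
    rw [integral_eq_integral_averageOut hX hind l hme (hexp _ _ hK), Finset.sum_range_succ,
      mul_add, add_div, Real.exp_add, mul_assoc]
    refine mul_le_mul_of_nonneg_left ?_ (Real.exp_nonneg _)
    rw [← integral_const_mul]
    refine integral_mono ?_ ?_ fun ω => hoeffding_update i1 i2 hc hs (fun t => X t ω) s
    · refine integrable_of_abs_le ((measurable_averageOut l hme).comp hm)
        (K := Real.exp (|s| * K)) fun ω => ?_
      have := norm_integral_le_of_norm_le_const (μ := μ.map (X l)) (C := Real.exp (|s| * K))
        (f := fun e => Real.exp (s * averagedOut μ X F l (Function.update (fun t => X t ω) l e)))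
        (Filter.Eventually.of_forall fun e => hexp _ _ hK _)
      simpa [averageOut] using this
    · exact (integrable_of_abs_le ((j1.comp hm).const_mul s).exp
        fun ω => hexp _ _ hK' fun t => X t ω).const_mul _

/-- Once `l` coordinates are averaged out, what remains exceeds its mean nowhere by more than the
tail `∑' t, c (t + l)`. No martingale convergence is needed, since this tail tends to zero. -/
theorem integral_exp_le (hX : ∀ t, Measurable (X t)) (hind : iIndepFun X μ)
    (hF : Measurable F) (h : HasBoundedDiff F c 0) (hc : ∀ t, 0 ≤ c t) (hs : Summable c)
    (hs2 : Summable fun t => c t ^ 2) {s : ℝ} (hs0 : 0 ≤ s) :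
    ∫ ω, Real.exp (s * F (fun t => X t ω)) ∂μ ≤
      Real.exp (s ^ 2 * (∑' t, c t ^ 2) / 8 + s * ∫ ω, F (fun t => X t ω) ∂μ) := by
  have hm : Measurable fun ω t => X t ω := measurable_pi_lambda _ hX
  have key : ∀ l, ∫ ω, Real.exp (s * F (fun t => X t ω)) ∂μ ≤
      Real.exp (s ^ 2 * (∑' t, c t ^ 2) / 8 +
        s * (∫ ω, F (fun t => X t ω) ∂μ + ∑' t, c (t + l))) := by
    intro l
    obtain ⟨i1, i2, i3, i4⟩ := averagedOut_spec hX hind hF h hc hs s l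
    obtain ⟨K, hK⟩ := i2.exists_bound hc hs
    refine i4.trans ?_
    rw [Real.exp_add]
    have htail : (∑' t, if l ≤ t then c t else 0) = ∑' t, c (t + l) := by
      rw [← (summable_ite hc hs (fun t => l ≤ t)).sum_add_tsum_nat_add l]
      simp only [Nat.le_add_left, if_true]
      rw [Finset.sum_eq_zero, zero_add]
      intro t ht
      rw [if_neg (by simpa using ht)]
    have hG : ∀ x, averagedOut μ X F l x ≤ ∫ ω, F (fun t => X t ω) ∂μ + ∑' t, c (t + l) := by
      intro x
      rw [i3, ← htail, ← sub_le_iff_le_add]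
      have : averagedOut μ X F l x - (∑' t, if l ≤ t then c t else 0) =
          ∫ _ω, (averagedOut μ X F l x - ∑' t, if l ≤ t then c t else 0) ∂μ := by simp
      rw [this]
      refine integral_mono (integrable_const _)
        (integrable_of_abs_le (i1.comp hm) fun ω => hK _) fun ω => ?_
      have := (le_abs_self _).trans ((i2 x fun t => X t ω).trans (diffWeight_le hc hs l _ _))
      simp only
      linarith
    have h2 : ∫ ω, Real.exp (s * averagedOut μ X F l (fun t => X t ω)) ∂μ ≤
        Real.exp (s * (∫ ω, F (fun t => X t ω) ∂μ + ∑' t, c (t + l))) := by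
      have := norm_integral_le_of_norm_le_const (μ := μ)
        (f := fun ω => Real.exp (s * averagedOut μ X F l (fun t => X t ω)))
        (C := Real.exp (s * (∫ ω, F (fun t => X t ω) ∂μ + ∑' t, c (t + l))))
        (Filter.Eventually.of_forall fun ω => by
          rw [Real.norm_eq_abs, Real.abs_exp]
          exact Real.exp_le_exp.2 (mul_le_mul_of_nonneg_left (hG _) hs0))
      rw [probReal_univ, mul_one] at this
      exact (le_abs_self _).trans this
    refine mul_le_mul (Real.exp_le_exp.2 ?_) h2 (integral_nonneg fun ω => Real.exp_nonneg _)
      (Real.exp_nonneg _)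
    have := hs2.sum_le_tsum (Finset.range l) fun t _ => sq_nonneg (c t)
    have := mul_le_mul_of_nonneg_left this (sq_nonneg s)
    linarith
  have hlim : Filter.Tendsto (fun l => Real.exp (s ^ 2 * (∑' t, c t ^ 2) / 8 +
        s * (∫ ω, F (fun t => X t ω) ∂μ + ∑' t, c (t + l)))) Filter.atTop
      (nhds (Real.exp (s ^ 2 * (∑' t, c t ^ 2) / 8 +
        s * (∫ ω, F (fun t => X t ω) ∂μ + 0)))) :=
    (Real.continuous_exp.tendsto _).comp (((tendsto_sum_nat_add c).const_add _ |>.const_mul s).const_add _)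
  rw [add_zero] at hlim
  exact ge_of_tendsto' hlim key

/-- The bounded differences inequality. -/
theorem measure_gt_le_of_hasBoundedDiff (hX : ∀ t, Measurable (X t)) (hind : iIndepFun X μ)
    (hF : Measurable F) (h : HasBoundedDiff F c 0) (hc : ∀ t, 0 ≤ c t) (hs : Summable c)
    (hs2 : Summable fun t => c t ^ 2) {v : ℝ} (hv : ∑' t, c t ^ 2 ≤ v) {δ : ℝ} (hδ : 0 < δ)
    (hδ1 : δ < 1) :
    μ.real {ω | ∫ ω, F (fun t => X t ω) ∂μ + Real.sqrt (v * Real.log (1 / δ) / 2) <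
      F fun t => X t ω} ≤ δ := by
  have hm : Measurable fun ω t => X t ω := measurable_pi_lambda _ hX
  obtain ⟨K, hK⟩ := h.exists_bound hc hs
  set EF := ∫ ω, F (fun t => X t ω) ∂μ
  have hlog : 0 < Real.log (1 / δ) := Real.log_pos (by rw [lt_div_iff₀ hδ]; linarith)
  have hv0 : 0 ≤ v := (tsum_nonneg fun t => sq_nonneg (c t)).trans hv
  -- The exponent chosen below divides by `v`. If `v = 0`, all `c t` vanish and `F` is constant.
  rcases hv0.eq_or_lt with rfl | hvpos
  · have hc0 : ∀ t, c t = 0 := fun t => by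
      have h1 := (hs2.le_tsum t fun j _ => sq_nonneg (c j)).trans hv
      exact pow_eq_zero_iff two_ne_zero |>.1 (le_antisymm h1 (sq_nonneg _))
    have hconst : ∀ x x', F x = F x' := fun x x' => by
      have h1 := (h x x').trans (diffWeight_le_tsum hc hs 0 x x')
      simp only [hc0, tsum_zero] at h1
      exact sub_eq_zero.1 (abs_eq_zero.1 (le_antisymm h1 (abs_nonneg _)))
    have hE : ∀ ω, EF = F fun t => X t ω := fun ω => by
      have : EF = ∫ _ω', F (fun t => X t ω) ∂μ :=
        integral_congr_ae (Filter.Eventually.of_forall fun ω' => hconst _ _)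
      rw [this]; simp
    have : {ω | EF + Real.sqrt (0 * Real.log (1 / δ) / 2) < F fun t => X t ω} = ∅ := by
      ext ω
      simp [← hE ω]
    rw [this]
    simpa using hδ.le
  · set ε := Real.sqrt (v * Real.log (1 / δ) / 2)
    have hε2 : ε ^ 2 = v * Real.log (1 / δ) / 2 := Real.sq_sqrt (by positivity)
    have hε : 0 ≤ ε := Real.sqrt_nonneg _
    -- Minimiser of `s ^ 2 * v / 8 - s * ε`, with minimum `-2 * ε ^ 2 / v = log δ`.
    set s := 4 * ε / v
    have hs0 : 0 ≤ s := by positivity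
    have hi : Integrable (fun ω => Real.exp (s * F fun t => X t ω)) μ := by
      refine integrable_of_abs_le ((hF.comp hm).const_mul s).exp (K := Real.exp (s * K))
        fun ω => ?_
      rw [Real.abs_exp]
      exact Real.exp_le_exp.2 (mul_le_mul_of_nonneg_left ((le_abs_self _).trans (hK _)) hs0)
    have h1 := measure_ge_le_exp_mul_mgf (μ := μ) (X := fun ω => F fun t => X t ω) (EF + ε) hs0 hi
    have h2 := integral_exp_le hX hind hF h hc hs hs2 hs0
    refine (measureReal_mono (s₂ := {ω | EF + ε ≤ F fun t => X t ω})
      (fun ω hω => by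
        simp only [Set.mem_ofPred_eq] at hω ⊢
        exact hω.le)).trans (h1.trans ?_)
    refine (mul_le_mul_of_nonneg_left h2 (Real.exp_nonneg _)).trans ?_
    rw [← Real.exp_add]
    have h3 : -s * (EF + ε) + (s ^ 2 * (∑' t, c t ^ 2) / 8 + s * EF) ≤ Real.log δ := by
      have h4 : s ^ 2 * (∑' t, c t ^ 2) ≤ s ^ 2 * v := mul_le_mul_of_nonneg_left hv (sq_nonneg s)
      have h5 : s ^ 2 * v = 4 * (s * ε) := by
        simp only [s]; field_simp
      have h6 : s * ε = 2 * Real.log (1 / δ) := by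
        have : s * ε = 4 * ε ^ 2 / v := by simp only [s]; ring
        rw [this, hε2]; field_simp; norm_num
      have h7 : Real.log (1 / δ) = -Real.log δ := by rw [one_div, Real.log_inv]
      nlinarith
    exact (Real.exp_le_exp.2 h3).trans (le_of_eq (Real.exp_log hδ))

end BoundedDifferences
/-! ### Causal shifts on sequences of innovations -/

section CausalShift

variable {E : Type*} [MeasurableSpace E]

/-- A causal functional that is Lipschitz for a geometrically weighted distance of sequences. -/
structure IsCausalShift (g : (ℕ → E) → ℝ) (d : E → E → ℝ) (w : ℕ → ℝ) (L D M : ℝ) : Prop where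
  measurable : Measurable g
  L_nonneg : 0 ≤ L
  w_nonneg : ∀ k, 0 ≤ w k
  w_le : ∀ k, w k ≤ D ^ k
  D_nonneg : 0 ≤ D
  D_lt_one : D < 1
  M_nonneg : 0 ≤ M
  d_nonneg : ∀ e e', 0 ≤ d e e'
  d_le : ∀ e e', d e e' ≤ 2 * M
  d_self : ∀ e, d e e = 0
  d_measurable : ∀ e', Measurable fun e => d e e'
  lipschitz : ∀ x x', |g x - g x'| ≤ L * ∑' k, w k * d (x k) (x' k)

/-- The sequence seen from time `-i`. -/
def shiftSeq (i : ℕ) (x : ℕ → E) : ℕ → E := fun k => x (i + k)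

/-- The first `τ` entries of a sequence, followed by a constant. -/
def padSeq (e₀ : E) (τ : ℕ) (x : ℕ → E) : ℕ → E := fun k => if k < τ then x k else e₀

/-- The weights seen from time `-i`. -/
def delayed (w : ℕ → ℝ) (i t : ℕ) : ℝ := if i ≤ t then w (t - i) else 0

theorem measurable_shiftSeq (i : ℕ) : Measurable (shiftSeq i : (ℕ → E) → ℕ → E) :=
  measurable_pi_lambda _ fun k => measurable_pi_apply (i + k)

theorem measurable_padSeq (e₀ : E) (τ : ℕ) : Measurable (padSeq e₀ τ) := by
  refine measurable_pi_lambda _ fun k => ?_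
  unfold padSeq
  split_ifs
  · exact measurable_pi_apply k
  · exact measurable_const

theorem delayed_nonneg {w : ℕ → ℝ} (hw : ∀ k, 0 ≤ w k) (i t : ℕ) : 0 ≤ delayed w i t := by
  unfold delayed
  split_ifs
  · exact hw _
  · exact le_rfl

theorem tsum_delayed_mul {w : ℕ → ℝ} (i : ℕ) (p : ℕ → ℝ) :
    ∑' t, delayed w i t * p t = ∑' k, w k * p (i + k) := by
  rw [← (add_right_injective i).tsum_eq (f := fun t => delayed w i t * p t)]
  · simp [delayed]
  · intro t ht
    by_contra h
    refine ht ?_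
    have : ¬ i ≤ t := fun hit => h ⟨t - i, by simp [hit]⟩
    simp [delayed, this]

theorem summable_delayed {w : ℕ → ℝ} (hs : Summable w) (i : ℕ) : Summable (delayed w i) := by
  refine ((add_right_injective i).summable_iff (f := delayed w i) ?_).1 ?_
  · intro t ht
    have : ¬ i ≤ t := fun hit => ht ⟨t - i, by simp [hit]⟩
    simp [delayed, this]
  · refine hs.congr fun k => ?_
    simp [delayed]

theorem tsum_delayed (w : ℕ → ℝ) (i : ℕ) : ∑' t, delayed w i t = ∑' k, w k := by
  simpa using tsum_delayed_mul (w := w) i fun _ => 1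

/-- Distinct `i` give distinct lags `t - (i + s)`, so no weight is counted twice. The bound is free
of `m`, which makes each influence on the empirical mean of order `1 / m`. -/
theorem sum_delayed_le {w : ℕ → ℝ} (hw : ∀ k, 0 ≤ w k) (hs : Summable w) (m s t : ℕ) :
    ∑ i ∈ Finset.range m, delayed w (i + s) t ≤ ∑' k, w k := by
  unfold delayed
  rw [← Finset.sum_filter]
  have hinj : Set.InjOn (fun i => t - (i + s))
      (↑((Finset.range m).filter fun i => i + s ≤ t) : Set ℕ) := by
    intro i hi j hj hij
    simp only [Finset.coe_filter, Finset.mem_range, Set.mem_ofPred_eq] at hi hj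
    simp only at hij
    omega
  rw [← Finset.sum_image (f := w) hinj]
  exact hs.sum_le_tsum _ fun k _ => hw k

variable {g : (ℕ → E) → ℝ} {d : E → E → ℝ} {w : ℕ → ℝ} {L D M : ℝ}

namespace IsCausalShift

theorem summable_w (h : IsCausalShift g d w L D M) : Summable w :=
  Summable.of_nonneg_of_le h.w_nonneg h.w_le (summable_geometric_of_lt_one h.D_nonneg h.D_lt_one)

theorem summable_dist (h : IsCausalShift g d w L D M) (x x' : ℕ → E) :
    Summable fun k => w k * d (x k) (x' k) :=
  Summable.of_nonneg_of_le (fun k => mul_nonneg (h.w_nonneg k) (h.d_nonneg _ _))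
    (fun k => mul_le_mul_of_nonneg_left (h.d_le _ _) (h.w_nonneg k)) (h.summable_w.mul_right _)

theorem exists_bound (h : IsCausalShift g d w L D M) : ∃ K, ∀ x, |g x| ≤ K := by
  rcases isEmpty_or_nonempty E with hE | ⟨⟨e⟩⟩
  · exact ⟨0, fun x => isEmptyElim (x 0)⟩
  · refine ⟨|g fun _ => e| + L * ∑' k, w k * (2 * M), fun x => ?_⟩
    have h1 := (h.lipschitz x fun _ => e).trans (mul_le_mul_of_nonneg_left
      ((h.summable_dist x fun _ => e).tsum_le_tsum
        (fun k => mul_le_mul_of_nonneg_left (h.d_le _ _) (h.w_nonneg k))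
        (h.summable_w.mul_right _)) h.L_nonneg)
    have h2 := abs_sub_abs_le_abs_sub (g x) (g fun _ => e)
    linarith

/-- Two entries are at distance at most `2 * M`, and at distance zero when equal; this turns the
metric Lipschitz condition into bounded differences. -/
theorem abs_sub_shift_le (h : IsCausalShift g d w L D M) (i : ℕ) (x x' : ℕ → E) :
    |g (shiftSeq i x) - g (shiftSeq i x')| ≤ 2 * M * L * diffWeight (delayed w i) 0 x x' := by
  classical
  refine (h.lipschitz _ _).trans ?_
  have h1 : diffWeight (delayed w i) 0 x x' =
      ∑' k, w k * (if x (i + k) ≠ x' (i + k) then 1 else 0) := by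
    rw [← tsum_delayed_mul (w := w) i fun t => if x t ≠ x' t then 1 else 0]
    refine tsum_congr fun t => ?_
    simp
  rw [h1, mul_comm (2 * M) L, mul_assoc]
  refine mul_le_mul_of_nonneg_left ?_ h.L_nonneg
  rw [← tsum_mul_left]
  refine Summable.tsum_le_tsum (fun k => ?_) (h.summable_dist _ _) ?_
  · by_cases hx : x (i + k) = x' (i + k)
    · simp [shiftSeq, hx, h.d_self]
    · have := mul_le_mul_of_nonneg_left (h.d_le (x (i + k)) (x' (i + k))) (h.w_nonneg k)
      simp only [shiftSeq, ne_eq, hx, not_false_eq_true, if_true]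
      linarith
  · refine Summable.mul_left _ (Summable.of_nonneg_of_le (fun k => ?_) (fun k => ?_) h.summable_w)
    · have := h.w_nonneg k
      positivity
    · split_ifs <;> simp [h.w_nonneg k]

theorem tsum_tail_le (h : IsCausalShift g d w L D M) (j : ℕ) :
    (∑' k, if k < j then 0 else w k) ≤ D ^ j / (1 - D) := by
  have hs : Summable fun k => if k < j then 0 else w k :=
    Summable.of_nonneg_of_le (fun k => by split_ifs <;> simp [h.w_nonneg k])
      (fun k => by split_ifs <;> simp [h.w_nonneg k]) h.summable_w
  rw [← hs.sum_add_tsum_nat_add j, Finset.sum_eq_zero, zero_add]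
  · have hg := summable_geometric_of_lt_one h.D_nonneg h.D_lt_one
    have e : D ^ j / (1 - D) = ∑' k, D ^ j * D ^ k := by
      rw [tsum_mul_left, tsum_geometric_of_lt_one h.D_nonneg h.D_lt_one, div_eq_mul_inv]
    rw [e]
    have hs' : Summable fun k => if k + j < j then 0 else w (k + j) :=
      (summable_nat_add_iff (f := fun k => if k < j then 0 else w k) j).2 hs
    have hg' : Summable fun k => D ^ j * D ^ k := hg.mul_left (D ^ j)
    refine hs'.tsum_le_tsum (fun k => ?_) hg'
    rw [if_neg (by omega), ← pow_add, add_comm j k]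
    exact h.w_le _
  · intro k hk
    rw [if_pos (Finset.mem_range.1 hk)]

/-- The distance between a sequence and its truncation, seen from time `-s`. -/
theorem abs_sub_padSeq_le (h : IsCausalShift g d w L D M) (e₀ : E) (τ s : ℕ) (x : ℕ → E) :
    |g (shiftSeq s x) - g (shiftSeq s (padSeq e₀ τ x))| ≤
      L * ∑' k, (if k < τ - s then 0 else w k) * d (x (s + k)) e₀ := by
  refine (h.lipschitz _ _).trans (le_of_eq ?_)
  congr 1
  refine tsum_congr fun k => ?_
  by_cases hk : k < τ - s
  · have : s + k < τ := by omega
    simp [shiftSeq, padSeq, this, h.d_self, hk]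
  · have : ¬ s + k < τ := by omega
    simp [shiftSeq, padSeq, this, hk]

variable {Ω : Type*} [MeasurableSpace Ω] {μ : Measure Ω} [IsProbabilityMeasure μ]
  {X : ℕ → Ω → E}

/-- Seen from time `-s`, only lags from `τ - s` on are altered. Each contributes its weight times
the mean distance to `e₀`, and the weights have a geometric tail. -/
theorem integral_abs_sub_padSeq_le (h : IsCausalShift g d w L D M) (hX : ∀ t, Measurable (X t))
    {e₀ : E} {m₁ : ℝ} (hm₁ : ∀ t, ∫ ω, d (X t ω) e₀ ∂μ = m₁) (τ s i : ℕ) :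
    ∫ ω, |g (shiftSeq s (shiftSeq i fun t => X t ω)) -
      g (shiftSeq s (padSeq e₀ τ (shiftSeq i fun t => X t ω)))| ∂μ ≤
      L * m₁ * (D ^ (τ - s) / (1 - D)) := by
  have hm : Measurable fun ω t => X t ω := measurable_pi_lambda _ hX
  obtain ⟨K, hK⟩ := h.exists_bound
  have hdi : ∀ t, Integrable (fun ω => d (X t ω) e₀) μ := fun t =>
    integrable_of_abs_le ((h.d_measurable e₀).comp (hX t)) (K := 2 * M) fun ω => by
      rw [abs_of_nonneg (h.d_nonneg _ _)]; exact h.d_le _ _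
  have hm0 : 0 ≤ m₁ := by rw [← hm₁ 0]; exact integral_nonneg fun ω => h.d_nonneg _ _
  set F : ℕ → Ω → ℝ := fun k ω => (if k < τ - s then 0 else w k) * d (X (i + (s + k)) ω) e₀
  have hw0 : ∀ k, 0 ≤ (if k < τ - s then 0 else w k) := fun k => by
    split_ifs
    · exact le_rfl
    · exact h.w_nonneg k
  have hws : Summable fun k => if k < τ - s then 0 else w k :=
    Summable.of_nonneg_of_le hw0 (fun k => by split_ifs <;> simp [h.w_nonneg k]) h.summable_w
  have hF : ∀ k, Integrable (F k) μ := fun k => (hdi _).const_mul _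
  have hF0 : ∀ k ω, 0 ≤ F k ω := fun k ω => mul_nonneg (hw0 k) (h.d_nonneg _ _)
  have hFint : ∀ k, ∫ ω, F k ω ∂μ = (if k < τ - s then 0 else w k) * m₁ := fun k => by
    simp only [F]
    rw [integral_const_mul, hm₁]
  have hFs : Summable fun k => ∫ ω, ‖F k ω‖ ∂μ := by
    simp only [Real.norm_eq_abs, abs_of_nonneg (hF0 _ _), hFint]
    exact hws.mul_right _
  have h1 := hasSum_integral_of_summable_integral_norm hF hFs
  have hFsum : ∀ ω, Summable fun k => F k ω := fun ω =>
    Summable.of_nonneg_of_le (fun k => hF0 k ω)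
      (fun k => mul_le_mul_of_nonneg_left (h.d_le _ _) (hw0 k)) (hws.mul_right _)
  have hmeas : Measurable fun ω => ∑' k, F k ω :=
    measurable_of_tendsto_metrizable (f := fun n ω => ∑ k ∈ Finset.range n, F k ω)
      (fun n => Finset.measurable_sum _ fun k _ =>
        ((h.d_measurable e₀).comp (hX _)).const_mul _)
      (tendsto_pi_nhds.2 fun ω => (hFsum ω).hasSum.tendsto_sum_nat)
  have hint : Integrable (fun ω => ∑' k, F k ω) μ := by
    refine integrable_of_abs_le hmeas
      (K := ∑' k, (if k < τ - s then 0 else w k) * (2 * M)) fun ω => ?_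
    rw [abs_of_nonneg (tsum_nonneg fun k => hF0 k ω)]
    exact (hFsum ω).tsum_le_tsum
      (fun k => mul_le_mul_of_nonneg_left (h.d_le _ _) (hw0 k)) (hws.mul_right _)
  calc _ ≤ ∫ ω, L * ∑' k, F k ω ∂μ := by
        refine integral_mono ?_ (hint.const_mul L) fun ω => h.abs_sub_padSeq_le e₀ τ s _
        refine integrable_of_abs_le (K := K + K) ?_ fun ω => ?_
        · have m1 : Measurable fun ω => g (shiftSeq s (shiftSeq i fun t => X t ω)) :=
            h.measurable.comp ((measurable_shiftSeq s).comp ((measurable_shiftSeq i).comp hm))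
          have m2 : Measurable fun ω => g (shiftSeq s (padSeq e₀ τ (shiftSeq i fun t => X t ω))) :=
            h.measurable.comp ((measurable_shiftSeq s).comp
              ((measurable_padSeq e₀ τ).comp ((measurable_shiftSeq i).comp hm)))
          exact (m1.sub m2).abs
        · rw [abs_abs]
          exact (abs_sub _ _).trans (add_le_add (hK _) (hK _))
    _ = L * (m₁ * ∑' k, if k < τ - s then 0 else w k) := by
        rw [integral_const_mul, ← h1.tsum_eq]
        simp only [hFint]
        rw [tsum_mul_right, mul_comm m₁]
    _ ≤ L * (m₁ * (D ^ (τ - s) / (1 - D))) :=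
        mul_le_mul_of_nonneg_left (mul_le_mul_of_nonneg_left (h.tsum_tail_le _) hm0) h.L_nonneg
    _ = _ := by ring

end IsCausalShift

end CausalShift
/-! ### Risks of finite families of fading-memory readouts -/

section Setup

/-- A family of functionals `Φ j k` of the last `k` inputs that are linear in bounded features and
forget the past at rate `r`. -/
structure IsReadoutFamily {ι Q : Type*} [Fintype Q] (Φ : ι → ℕ → (ℕ → ℝ) → ℝ) (c : ι → Q → ℝ)
    (C : Q → ℝ) (feat : ℕ → (ℕ → ℝ) → Q → ℝ) (Lh a b r : ℝ) : Prop where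
  measurable : ∀ j k, Measurable (Φ j k)
  Lh_nonneg : 0 ≤ Lh
  a_nonneg : 0 ≤ a
  r_nonneg : 0 ≤ r
  r_lt_one : r < 1
  coef_le : ∀ j q, |c j q| ≤ C q
  feat_le : ∀ k v q, (∀ t, v t ∈ Set.Icc (0 : ℝ) b) → |feat k v q| ≤ 1
  eq_sum : ∀ j k v, (∀ t, v t ∈ Set.Icc (0 : ℝ) b) → Φ j k v = ∑ q, c j q * feat k v q
  lipschitz : ∀ j k v v', (∀ t, v t ∈ Set.Icc (0 : ℝ) b) → (∀ t, v' t ∈ Set.Icc (0 : ℝ) b) →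
    |Φ j k v - Φ j k v'| ≤ Lh * (a * ∑ s ∈ Finset.range k, r ^ s * |v s - v' s|)
  forget : ∀ j k l v v', (∀ t, v t ∈ Set.Icc (0 : ℝ) b) → (∀ t, v' t ∈ Set.Icc (0 : ℝ) b) →
    |Φ j (k + l) v - Φ j k v'| ≤
      Lh * (r ^ k + a * ∑ s ∈ Finset.range k, r ^ s * |v s - v' s|)

/-- Causal input and target functionals, a Lipschitz loss and a family of readouts. -/
structure Setup (E ι Q : Type*) [MeasurableSpace E] [Fintype Q] where
  gv : (ℕ → E) → ℝ
  gy : (ℕ → E) → ℝ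
  dv : E → E → ℝ
  dy : E → E → ℝ
  wv : ℕ → ℝ
  wy : ℕ → ℝ
  (Lv Ly Dv Dy M Lℓ Lh a b r : ℝ)
  loss : ℝ → ℝ → ℝ
  Φ : ι → ℕ → (ℕ → ℝ) → ℝ
  c : ι → Q → ℝ
  C : Q → ℝ
  feat : ℕ → (ℕ → ℝ) → Q → ℝ
  hv : IsCausalShift gv dv wv Lv Dv M
  hy : IsCausalShift gy dy wy Ly Dy M
  gv_mem : ∀ x, gv x ∈ Set.Icc (0 : ℝ) b
  loss_lip : ∀ x x' y y' : ℝ, |loss x y - loss x' y'| ≤ Lℓ * (|x - x'| + |y - y'|)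
  hΦ : IsReadoutFamily Φ c C feat Lh a b r

namespace Setup

variable {E ι Q : Type*} [MeasurableSpace E] [Fintype Q] (S : Setup E ι Q)

theorem loss_nonneg_of_lip {loss : ℝ → ℝ → ℝ} {Lℓ : ℝ}
    (h : ∀ x x' y y' : ℝ, |loss x y - loss x' y'| ≤ Lℓ * (|x - x'| + |y - y'|)) : 0 ≤ Lℓ := by
  have := (abs_nonneg _).trans (h 1 0 0 0)
  simpa using this

theorem Lℓ_nonneg : 0 ≤ S.Lℓ := loss_nonneg_of_lip S.loss_lip

theorem continuous_of_lip {loss : ℝ → ℝ → ℝ} {Lℓ : ℝ}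
    (h : ∀ x x' y y' : ℝ, |loss x y - loss x' y'| ≤ Lℓ * (|x - x'| + |y - y'|)) :
    Continuous fun p : ℝ × ℝ => loss p.1 p.2 := by
  have h0 : 0 ≤ Lℓ := loss_nonneg_of_lip h
  refine (LipschitzWith.of_dist_le_mul (K := ⟨2 * Lℓ, by positivity⟩) fun p q => ?_).continuous
  rw [Real.dist_eq]
  refine (h _ _ _ _).trans ?_
  have h1 : |p.1 - q.1| ≤ dist p q := le_max_left _ _
  have h2 : |p.2 - q.2| ≤ dist p q := le_max_right _ _
  have := mul_le_mul_of_nonneg_left (add_le_add h1 h2) h0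
  refine this.trans (le_of_eq ?_)
  change Lℓ * (dist p q + dist p q) = 2 * Lℓ * dist p q
  ring

/-- The inputs generated by a sequence of innovations. -/
def inputs (x : ℕ → E) : ℕ → ℝ := fun s => S.gv (shiftSeq s x)

theorem inputs_mem (x : ℕ → E) (t : ℕ) : S.inputs x t ∈ Set.Icc (0 : ℝ) S.b := S.gv_mem _

theorem measurable_inputs : Measurable S.inputs :=
  measurable_pi_lambda _ fun s => S.hv.measurable.comp (measurable_shiftSeq s)

/-- The loss of readout `j` run for `k` steps. -/
def blockLoss (j : ι) (k : ℕ) (x : ℕ → E) : ℝ := S.loss (S.Φ j k (S.inputs x)) (S.gy x)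

/-- The empirical risk of readout `j`. -/
def empLoss (m : ℕ) (j : ι) (x : ℕ → E) : ℝ :=
  (1 / (m : ℝ)) * ∑ i ∈ Finset.range m, S.blockLoss j (m - i) (shiftSeq i x)

theorem measurable_blockLoss (j : ι) (k : ℕ) : Measurable (S.blockLoss j k) :=
  (continuous_of_lip S.loss_lip).measurable.comp
    (((S.hΦ.measurable j k).comp S.measurable_inputs).prodMk S.hy.measurable)

theorem measurable_empLoss (m : ℕ) (j : ι) : Measurable (S.empLoss m j) :=
  (Finset.measurable_sum _ fun i _ =>
    (S.measurable_blockLoss j (m - i)).comp (measurable_shiftSeq i)).const_mul _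

theorem abs_Φ_le (j : ι) (k : ℕ) (x : ℕ → E) : |S.Φ j k (S.inputs x)| ≤ ∑ q, S.C q := by
  rw [S.hΦ.eq_sum j k _ (S.inputs_mem x)]
  refine (Finset.abs_sum_le_sum_abs _ _).trans (Finset.sum_le_sum fun q _ => ?_)
  rw [abs_mul]
  exact (mul_le_of_le_one_right (abs_nonneg _) (S.hΦ.feat_le k _ q (S.inputs_mem x))).trans
    (S.hΦ.coef_le j q)

theorem exists_blockLoss_bound : ∃ K, ∀ j k x, |S.blockLoss j k x| ≤ K := by
  obtain ⟨K, hK⟩ := S.hy.exists_bound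
  refine ⟨|S.loss 0 0| + S.Lℓ * (∑ q, S.C q + K), fun j k x => ?_⟩
  have h1 := S.loss_lip (S.Φ j k (S.inputs x)) 0 (S.gy x) 0
  rw [sub_zero, sub_zero] at h1
  have h2 := mul_le_mul_of_nonneg_left (add_le_add (S.abs_Φ_le j k x) (hK x)) S.Lℓ_nonneg
  have h3 := abs_sub_abs_le_abs_sub (S.blockLoss j k x) (S.loss 0 0)
  unfold blockLoss at h3 ⊢
  linarith

theorem abs_blockLoss_sub_le (j : ι) (k : ℕ) (x x' : ℕ → E) :
    |S.blockLoss j k x - S.blockLoss j k x'| ≤ S.Lℓ * (S.Lh * (S.a *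
      ∑ s ∈ Finset.range k, S.r ^ s * |S.inputs x s - S.inputs x' s|) + |S.gy x - S.gy x'|) :=
  (S.loss_lip _ _ _ _).trans (mul_le_mul_of_nonneg_left (add_le_add
    (S.hΦ.lipschitz j k _ _ (S.inputs_mem x) (S.inputs_mem x')) le_rfl) S.Lℓ_nonneg)

/-- The error of truncating a sequence of innovations after `τ` steps. -/
def padErr (e₀ : E) (τ : ℕ) (x : ℕ → E) : ℝ :=
  S.Lh * (S.a * ∑ s ∈ Finset.range τ, S.r ^ s *
    |S.inputs x s - S.inputs (padSeq e₀ τ x) s|) + |S.gy x - S.gy (padSeq e₀ τ x)|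

theorem abs_blockLoss_sub_padSeq_le (e₀ : E) (j : ι) (τ : ℕ) (x : ℕ → E) :
    |S.blockLoss j τ x - S.blockLoss j τ (padSeq e₀ τ x)| ≤ S.Lℓ * S.padErr e₀ τ x :=
  S.abs_blockLoss_sub_le j τ x _

theorem abs_blockLoss_sub_padSeq_le' (e₀ : E) (j : ι) (k τ : ℕ) (x : ℕ → E) :
    |S.blockLoss j τ (padSeq e₀ τ x) - S.blockLoss j k x| ≤
      S.Lℓ * (S.Lh * (S.r ^ k + S.r ^ τ) + S.padErr e₀ τ x) := by
  refine (S.loss_lip _ _ _ _).trans (mul_le_mul_of_nonneg_left ?_ S.Lℓ_nonneg)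
  rw [padErr, ← add_assoc, ← mul_add, abs_sub_comm (S.gy _)]
  refine add_le_add ?_ le_rfl
  have hk := pow_nonneg S.hΦ.r_nonneg k
  have hτ := pow_nonneg S.hΦ.r_nonneg τ
  have hx := S.inputs_mem x
  have hp := S.inputs_mem (padSeq e₀ τ x)
  -- The two runs share their last `min k τ` steps. Keeping both `r ^ k` and `r ^ τ` in the bound
  -- covers either order.
  rcases le_total τ k with h | h
  · obtain ⟨l, rfl⟩ := Nat.exists_eq_add_of_le h
    rw [abs_sub_comm]
    refine (S.hΦ.forget j τ l _ _ hx hp).trans (mul_le_mul_of_nonneg_left ?_ S.hΦ.Lh_nonneg)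
    linarith
  · obtain ⟨l, rfl⟩ := Nat.exists_eq_add_of_le h
    refine (S.hΦ.forget j k l _ _ hp hx).trans (mul_le_mul_of_nonneg_left ?_ S.hΦ.Lh_nonneg)
    have h1 : ∑ s ∈ Finset.range k, S.r ^ s *
        |S.inputs (padSeq e₀ (k + l) x) s - S.inputs x s| ≤
        ∑ s ∈ Finset.range (k + l), S.r ^ s *
          |S.inputs x s - S.inputs (padSeq e₀ (k + l) x) s| := by
      simp only [abs_sub_comm (S.inputs x _)]
      exact Finset.sum_le_sum_of_subset_of_nonneg (Finset.range_mono (Nat.le_add_right k l))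
        fun s _ _ => mul_nonneg (pow_nonneg S.hΦ.r_nonneg s) (abs_nonneg _)
    have := mul_le_mul_of_nonneg_left h1 S.hΦ.a_nonneg
    linarith

theorem measurable_padErr (e₀ : E) (τ : ℕ) : Measurable (S.padErr e₀ τ) := by
  have hi : ∀ s, Measurable fun x => S.inputs x s := fun s =>
    (measurable_pi_apply s).comp S.measurable_inputs
  have hp := measurable_padSeq e₀ τ
  exact (((Finset.measurable_sum _ fun s _ =>
    (((hi s).sub ((hi s).comp hp)).abs.const_mul _)).const_mul _).const_mul _).add
      (S.hy.measurable.sub (S.hy.measurable.comp hp)).abs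

theorem exists_padErr_bound (e₀ : E) (τ : ℕ) : ∃ K, ∀ x, |S.padErr e₀ τ x| ≤ K := by
  obtain ⟨Kv, hKv⟩ := S.hv.exists_bound
  obtain ⟨Ky, hKy⟩ := S.hy.exists_bound
  have := S.hΦ.Lh_nonneg
  have := S.hΦ.a_nonneg
  have hr := S.hΦ.r_nonneg
  refine ⟨S.Lh * (S.a * ∑ s ∈ Finset.range τ, S.r ^ s * (Kv + Kv)) + (Ky + Ky), fun x => ?_⟩
  have h0 : 0 ≤ S.padErr e₀ τ x := by unfold padErr; positivity
  rw [abs_of_nonneg h0, padErr]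
  gcongr
  · exact (abs_sub _ _).trans (add_le_add (hKv _) (hKv _))
  · exact (abs_sub _ _).trans (add_le_add (hKy _) (hKy _))

variable {Ω : Type*} [MeasurableSpace Ω] {μ : Measure Ω} [IsProbabilityMeasure μ]
  {X : ℕ → Ω → E}

theorem integrable_padErr (hX : ∀ t, Measurable (X t)) (e₀ : E) (τ i : ℕ) :
    Integrable (fun ω => S.padErr e₀ τ (shiftSeq i fun t => X t ω)) μ := by
  obtain ⟨K, hK⟩ := S.exists_padErr_bound e₀ τ
  exact integrable_of_abs_le ((S.measurable_padErr e₀ τ).comp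
    ((measurable_shiftSeq i).comp (measurable_pi_lambda _ hX))) fun ω => hK _

/-- An input `s` steps back is damped by `r ^ s` and has truncation error of order `Dv ^ (τ - s)`.
Each product is at most `ζ ^ τ`; the `τ` of them give the factor behind the `log m / m` term. -/
theorem integral_padErr_le (hX : ∀ t, Measurable (X t)) {e₀ : E} {mv my ζ : ℝ}
    (hmv : ∀ t, ∫ ω, S.dv (X t ω) e₀ ∂μ = mv) (hmy : ∀ t, ∫ ω, S.dy (X t ω) e₀ ∂μ = my)
    (hrζ : S.r ≤ ζ) (hvζ : S.Dv ≤ ζ) (hyζ : S.Dy ≤ ζ) (τ i : ℕ) :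
    ∫ ω, S.padErr e₀ τ (shiftSeq i fun t => X t ω) ∂μ ≤
      (S.Lh * (S.a * (τ * (S.Lv * mv / (1 - S.Dv)))) + S.Ly * my / (1 - S.Dy)) * ζ ^ τ := by
  have hm : Measurable fun ω t => X t ω := measurable_pi_lambda _ hX
  have hsm := (measurable_shiftSeq i).comp hm
  have hi : ∀ s, Measurable fun x => S.inputs x s := fun s =>
    (measurable_pi_apply s).comp S.measurable_inputs
  have hp := measurable_padSeq e₀ τ
  obtain ⟨Kv, hKv⟩ := S.hv.exists_bound
  obtain ⟨Ky, hKy⟩ := S.hy.exists_bound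
  have hmv0 : 0 ≤ mv := by rw [← hmv 0]; exact integral_nonneg fun ω => S.hv.d_nonneg _ _
  have hmy0 : 0 ≤ my := by rw [← hmy 0]; exact integral_nonneg fun ω => S.hy.d_nonneg _ _
  have hζ : 0 ≤ ζ := S.hΦ.r_nonneg.trans hrζ
  have hDv : 0 < 1 - S.Dv := by linarith [S.hv.D_lt_one]
  have hDy : 0 < 1 - S.Dy := by linarith [S.hy.D_lt_one]
  have hLv := S.hv.L_nonneg
  have hLy := S.hy.L_nonneg
  have hLh := S.hΦ.Lh_nonneg
  have ha := S.hΦ.a_nonneg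
  have i1 : ∀ s, Integrable (fun ω => |S.inputs (shiftSeq i fun t => X t ω) s -
      S.inputs (padSeq e₀ τ (shiftSeq i fun t => X t ω)) s|) μ := fun s => by
    refine integrable_of_abs_le (((hi s).sub ((hi s).comp hp)).abs.comp hsm)
      (K := Kv + Kv) fun ω => ?_
    rw [abs_abs]
    exact (abs_sub _ _).trans (add_le_add (hKv _) (hKv _))
  have i2 : Integrable (fun ω => |S.gy (shiftSeq i fun t => X t ω) -
      S.gy (padSeq e₀ τ (shiftSeq i fun t => X t ω))|) μ := by
    refine integrable_of_abs_le
      ((S.hy.measurable.sub (S.hy.measurable.comp hp)).abs.comp hsm) (K := Ky + Ky) fun ω => ?_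
    rw [abs_abs]
    exact (abs_sub _ _).trans (add_le_add (hKy _) (hKy _))
  have i3 : Integrable (fun ω => ∑ s ∈ Finset.range τ, S.r ^ s *
      |S.inputs (shiftSeq i fun t => X t ω) s -
        S.inputs (padSeq e₀ τ (shiftSeq i fun t => X t ω)) s|) μ :=
    integrable_finsetSum _ fun s _ => (i1 s).const_mul _
  have hy0 : shiftSeq 0 = (id : (ℕ → E) → ℕ → E) := by
    funext x k; simp [shiftSeq]
  have h2 := S.hy.integral_abs_sub_padSeq_le (μ := μ) hX hmy τ 0 i
  simp only [hy0, id, Nat.sub_zero] at h2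
  have h1 : ∀ s ∈ Finset.range τ, S.r ^ s * ∫ ω, |S.inputs (shiftSeq i fun t => X t ω) s -
      S.inputs (padSeq e₀ τ (shiftSeq i fun t => X t ω)) s| ∂μ ≤
      S.Lv * mv / (1 - S.Dv) * ζ ^ τ := by
    intro s hs
    have hs' : s + (τ - s) = τ := by have := Finset.mem_range.1 hs; omega
    have h3 := S.hv.integral_abs_sub_padSeq_le (μ := μ) hX hmv τ s i
    calc _ ≤ ζ ^ s * (S.Lv * mv * (ζ ^ (τ - s) / (1 - S.Dv))) := by
          refine mul_le_mul (pow_le_pow_left₀ S.hΦ.r_nonneg hrζ s) (h3.trans ?_)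
            (integral_nonneg fun ω => abs_nonneg _) (pow_nonneg hζ s)
          have := pow_le_pow_left₀ S.hv.D_nonneg hvζ (τ - s)
          gcongr
      _ = S.Lv * mv / (1 - S.Dv) * (ζ ^ s * ζ ^ (τ - s)) := by ring
      _ = _ := by rw [← pow_add, hs']
  have h4 := Finset.sum_le_sum h1
  rw [Finset.sum_const, Finset.card_range, nsmul_eq_mul] at h4
  unfold padErr
  rw [integral_add ((i3.const_mul _).const_mul _) i2, integral_const_mul, integral_const_mul,
    integral_finsetSum _ fun s _ => (i1 s).const_mul _]
  simp only [integral_const_mul]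
  have h5 : S.Ly * my * (S.Dy ^ τ / (1 - S.Dy)) ≤ S.Ly * my / (1 - S.Dy) * ζ ^ τ := by
    rw [← mul_div_assoc, mul_div_right_comm]
    exact mul_le_mul_of_nonneg_left (pow_le_pow_left₀ S.hy.D_nonneg hyζ τ) (by positivity)
  have h6 := mul_le_mul_of_nonneg_left (mul_le_mul_of_nonneg_left h4 ha) hLh
  have h7 := h2.trans h5
  rw [add_mul]
  refine add_le_add (h6.trans (le_of_eq (by ring))) h7

end Setup
end Setup
/-! ### The expected supremum of the generalisation gap -/

section Windows

variable {E : Type*} [MeasurableSpace E] {Ω : Type*} [MeasurableSpace Ω] {μ : Measure Ω}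
  [IsProbabilityMeasure μ] {X : ℕ → Ω → E}

/-- The innovations at the times `-i, …, -i - τ + 1`, followed by a constant. -/
def window (X : ℕ → Ω → E) (e₀ : E) (τ i : ℕ) (ω : Ω) : ℕ → E :=
  padSeq e₀ τ (shiftSeq i fun t => X t ω)

theorem measurable_window (hX : ∀ t, Measurable (X t)) (e₀ : E) (τ i : ℕ) :
    Measurable (window X e₀ τ i) :=
  (measurable_padSeq e₀ τ).comp ((measurable_shiftSeq i).comp (measurable_pi_lambda _ hX))

omit [IsProbabilityMeasure μ] in
-- Both laws are infinite products of the same marginal.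
theorem map_shiftSeq_eq (hX : ∀ t, Measurable (X t)) (hind : iIndepFun X μ)
    (hid : ∀ t, μ.map (X t) = μ.map (X 0)) (i : ℕ) :
    μ.map (fun ω => shiftSeq i fun t => X t ω) = μ.map (fun ω t => X t ω) := by
  have h1 : iIndepFun (fun t => X (i + t)) μ := hind.precomp (add_right_injective i)
  have h2 := h1.map_fun_eq_infinitePi_map fun t => hX (i + t)
  have h3 := hind.map_fun_eq_infinitePi_map hX
  rw [h3]
  refine h2.trans ?_
  congr 1
  funext t
  rw [hid, ← hid t]

omit [IsProbabilityMeasure μ] in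
theorem map_window_eq (hX : ∀ t, Measurable (X t)) (hind : iIndepFun X μ)
    (hid : ∀ t, μ.map (X t) = μ.map (X 0)) (e₀ : E) (τ i : ℕ) :
    μ.map (window X e₀ τ i) = μ.map (window X e₀ τ 0) := by
  have h : ∀ i, μ.map (window X e₀ τ i) = (μ.map (fun ω t => X t ω)).map (padSeq e₀ τ) := by
    intro i
    have hs : Measurable fun ω => shiftSeq i fun t => X t ω :=
      (measurable_shiftSeq i).comp (measurable_pi_lambda _ hX)
    rw [← map_shiftSeq_eq hX hind hid i, Measure.map_map (measurable_padSeq e₀ τ) hs]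
    rfl
  rw [h, h]

theorem add_le_of_mod_eq {τ i l : ℕ} (h : i % τ = l % τ) (hil : i < l) : i + τ ≤ l := by
  have h1 : τ ∣ l - i := (Nat.modEq_iff_dvd' hil.le).1 h
  have := Nat.le_of_dvd (by omega) h1
  omega

omit [IsProbabilityMeasure μ] in
-- Positions congruent modulo `τ` are at least `τ` apart, so the windows read disjoint finite sets
-- of innovations.
theorem indepFun_sum_window (hX : ∀ t, Measurable (X t)) (hind : iIndepFun X μ) (e₀ : E)
    {τ s : ℕ} {F : Type*} [AddCommMonoid F] [MeasurableSpace F] [MeasurableAdd₂ F]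
    {f : (ℕ → E) → F} (hf : Measurable f) {J : Finset ℕ} (hJ : ∀ l ∈ J, l % τ = s) {i : ℕ}
    (hi : i % τ = s) (hiJ : i ∉ J) :
    IndepFun (fun ω => ∑ l ∈ J, f (window X e₀ τ l ω)) (window X e₀ τ i) μ := by
  classical
  set A := J.biUnion fun l => Finset.Ico l (l + τ)
  set B := Finset.Ico i (i + τ)
  have hAB : Disjoint A B := by
    rw [Finset.disjoint_left]
    intro t hA hB
    obtain ⟨l, hl, hlt⟩ := Finset.mem_biUnion.1 hA
    rw [Finset.mem_Ico] at hlt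
    have hB' := Finset.mem_Ico.1 hB
    have hne : i ≠ l := fun h => hiJ (h ▸ hl)
    rcases lt_or_gt_of_ne hne with h | h
    · have := add_le_of_mod_eq (hi.trans (hJ l hl).symm) h
      omega
    · have := add_le_of_mod_eq ((hJ l hl).trans hi.symm) h
      omega
  have h1 := hind.indepFun_finset A B hAB hX
  -- Rebuilds the window at `l` from the innovations indexed by `D`; it is correct once `D` contains
  -- `[l, l + τ)`.
  let ext : (D : Finset ℕ) → (l : ℕ) → (D → E) → ℕ → E := fun D l p k =>
    if h : k < τ ∧ l + k ∈ D then p ⟨l + k, h.2⟩ else e₀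
  have hext : ∀ D l, Measurable (ext D l) := by
    intro D l
    refine measurable_pi_lambda _ fun k => ?_
    simp only [ext]
    split_ifs
    · exact measurable_pi_apply _
    · exact measurable_const
  have hwin : ∀ (D : Finset ℕ) (l : ℕ), Finset.Ico l (l + τ) ⊆ D → ∀ ω,
      window X e₀ τ l ω = ext D l fun t => X t ω := by
    intro D l hD ω
    funext k
    simp only [window, padSeq, shiftSeq, ext]
    by_cases hk : k < τ
    · have : l + k ∈ D := hD (Finset.mem_Ico.2 ⟨by omega, by omega⟩)
      simp [hk, this]
    · simp [hk]
  have h2 := h1.comp (φ := fun p => ∑ l ∈ J, f (ext A l p)) (ψ := ext B i)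
    (Finset.measurable_sum _ fun l _ => hf.comp (hext A l)) (hext B i)
  have e1 : (fun ω => ∑ l ∈ J, f (window X e₀ τ l ω)) =
      (fun p => ∑ l ∈ J, f (ext A l p)) ∘ fun ω (t : A) => X t ω := by
    funext ω
    refine Finset.sum_congr rfl fun l hl => ?_
    rw [hwin A l (Finset.subset_biUnion_of_mem (fun l => Finset.Ico l (l + τ)) hl)]
  have e2 : window X e₀ τ i = ext B i ∘ fun ω (t : B) => X t ω := by
    funext ω
    exact hwin B i subset_rfl ω
  rw [e1, e2]
  exact h2

end Windows

/-! ### Blocking: from one residue class to the mean of the supremum -/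

namespace Setup

variable {E ι Q : Type*} [MeasurableSpace E] [Fintype Q] (S : Setup E ι Q)
variable {Ω : Type*} [MeasurableSpace Ω] {μ : Measure Ω} [IsProbabilityMeasure μ]
  {X : ℕ → Ω → E}

theorem abs_iSup_le {κ : Type*} [Finite κ] [Nonempty κ] {f : κ → ℝ} {K : ℝ}
    (h : ∀ j, |f j| ≤ K) : |⨆ j, f j| ≤ K := by
  obtain ⟨j, hj⟩ := exists_eq_ciSup_of_finite (f := f)
  rw [← hj]
  exact h j

theorem iSup_sum_le_of_finite {κ α : Type*} [Finite κ] [Nonempty κ] (s : Finset α)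
    (f : α → κ → ℝ) : ⨆ j, ∑ i ∈ s, f i j ≤ ∑ i ∈ s, ⨆ j, f i j :=
  ciSup_le fun j => Finset.sum_le_sum fun i _ => le_ciSup (Set.finite_range (f i)).bddAbove j

variable [Fintype ι] [Nonempty ι]

/-- The expected supremum over one residue class modulo `τ`. -/
theorem integral_iSup_window_le (hX : ∀ t, Measurable (X t)) (hind : iIndepFun X μ)
    (hid : ∀ t, μ.map (X t) = μ.map (X 0)) (e₀ : E) (τ s : ℕ) {J : Finset ℕ}
    (hJ : ∀ l ∈ J, l % τ = s) :
    ∫ ω, ⨆ j, ∑ l ∈ J, (∫ ω', S.blockLoss j τ (window X e₀ τ 0 ω') ∂μ -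
      S.blockLoss j τ (window X e₀ τ l ω)) ∂μ ≤
      2 * S.Lℓ * (∑ q, S.C q) * Real.sqrt J.card := by
  have hW := fun i => measurable_window (X := X) hX e₀ τ i
  set ν := μ.map (window X e₀ τ 0)
  have : IsProbabilityMeasure ν := Measure.isProbabilityMeasure_map (hW 0).aemeasurable
  obtain ⟨K, hK⟩ := S.exists_blockLoss_bound
  have hK0 : 0 ≤ max K (∑ q, S.C q) :=
    ((abs_nonneg _).trans (hK (Classical.arbitrary ι) 0 fun _ => e₀)).trans (le_max_left _ _)
  set f : (ℕ → E) → ι → ℝ := fun y j => S.blockLoss j τ y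
  set h : (ℕ → E) → ι → ℝ := fun y j => S.Φ j τ (S.inputs y)
  have hf : Measurable f := measurable_pi_lambda _ fun j => S.measurable_blockLoss j τ
  have hh : Measurable h :=
    measurable_pi_lambda _ fun j => (S.hΦ.measurable j τ).comp S.measurable_inputs
  have hfK : ∀ y, ‖f y‖ ≤ max K (∑ q, S.C q) := fun y =>
    (pi_norm_le_iff_of_nonneg hK0).2 fun j => (hK j τ y).trans (le_max_left _ _)
  have hhK : ∀ y, ‖h y‖ ≤ max K (∑ q, S.C q) := fun y =>
    (pi_norm_le_iff_of_nonneg hK0).2 fun j => (S.abs_Φ_le j τ y).trans (le_max_right _ _)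
  -- Two readouts see the same target, so only the first argument of the loss changes.
  have hfh : ∀ y j l, |f y j - f y l| ≤ S.Lℓ * |h y j - h y l| := fun y j l => by
    have := S.loss_lip (S.Φ j τ (S.inputs y)) (S.Φ l τ (S.inputs y)) (S.gy y) (S.gy y)
    rwa [sub_self, abs_zero, add_zero] at this
  have key := integral_iSup_centred_sum_le (μ := μ) (ν := ν) (f := f) (h := h) (L := S.Lℓ)
    S.hΦ.coef_le (g := fun y => S.feat τ (S.inputs y))
    (fun y q => S.hΦ.feat_le τ _ q (S.inputs_mem y)) hf hfK hh hhK
    (fun y j => S.hΦ.eq_sum j τ _ (S.inputs_mem y)) S.Lℓ_nonneg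
    hfh
    hW (fun i => map_window_eq hX hind hid e₀ τ i) J
    (fun J' hJ' i hi hiJ' => indepFun_sum_window hX hind e₀ (measurable_const.sub hf)
      (fun l hl => hJ l (hJ' hl)) (hJ i hi) hiJ')
  refine le_trans (le_of_eq ?_) key
  congr 1
  funext ω
  congr 1
  funext j
  rw [Finset.sum_apply]
  refine Finset.sum_congr rfl fun l _ => ?_
  rw [Pi.sub_apply, eval_integral fun j => integrable_of_abs_le (S.measurable_blockLoss j τ)
    fun y => hK j τ y, integral_map (hW 0).aemeasurable
      (S.measurable_blockLoss j τ).aestronglyMeasurable]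

/-- Cauchy-Schwarz over the `τ` residue classes, whose sizes add up to `m`. -/
theorem sum_sqrt_card_le (m τ : ℕ) (hτ : 0 < τ) :
    ∑ s ∈ Finset.range τ, Real.sqrt ((Finset.range m).filter fun i => i % τ = s).card ≤
      Real.sqrt (τ * m) := by
  apply Real.le_sqrt_of_sq_le
  refine sq_sum_le_card_mul_sum_sq.trans ?_
  rw [Finset.card_range]
  refine mul_le_mul_of_nonneg_left (le_of_eq ?_) (Nat.cast_nonneg τ)
  simp only [Real.sq_sqrt (Nat.cast_nonneg _)]
  have := Finset.card_eq_sum_card_fiberwise (s := Finset.range m) (t := Finset.range τ)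
    (f := fun i => i % τ) fun i _ => Finset.mem_coe.2 (Finset.mem_range.2 (Nat.mod_lt i hτ))
  rw [Finset.card_range] at this
  exact_mod_cast this.symm

theorem integrable_iSup_blockLoss (hX : ∀ t, Measurable (X t)) (e₀ : E) (τ : ℕ) (J : Finset ℕ) :
    Integrable (fun ω => ⨆ j, ∑ l ∈ J, (∫ ω', S.blockLoss j τ (window X e₀ τ 0 ω') ∂μ -
      S.blockLoss j τ (window X e₀ τ l ω))) μ := by
  obtain ⟨K, hK⟩ := S.exists_blockLoss_bound
  refine integrable_of_abs_le (Measurable.iSup fun j => Finset.measurable_sum _ fun l _ =>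
    measurable_const.sub ((S.measurable_blockLoss j τ).comp (measurable_window hX e₀ τ l)))
    (K := ∑ _l ∈ J, (K + K)) fun ω => abs_iSup_le fun j =>
      (Finset.abs_sum_le_sum_abs _ _).trans (Finset.sum_le_sum fun l _ =>
        (abs_sub _ _).trans (add_le_add ?_ (hK _ _ _)))
  have := norm_integral_le_of_norm_le_const (μ := μ)
    (f := fun ω' => S.blockLoss j τ (window X e₀ τ 0 ω'))
    (Filter.Eventually.of_forall fun ω' => hK j τ _)
  simpa using this

/-- The expected supremum over all windows. -/
theorem integral_iSup_window_range_le (hX : ∀ t, Measurable (X t)) (hind : iIndepFun X μ)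
    (hid : ∀ t, μ.map (X t) = μ.map (X 0)) (e₀ : E) (τ m : ℕ) :
    ∫ ω, ⨆ j, ∑ l ∈ Finset.range m, (∫ ω', S.blockLoss j τ (window X e₀ τ 0 ω') ∂μ -
      S.blockLoss j τ (window X e₀ τ l ω)) ∂μ ≤
      2 * S.Lℓ * (∑ q, S.C q) * Real.sqrt (τ * m) := by
  have hC0 : 0 ≤ ∑ q, S.C q :=
    (abs_nonneg _).trans (S.abs_Φ_le (Classical.arbitrary ι) 0 fun _ => e₀)
  rcases Nat.eq_zero_or_pos τ with rfl | hτ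
  -- The case `τ = 0` does occur, for instance when `m = 1`. The windows are then constant and both
  -- sides vanish.
  · have : ∀ l ω, window X e₀ 0 l ω = fun _ => e₀ := fun l ω => by
      funext k; simp [window, padSeq]
    simp [this]
  · set D : ℕ → Finset ℕ := fun s => (Finset.range m).filter fun i => i % τ = s
    have hsplit : ∀ g : ℕ → ℝ, ∑ l ∈ Finset.range m, g l =
        ∑ s ∈ Finset.range τ, ∑ l ∈ D s, g l := fun g =>
      (Finset.sum_fiberwise_of_maps_to (fun i _ => Finset.mem_range.2 (Nat.mod_lt i hτ)) g).symm
    calc _ ≤ ∫ ω, ∑ s ∈ Finset.range τ, ⨆ j, ∑ l ∈ D s,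
          (∫ ω', S.blockLoss j τ (window X e₀ τ 0 ω') ∂μ -
            S.blockLoss j τ (window X e₀ τ l ω)) ∂μ := by
          refine integral_mono (S.integrable_iSup_blockLoss hX e₀ τ _)
            (integrable_finsetSum _ fun s _ => S.integrable_iSup_blockLoss hX e₀ τ _) fun ω => ?_
          simp only [hsplit]
          exact iSup_sum_le_of_finite _ _
      _ ≤ ∑ s ∈ Finset.range τ, 2 * S.Lℓ * (∑ q, S.C q) * Real.sqrt (D s).card := by
          rw [integral_finsetSum _ fun s _ => S.integrable_iSup_blockLoss hX e₀ τ _]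
          exact Finset.sum_le_sum fun s _ => S.integral_iSup_window_le hX hind hid e₀ τ s
            fun l hl => (Finset.mem_filter.1 hl).2
      _ ≤ _ := by
          rw [← Finset.mul_sum]
          have := S.Lℓ_nonneg
          exact mul_le_mul_of_nonneg_left (sum_sqrt_card_le m τ hτ) (by positivity)

/-- The run ending at time `-i` has only `m - i` observed inputs, so its initial state is forgotten
up to `r ^ (m - i)`. The sum over `i` is the shape of `constC0`. -/
theorem sum_range_pow_sub {r : ℝ} (hr : r < 1) (m : ℕ) :
    ∑ i ∈ Finset.range m, r ^ (m - i) = (1 - r ^ m) * r / (1 - r) := by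
  have h1 : (1 - r) ≠ 0 := by linarith
  induction m with
  | zero => simp
  | succ m ih =>
    rw [Finset.sum_range_succ']
    simp only [Nat.add_sub_add_right, Nat.sub_zero, ih]
    field_simp
    ring

omit [Fintype ι] [Nonempty ι] in
theorem abs_sub_integral_window_le (hX : ∀ t, Measurable (X t)) {e₀ : E} {τ : ℕ} {j : ι}
    {R err δ : ℝ} (hR : |R - ∫ ω, S.blockLoss j τ (fun t => X t ω) ∂μ| ≤ δ)
    (herr : ∫ ω, S.padErr e₀ τ (shiftSeq 0 fun t => X t ω) ∂μ ≤ err) :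
    |R - ∫ ω, S.blockLoss j τ (window X e₀ τ 0 ω) ∂μ| ≤ δ + S.Lℓ * err := by
  obtain ⟨K, hK⟩ := S.exists_blockLoss_bound
  have hm : Measurable fun ω t => X t ω := measurable_pi_lambda _ hX
  have h0 : (shiftSeq 0 : (ℕ → E) → ℕ → E) = id := by funext x k; simp [shiftSeq]
  have i1 : Integrable (fun ω => S.blockLoss j τ fun t => X t ω) μ :=
    integrable_of_abs_le ((S.measurable_blockLoss j τ).comp hm) fun ω => hK _ _ _
  have i2 : Integrable (fun ω => S.blockLoss j τ (window X e₀ τ 0 ω)) μ :=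
    integrable_of_abs_le ((S.measurable_blockLoss j τ).comp (measurable_window hX e₀ τ 0))
      fun ω => hK _ _ _
  have h1 : |∫ ω, S.blockLoss j τ (fun t => X t ω) ∂μ -
      ∫ ω, S.blockLoss j τ (window X e₀ τ 0 ω) ∂μ| ≤ S.Lℓ * err := by
    rw [← integral_sub i1 i2]
    refine (abs_integral_le_integral_abs).trans ?_
    calc _ ≤ ∫ ω, S.Lℓ * S.padErr e₀ τ (shiftSeq 0 fun t => X t ω) ∂μ :=
          integral_mono (i1.sub i2).abs ((S.integrable_padErr hX e₀ τ 0).const_mul _) fun ω => by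
            simp only [h0, id, window]
            exact S.abs_blockLoss_sub_padSeq_le e₀ j τ _
      _ ≤ _ := by
          rw [integral_const_mul]
          exact mul_le_mul_of_nonneg_left herr S.Lℓ_nonneg
  have := abs_sub_le R (∫ ω, S.blockLoss j τ (fun t => X t ω) ∂μ)
    (∫ ω, S.blockLoss j τ (window X e₀ τ 0 ω) ∂μ)
  linarith

/-- The expected supremum of the generalisation gap, for windows of any length `τ`. -/
theorem integral_iSup_gap_le (hX : ∀ t, Measurable (X t)) (hind : iIndepFun X μ)
    (hid : ∀ t, μ.map (X t) = μ.map (X 0)) {e₀ : E} {τ m : ℕ} (hm : 0 < m) {R : ι → ℝ} {err : ℝ}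
    (hR : ∀ j, |R j - ∫ ω, S.blockLoss j τ (fun t => X t ω) ∂μ| ≤ S.Lℓ * (S.Lh * S.r ^ τ))
    (herr : ∀ i, ∫ ω, S.padErr e₀ τ (shiftSeq i fun t => X t ω) ∂μ ≤ err) :
    ∫ ω, ⨆ j, (R j - S.empLoss m j fun t => X t ω) ∂μ ≤
      S.Lℓ * (S.Lh * ((1 - S.r ^ m) * S.r / (1 - S.r))) * (1 / (m : ℝ)) +
      2 * (S.Lℓ * (S.Lh * S.r ^ τ + err)) +
      2 * S.Lℓ * (∑ q, S.C q) * Real.sqrt (τ / m) := by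
  have hmp : (0 : ℝ) < m := by exact_mod_cast hm
  have hmX : Measurable fun ω t => X t ω := measurable_pi_lambda _ hX
  obtain ⟨K, hK⟩ := S.exists_blockLoss_bound
  set P : ι → ℝ := fun j => ∫ ω', S.blockLoss j τ (window X e₀ τ 0 ω') ∂μ
  set G : ℕ → Ω → ℝ := fun i ω => S.Lℓ * (S.Lh * (S.r ^ (m - i) + S.r ^ τ) +
    S.padErr e₀ τ (shiftSeq i fun t => X t ω))
  have hG : ∀ i, Integrable (G i) μ := fun i =>
    ((integrable_const _).add (S.integrable_padErr hX e₀ τ i)).const_mul _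
  have hGi : ∀ i, ∫ ω, G i ω ∂μ ≤ S.Lℓ * (S.Lh * (S.r ^ (m - i) + S.r ^ τ) + err) := fun i => by
    simp only [G]
    rw [integral_const_mul, integral_add (integrable_const _) (S.integrable_padErr hX e₀ τ i)]
    refine mul_le_mul_of_nonneg_left ?_ S.Lℓ_nonneg
    simpa using herr i
  set T : Ω → ℝ := fun ω => ⨆ j, ∑ l ∈ Finset.range m,
    (P j - S.blockLoss j τ (window X e₀ τ l ω))
  have hT : Integrable T μ := S.integrable_iSup_blockLoss hX e₀ τ _
  have hTi : ∫ ω, T ω ∂μ ≤ 2 * S.Lℓ * (∑ q, S.C q) * Real.sqrt (τ * m) :=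
    S.integral_iSup_window_range_le hX hind hid e₀ τ m
  set δ := S.Lℓ * (S.Lh * S.r ^ τ) + S.Lℓ * err
  have hP : ∀ j, |R j - P j| ≤ δ := fun j =>
    S.abs_sub_integral_window_le hX (hR j) (herr 0)
  have hpt : ∀ ω, (⨆ j, (R j - S.empLoss m j fun t => X t ω)) ≤
      δ + (1 / (m : ℝ)) * (∑ i ∈ Finset.range m, G i ω) + (1 / (m : ℝ)) * T ω := by
    intro ω
    refine ciSup_le fun j => ?_
    -- Three errors: truncation in the mean, truncation and run length along the sample, and the
    -- centred sum over windows. Only the last requires a supremum over `j` under the integral.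
    have h1 : R j - S.empLoss m j (fun t => X t ω) = (R j - P j) +
        (1 / (m : ℝ)) * (∑ i ∈ Finset.range m, (S.blockLoss j τ (window X e₀ τ i ω) -
          S.blockLoss j (m - i) (shiftSeq i fun t => X t ω))) +
        (1 / (m : ℝ)) * ∑ l ∈ Finset.range m, (P j - S.blockLoss j τ (window X e₀ τ l ω)) := by
      rw [empLoss, Finset.sum_sub_distrib, Finset.sum_sub_distrib, Finset.sum_const,
        Finset.card_range, nsmul_eq_mul]
      field_simp
      ring
    rw [h1]
    have hm0 : 0 ≤ 1 / (m : ℝ) := by positivity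
    refine add_le_add (add_le_add ((le_abs_self _).trans (hP j))
      (mul_le_mul_of_nonneg_left (Finset.sum_le_sum fun i _ => (le_abs_self _).trans
        (S.abs_blockLoss_sub_padSeq_le' e₀ j (m - i) τ _)) hm0))
      (mul_le_mul_of_nonneg_left (le_iSup_fintype
        (fun j => ∑ l ∈ Finset.range m, (P j - S.blockLoss j τ (window X e₀ τ l ω))) j) hm0)
  have hint : Integrable (fun ω => ⨆ j, (R j - S.empLoss m j fun t => X t ω)) μ := by
    refine integrable_of_abs_le (Measurable.iSup fun j => measurable_const.sub
      ((S.measurable_empLoss m j).comp hmX))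
      (K := (⨆ j, |R j|) + (1 / (m : ℝ)) * ∑ _i ∈ Finset.range m, K) fun ω => abs_iSup_le fun j => ?_
    refine (abs_sub _ _).trans (add_le_add (le_iSup_fintype (fun j => |R j|) j) ?_)
    rw [empLoss, abs_mul, abs_of_nonneg (by positivity : 0 ≤ 1 / (m : ℝ))]
    exact mul_le_mul_of_nonneg_left ((Finset.abs_sum_le_sum_abs _ _).trans
      (Finset.sum_le_sum fun i _ => hK _ _ _)) (by positivity)
  have hGs : Integrable (fun ω => (1 / (m : ℝ)) * (∑ i ∈ Finset.range m, G i ω)) μ :=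
    (integrable_finsetSum _ fun i _ => hG i).const_mul _
  have hδG : Integrable (fun ω => δ + (1 / (m : ℝ)) * (∑ i ∈ Finset.range m, G i ω)) μ :=
    (integrable_const δ).add hGs
  have h2 := integral_mono hint (hδG.add (hT.const_mul (1 / (m : ℝ)))) hpt
  refine h2.trans ?_
  have e1 : ∫ ω, (δ + (1 / (m : ℝ)) * (∑ i ∈ Finset.range m, G i ω) + (1 / (m : ℝ)) * T ω) ∂μ =
      δ + (1 / (m : ℝ)) * (∑ i ∈ Finset.range m, ∫ ω, G i ω ∂μ) + (1 / (m : ℝ)) * ∫ ω, T ω ∂μ := by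
    rw [integral_add hδG (hT.const_mul _),
      integral_add (integrable_const δ) hGs, integral_const_mul, integral_const_mul,
      integral_finsetSum _ fun i _ => hG i]
    simp
  refine (le_of_eq e1).trans ?_
  have h3 : ∑ i ∈ Finset.range m, ∫ ω, G i ω ∂μ ≤
      S.Lℓ * (S.Lh * ((1 - S.r ^ m) * S.r / (1 - S.r))) +
        m * (S.Lℓ * (S.Lh * S.r ^ τ + err)) := by
    refine (Finset.sum_le_sum fun i _ => hGi i).trans (le_of_eq ?_)
    rw [← sum_range_pow_sub S.hΦ.r_lt_one m, ← Finset.mul_sum, Finset.sum_add_distrib,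
      ← Finset.mul_sum, Finset.sum_add_distrib]
    simp only [Finset.sum_const, Finset.card_range, nsmul_eq_mul]
    ring
  have h4 : (1 / (m : ℝ)) * Real.sqrt (τ * m) = Real.sqrt (τ / m) := by
    have : (τ : ℝ) / m = τ * m / m ^ 2 := by field_simp
    rw [this, Real.sqrt_div (by positivity), Real.sqrt_sq hmp.le]
    ring
  have h5 := mul_le_mul_of_nonneg_left h3 (by positivity : 0 ≤ 1 / (m : ℝ))
  have h6 := mul_le_mul_of_nonneg_left hTi (by positivity : 0 ≤ 1 / (m : ℝ))
  rw [mul_left_comm, h4] at h6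
  have h7 : (1 / (m : ℝ)) * (m * (S.Lℓ * (S.Lh * S.r ^ τ + err))) =
      S.Lℓ * (S.Lh * S.r ^ τ + err) := by field_simp
  rw [mul_add, h7] at h5
  have h8 : δ = S.Lℓ * (S.Lh * S.r ^ τ + err) := by simp only [δ]; ring
  rw [h8]
  linarith

end Setup
/-! ### Concentration of the generalisation gap -/

section DiffWeight

variable {E : Type*}

theorem diffWeight_add {f g : ℕ → ℝ} (hf : ∀ t, 0 ≤ f t) (hfs : Summable f) (hg : ∀ t, 0 ≤ g t)
    (hgs : Summable g) (l : ℕ) (x x' : ℕ → E) :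
    diffWeight (fun t => f t + g t) l x x' = diffWeight f l x x' + diffWeight g l x x' := by
  classical
  unfold diffWeight
  rw [← (summable_ite hf hfs _).tsum_add (summable_ite hg hgs _)]
  refine tsum_congr fun t => ?_
  split_ifs <;> simp

theorem diffWeight_mul (k : ℝ) (f : ℕ → ℝ) (l : ℕ) (x x' : ℕ → E) :
    diffWeight (fun t => k * f t) l x x' = k * diffWeight f l x x' := by
  unfold diffWeight
  rw [← tsum_mul_left]
  refine tsum_congr fun t => ?_
  split_ifs <;> simp

theorem diffWeight_sum {α : Type*} (s : Finset α) {f : α → ℕ → ℝ} (hf : ∀ i t, 0 ≤ f i t)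
    (hfs : ∀ i, Summable (f i)) (l : ℕ) (x x' : ℕ → E) :
    diffWeight (fun t => ∑ i ∈ s, f i t) l x x' = ∑ i ∈ s, diffWeight (f i) l x x' := by
  classical
  unfold diffWeight
  rw [← Summable.tsum_finsetSum fun i _ => summable_ite (hf i) (hfs i) _]
  refine tsum_congr fun t => ?_
  split_ifs <;> simp

end DiffWeight

namespace Setup

variable {E ι Q : Type*} [MeasurableSpace E] [Fintype Q] (S : Setup E ι Q)

/-- The weight of the innovation at time `-t` in the input part of the empirical risk. -/
def inputWeight (m t : ℕ) : ℝ :=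
  ∑ i ∈ Finset.range m, ∑ s ∈ Finset.range m, S.r ^ s * delayed S.wv (i + s) t

/-- The weight of the innovation at time `-t` in the target part of the empirical risk. -/
def targetWeight (m t : ℕ) : ℝ := ∑ i ∈ Finset.range m, delayed S.wy i t

/-- The influence of the innovation at time `-t` on the empirical risk. -/
def influence (m t : ℕ) : ℝ :=
  2 * S.M * S.Lℓ * (1 / (m : ℝ)) * (S.Lh * S.a * S.Lv) * S.inputWeight m t +
    2 * S.M * S.Lℓ * (1 / (m : ℝ)) * S.Ly * S.targetWeight m t

/-- The bounded differences constant. -/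
def totalInfluence : ℝ :=
  2 * S.M * S.Lℓ * (S.Lh * S.a * S.Lv * (∑' k, S.wv k) / (1 - S.r) + S.Ly * ∑' k, S.wy k)

theorem inputSummand_nonneg (i s t : ℕ) : 0 ≤ S.r ^ s * delayed S.wv (i + s) t :=
  mul_nonneg (pow_nonneg S.hΦ.r_nonneg s) (delayed_nonneg S.hv.w_nonneg _ _)

theorem summable_inputSummand (i s : ℕ) : Summable fun t => S.r ^ s * delayed S.wv (i + s) t :=
  (summable_delayed S.hv.summable_w _).mul_left _

theorem inputWeight_nonneg (m t : ℕ) : 0 ≤ S.inputWeight m t :=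
  Finset.sum_nonneg fun _ _ => Finset.sum_nonneg fun _ _ => S.inputSummand_nonneg _ _ _

theorem targetWeight_nonneg (m t : ℕ) : 0 ≤ S.targetWeight m t :=
  Finset.sum_nonneg fun _ _ => delayed_nonneg S.hy.w_nonneg _ _

theorem summable_inputWeight (m : ℕ) : Summable (S.inputWeight m) :=
  summable_sum fun _ _ => summable_sum fun _ _ => S.summable_inputSummand _ _

theorem summable_targetWeight (m : ℕ) : Summable (S.targetWeight m) :=
  summable_sum fun _ _ => summable_delayed S.hy.summable_w _

theorem scale_nonneg (m : ℕ) : 0 ≤ 2 * S.M * S.Lℓ * (1 / (m : ℝ)) := by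
  have := S.hv.M_nonneg
  have := S.Lℓ_nonneg
  positivity

theorem input_scale_nonneg : 0 ≤ S.Lh * S.a * S.Lv := by
  have := S.hΦ.Lh_nonneg
  have := S.hΦ.a_nonneg
  have := S.hv.L_nonneg
  positivity

theorem influence_nonneg (m t : ℕ) : 0 ≤ S.influence m t :=
  add_nonneg (mul_nonneg (mul_nonneg (S.scale_nonneg m) S.input_scale_nonneg)
    (S.inputWeight_nonneg m t))
    (mul_nonneg (mul_nonneg (S.scale_nonneg m) S.hy.L_nonneg) (S.targetWeight_nonneg m t))

theorem summable_influence (m : ℕ) : Summable (S.influence m) :=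
  ((S.summable_inputWeight m).mul_left _).add ((S.summable_targetWeight m).mul_left _)

theorem sum_pow_le {r : ℝ} (hr0 : 0 ≤ r) (hr : r < 1) (m : ℕ) :
    ∑ s ∈ Finset.range m, r ^ s ≤ 1 / (1 - r) := by
  rw [one_div, ← tsum_geometric_of_lt_one hr0 hr]
  exact (summable_geometric_of_lt_one hr0 hr).sum_le_tsum _ fun s _ => pow_nonneg hr0 s

/-- For a fixed memory lag `s`, the sum over `i` counts each weight at most once; the sum over `s`
is geometric. -/
theorem inputWeight_le (m t : ℕ) : S.inputWeight m t ≤ (∑' k, S.wv k) / (1 - S.r) := by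
  have hw : 0 ≤ ∑' k, S.wv k := tsum_nonneg S.hv.w_nonneg
  unfold inputWeight
  rw [Finset.sum_comm]
  calc _ ≤ ∑ s ∈ Finset.range m, S.r ^ s * ∑' k, S.wv k := by
        refine Finset.sum_le_sum fun s _ => ?_
        rw [← Finset.mul_sum]
        exact mul_le_mul_of_nonneg_left (sum_delayed_le S.hv.w_nonneg S.hv.summable_w m s t)
          (pow_nonneg S.hΦ.r_nonneg s)
    _ ≤ 1 / (1 - S.r) * ∑' k, S.wv k := by
        rw [← Finset.sum_mul]
        exact mul_le_mul_of_nonneg_right (sum_pow_le S.hΦ.r_nonneg S.hΦ.r_lt_one m) hw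
    _ = _ := by ring

theorem targetWeight_le (m t : ℕ) : S.targetWeight m t ≤ ∑' k, S.wy k := by
  simpa [targetWeight] using sum_delayed_le S.hy.w_nonneg S.hy.summable_w m 0 t

theorem tsum_inputWeight_le (m : ℕ) :
    ∑' t, S.inputWeight m t ≤ m * ((∑' k, S.wv k) / (1 - S.r)) := by
  have hw : 0 ≤ ∑' k, S.wv k := tsum_nonneg S.hv.w_nonneg
  unfold inputWeight
  rw [Summable.tsum_finsetSum fun i _ => summable_sum fun s _ => S.summable_inputSummand i s]
  have h1 : ∀ i ∈ Finset.range m, ∑' t, ∑ s ∈ Finset.range m, S.r ^ s * delayed S.wv (i + s) t ≤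
      (∑' k, S.wv k) / (1 - S.r) := by
    intro i _
    rw [Summable.tsum_finsetSum fun s _ => S.summable_inputSummand i s]
    simp only [tsum_mul_left, tsum_delayed]
    rw [← Finset.sum_mul]
    refine (mul_le_mul_of_nonneg_right (sum_pow_le S.hΦ.r_nonneg S.hΦ.r_lt_one m) hw).trans
      (le_of_eq (by ring))
  refine (Finset.sum_le_sum h1).trans (le_of_eq ?_)
  simp

theorem tsum_targetWeight (m : ℕ) : ∑' t, S.targetWeight m t = m * ∑' k, S.wy k := by
  unfold targetWeight
  rw [Summable.tsum_finsetSum fun i _ => summable_delayed S.hy.summable_w i]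
  simp [tsum_delayed]

theorem influence_le (m t : ℕ) : S.influence m t ≤ S.totalInfluence * (1 / (m : ℝ)) := by
  have h1 := mul_le_mul_of_nonneg_left (S.inputWeight_le m t)
    (mul_nonneg (S.scale_nonneg m) S.input_scale_nonneg)
  have h2 := mul_le_mul_of_nonneg_left (S.targetWeight_le m t)
    (mul_nonneg (S.scale_nonneg m) S.hy.L_nonneg)
  refine (add_le_add h1 h2).trans (le_of_eq ?_)
  unfold totalInfluence
  ring

theorem tsum_influence_le {m : ℕ} (hm : 0 < m) : ∑' t, S.influence m t ≤ S.totalInfluence := by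
  have hmp : (0 : ℝ) < m := by exact_mod_cast hm
  have h1 := mul_le_mul_of_nonneg_left (S.tsum_inputWeight_le m)
    (mul_nonneg (S.scale_nonneg m) S.input_scale_nonneg)
  have h2 := mul_le_mul_of_nonneg_left (S.tsum_targetWeight m).le
    (mul_nonneg (S.scale_nonneg m) S.hy.L_nonneg)
  unfold influence
  rw [((S.summable_inputWeight m).mul_left _).tsum_add ((S.summable_targetWeight m).mul_left _),
    tsum_mul_left, tsum_mul_left]
  refine (add_le_add h1 h2).trans (le_of_eq ?_)
  unfold totalInfluence
  field_simp

theorem totalInfluence_nonneg : 0 ≤ S.totalInfluence :=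
  (tsum_nonneg (S.influence_nonneg 1)).trans (S.tsum_influence_le Nat.one_pos)

theorem influence_sq_le (m t : ℕ) :
    S.influence m t ^ 2 ≤ S.totalInfluence * (1 / (m : ℝ)) * S.influence m t := by
  rw [sq]
  exact mul_le_mul_of_nonneg_right (S.influence_le m t) (S.influence_nonneg m t)

theorem summable_influence_sq (m : ℕ) : Summable fun t => S.influence m t ^ 2 :=
  Summable.of_nonneg_of_le (fun _ => sq_nonneg _) (S.influence_sq_le m)
    ((S.summable_influence m).mul_left _)

/-- The sum of squares is at most the largest influence times the total influence. -/
theorem tsum_influence_sq_le {m : ℕ} (hm : 0 < m) :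
    ∑' t, S.influence m t ^ 2 ≤ S.totalInfluence ^ 2 / m := by
  have h1 := (S.summable_influence_sq m).tsum_le_tsum (S.influence_sq_le m)
    ((S.summable_influence m).mul_left _)
  rw [tsum_mul_left] at h1
  have h0 := S.totalInfluence_nonneg
  have h2 := mul_le_mul_of_nonneg_left (S.tsum_influence_le hm)
    (by positivity : 0 ≤ S.totalInfluence * (1 / (m : ℝ)))
  refine (h1.trans h2).trans (le_of_eq ?_)
  ring

theorem diffWeight_influence (m : ℕ) (x x' : ℕ → E) :
    diffWeight (S.influence m) 0 x x' =
      2 * S.M * S.Lℓ * (1 / (m : ℝ)) * (S.Lh * S.a * S.Lv) *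
        (∑ i ∈ Finset.range m, ∑ s ∈ Finset.range m,
          S.r ^ s * diffWeight (delayed S.wv (i + s)) 0 x x') +
      2 * S.M * S.Lℓ * (1 / (m : ℝ)) * S.Ly *
        ∑ i ∈ Finset.range m, diffWeight (delayed S.wy i) 0 x x' := by
  unfold influence
  rw [diffWeight_add (fun t => mul_nonneg (mul_nonneg (S.scale_nonneg m) S.input_scale_nonneg)
      (S.inputWeight_nonneg m t)) ((S.summable_inputWeight m).mul_left _)
    (fun t => mul_nonneg (mul_nonneg (S.scale_nonneg m) S.hy.L_nonneg)
      (S.targetWeight_nonneg m t)) ((S.summable_targetWeight m).mul_left _),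
    diffWeight_mul, diffWeight_mul]
  unfold inputWeight targetWeight
  rw [diffWeight_sum _ (fun i t => Finset.sum_nonneg fun s _ => S.inputSummand_nonneg i s t)
      (fun i => summable_sum fun s _ => S.summable_inputSummand i s),
    diffWeight_sum _ (fun i t => delayed_nonneg S.hy.w_nonneg i t)
      (fun i => summable_delayed S.hy.summable_w i)]
  congr 2
  refine Finset.sum_congr rfl fun i _ => ?_
  rw [diffWeight_sum _ (fun s t => S.inputSummand_nonneg i s t)
    (fun s => S.summable_inputSummand i s)]
  refine Finset.sum_congr rfl fun s _ => ?_
  rw [diffWeight_mul]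

omit [MeasurableSpace E] in
theorem shiftSeq_shiftSeq (i s : ℕ) (x : ℕ → E) : shiftSeq s (shiftSeq i x) = shiftSeq (i + s) x := by
  funext k
  simp [shiftSeq, add_assoc]

omit [MeasurableSpace E] in
theorem diffWeight_nonneg {c : ℕ → ℝ} (hc : ∀ t, 0 ≤ c t) (l : ℕ) (x x' : ℕ → E) :
    0 ≤ diffWeight c l x x' := by
  classical
  exact tsum_nonneg fun t => by split_ifs <;> simp [hc t]

/-- The loss at time `-i` feels the input at time `-i - s` with factor `r ^ s`, and that input feels
each innovation through the delayed weights. The range of `s` is enlarged from `m - i` to `m` so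
that it no longer depends on `i`. -/
theorem abs_empLoss_sub_le (m : ℕ) (j : ι) (x x' : ℕ → E) :
    |S.empLoss m j x - S.empLoss m j x'| ≤ diffWeight (S.influence m) 0 x x' := by
  have h1 : ∀ i ∈ Finset.range m,
      |S.blockLoss j (m - i) (shiftSeq i x) - S.blockLoss j (m - i) (shiftSeq i x')| ≤
      S.Lℓ * (S.Lh * (S.a * ∑ s ∈ Finset.range m,
        S.r ^ s * (2 * S.M * S.Lv * diffWeight (delayed S.wv (i + s)) 0 x x')) +
        2 * S.M * S.Ly * diffWeight (delayed S.wy i) 0 x x') := by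
    intro i _
    refine (S.abs_blockLoss_sub_le j (m - i) _ _).trans
      (mul_le_mul_of_nonneg_left (add_le_add (mul_le_mul_of_nonneg_left
        (mul_le_mul_of_nonneg_left ?_ S.hΦ.a_nonneg) S.hΦ.Lh_nonneg)
        (S.hy.abs_sub_shift_le i x x')) S.Lℓ_nonneg)
    calc _ ≤ ∑ s ∈ Finset.range (m - i),
          S.r ^ s * (2 * S.M * S.Lv * diffWeight (delayed S.wv (i + s)) 0 x x') := by
          refine Finset.sum_le_sum fun s _ =>
            mul_le_mul_of_nonneg_left ?_ (pow_nonneg S.hΦ.r_nonneg s)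
          simp only [inputs, shiftSeq_shiftSeq]
          exact S.hv.abs_sub_shift_le (i + s) x x'
      _ ≤ _ := by
          refine Finset.sum_le_sum_of_subset_of_nonneg (Finset.range_mono (Nat.sub_le m i))
            fun s _ _ => ?_
          have := S.hv.M_nonneg
          have := S.hv.L_nonneg
          have := pow_nonneg S.hΦ.r_nonneg s
          have := diffWeight_nonneg (delayed_nonneg S.hv.w_nonneg (i + s)) 0 x x'
          positivity
  rw [empLoss, empLoss, ← mul_sub, ← Finset.sum_sub_distrib, abs_mul,
    abs_of_nonneg (by positivity : 0 ≤ 1 / (m : ℝ))]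
  refine (mul_le_mul_of_nonneg_left ((Finset.abs_sum_le_sum_abs _ _).trans
    (Finset.sum_le_sum h1)) (by positivity)).trans (le_of_eq ?_)
  rw [S.diffWeight_influence, ← Finset.mul_sum, Finset.sum_add_distrib, ← Finset.mul_sum,
    ← Finset.mul_sum, ← Finset.mul_sum]
  have e : ∀ i s, S.r ^ s * (2 * S.M * S.Lv * diffWeight (delayed S.wv (i + s)) 0 x x') =
      2 * S.M * S.Lv * (S.r ^ s * diffWeight (delayed S.wv (i + s)) 0 x x') := fun i s => by ring
  simp only [e, ← Finset.mul_sum]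
  ring

variable {Ω : Type*} [MeasurableSpace Ω] {μ : Measure Ω} [IsProbabilityMeasure μ]
  {X : ℕ → Ω → E} [Fintype ι] [Nonempty ι]

theorem hasBoundedDiff_iSup_gap (m : ℕ) (R : ι → ℝ) :
    HasBoundedDiff (fun x => ⨆ j, (R j - S.empLoss m j x)) (S.influence m) 0 := by
  have h : ∀ x x', (⨆ j, (R j - S.empLoss m j x)) - (⨆ j, (R j - S.empLoss m j x')) ≤
      diffWeight (S.influence m) 0 x x' := by
    intro x x'
    rw [sub_le_iff_le_add]
    refine ciSup_le fun j => ?_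
    have h1 := (abs_le.1 (S.abs_empLoss_sub_le m j x x')).1
    have h2 := le_iSup_fintype (fun j => R j - S.empLoss m j x') j
    linarith
  intro x x'
  refine abs_le.2 ⟨?_, h x x'⟩
  have h1 := h x' x
  have h2 : diffWeight (S.influence m) 0 x' x = diffWeight (S.influence m) 0 x x' := by
    classical
    refine tsum_congr fun t => ?_
    by_cases e : x t = x' t
    · simp [e]
    · have e' : ¬ x' t = x t := fun h => e h.symm
      simp [e, e']
  linarith

/-- A one-sided tail bound for the supremum of the generalisation gap. -/
theorem measure_gap_gt_le (hX : ∀ t, Measurable (X t)) (hind : iIndepFun X μ)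
    {m : ℕ} (hm : 0 < m) {R : ι → ℝ} {B : ℝ}
    (hB : ∫ ω, ⨆ j, (R j - S.empLoss m j fun t => X t ω) ∂μ ≤ B) {δ : ℝ} (hδ : 0 < δ)
    (hδ1 : δ < 1) :
    μ.real {ω | ∃ j, B + S.totalInfluence * Real.sqrt (Real.log (1 / δ) / (2 * m)) <
      R j - S.empLoss m j fun t => X t ω} ≤ δ := by
  have key := measure_gt_le_of_hasBoundedDiff hX hind
    (F := fun x => ⨆ j, (R j - S.empLoss m j x))
    (Measurable.iSup fun j => measurable_const.sub (S.measurable_empLoss m j))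
    (S.hasBoundedDiff_iSup_gap m R) (S.influence_nonneg m) (S.summable_influence m)
    (S.summable_influence_sq m) (S.tsum_influence_sq_le hm) hδ hδ1
  have e : Real.sqrt (S.totalInfluence ^ 2 / m * Real.log (1 / δ) / 2) =
      S.totalInfluence * Real.sqrt (Real.log (1 / δ) / (2 * m)) := by
    rw [← Real.sqrt_sq S.totalInfluence_nonneg, ← Real.sqrt_mul (sq_nonneg _),
      Real.sqrt_sq S.totalInfluence_nonneg]
    congr 1
    ring
  rw [e] at key
  refine (measureReal_mono fun ω hω => ?_).trans key
  simp only [Set.mem_ofPred_eq] at hω ⊢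
  obtain ⟨j, hj⟩ := hω
  have := le_iSup_fintype (fun j => R j - S.empLoss m j fun t => X t ω) j
  linarith

end Setup
-- Choice of the window length and the two-sided bound
namespace Setup

variable {E ι Q : Type*} [MeasurableSpace E] [Fintype Q]

/-- The same setup with the opposite loss. -/
def negLoss (S : Setup E ι Q) : Setup E ι Q :=
  { S with
    loss := fun x y => -S.loss x y
    loss_lip := fun x x' y y' => by
      rw [neg_sub_neg, abs_sub_comm]
      exact S.loss_lip x x' y y' }

theorem negLoss_blockLoss (S : Setup E ι Q) (j : ι) (k : ℕ) (x : ℕ → E) :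
    S.negLoss.blockLoss j k x = -S.blockLoss j k x := rfl

theorem negLoss_empLoss (S : Setup E ι Q) (m : ℕ) (j : ι) (x : ℕ → E) :
    S.negLoss.empLoss m j x = -S.empLoss m j x := by
  simp only [empLoss, negLoss_blockLoss, Finset.sum_neg_distrib, mul_neg]

variable {Ω : Type*} [MeasurableSpace Ω] {μ : Measure Ω} [IsProbabilityMeasure μ]
  {X : ℕ → Ω → E} [Fintype ι] [Nonempty ι]

/-- The bound on the expected supremum of the generalisation gap. -/
def meanBound (S : Setup E ι Q) (mv my ζ : ℝ) (m : ℕ) : ℝ :=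
  S.Lℓ * (S.Lh * ((1 - S.r ^ m) * S.r / (1 - S.r))) * (1 / (m : ℝ)) +
    2 * S.Lℓ * (S.Lh + S.Ly * my / (1 - S.Dy)) / ζ * (1 / (m : ℝ)) +
    2 * S.Lℓ * S.Lh * S.a * (S.Lv * mv / (1 - S.Dv)) / (ζ * Real.log ζ⁻¹) * (Real.log m / m) +
    2 * S.Lℓ * (∑ q, S.C q) / Real.sqrt (Real.log ζ⁻¹) * Real.sqrt (Real.log m / m)

/-- The floor of `log m / log ζ⁻¹`: one more step would give `ζ ^ (τ + 1) ≤ 1 / m`. Rounding down is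
what puts `1 / ζ` into the constants. -/
theorem exists_window_length {ζ : ℝ} (hζ0 : 0 < ζ) (hζ1 : ζ < 1) {m : ℕ} (hm : 0 < m) :
    ∃ τ : ℕ, (τ : ℝ) ≤ Real.log m / Real.log ζ⁻¹ ∧ ζ ^ τ ≤ 1 / (ζ * m) := by
  have hmp : (0 : ℝ) < m := by exact_mod_cast hm
  have hlogm : 0 ≤ Real.log m := Real.log_natCast_nonneg m
  have hl : 0 < Real.log ζ⁻¹ := Real.log_pos ((one_lt_inv₀ hζ0).2 hζ1)
  refine ⟨⌊Real.log m / Real.log ζ⁻¹⌋₊, Nat.floor_le (by positivity), ?_⟩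
  set τ := ⌊Real.log m / Real.log ζ⁻¹⌋₊
  have h1 : Real.log m ≤ (τ + 1 : ℕ) * Real.log ζ⁻¹ := by
    rw [← div_le_iff₀ hl]
    exact_mod_cast (Nat.lt_floor_add_one (Real.log m / Real.log ζ⁻¹)).le
  rw [← Real.log_pow, Real.log_le_log_iff hmp (by positivity), inv_pow,
    le_inv_comm₀ hmp (by positivity)] at h1
  rw [le_div_iff₀ (by positivity)]
  rw [pow_succ, ← one_div, le_div_iff₀ hmp] at h1
  linarith

theorem integral_iSup_gap_le_meanBound (S : Setup E ι Q) (hX : ∀ t, Measurable (X t))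
    (hind : iIndepFun X μ) (hid : ∀ t, μ.map (X t) = μ.map (X 0)) {e₀ : E} {mv my ζ : ℝ}
    (hmv : ∀ t, ∫ ω, S.dv (X t ω) e₀ ∂μ = mv) (hmy : ∀ t, ∫ ω, S.dy (X t ω) e₀ ∂μ = my)
    (hrζ : S.r ≤ ζ) (hvζ : S.Dv ≤ ζ) (hyζ : S.Dy ≤ ζ) (hζ0 : 0 < ζ) (hζ1 : ζ < 1)
    {m : ℕ} (hm : 0 < m) {R : ι → ℝ}
    (hR : ∀ j k, |R j - ∫ ω, S.blockLoss j k (fun t => X t ω) ∂μ| ≤ S.Lℓ * (S.Lh * S.r ^ k)) :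
    ∫ ω, ⨆ j, (R j - S.empLoss m j fun t => X t ω) ∂μ ≤ S.meanBound mv my ζ m := by
  obtain ⟨τ, hτ, hζτ⟩ := exists_window_length hζ0 hζ1 hm
  have hmp : (0 : ℝ) < m := by exact_mod_cast hm
  have hl : 0 < Real.log ζ⁻¹ := Real.log_pos ((one_lt_inv₀ hζ0).2 hζ1)
  have h1 := S.integral_iSup_gap_le hX hind hid (e₀ := e₀) hm (fun j => hR j τ)
    fun i => S.integral_padErr_le hX hmv hmy hrζ hvζ hyζ τ i
  have hmv0 : 0 ≤ mv := by rw [← hmv 0]; exact integral_nonneg fun ω => S.hv.d_nonneg _ _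
  have hmy0 : 0 ≤ my := by rw [← hmy 0]; exact integral_nonneg fun ω => S.hy.d_nonneg _ _
  have hcv : 0 ≤ S.Lv * mv / (1 - S.Dv) :=
    div_nonneg (mul_nonneg S.hv.L_nonneg hmv0) (by linarith [S.hv.D_lt_one])
  have hcy : 0 ≤ S.Ly * my / (1 - S.Dy) :=
    div_nonneg (mul_nonneg S.hy.L_nonneg hmy0) (by linarith [S.hy.D_lt_one])
  set cv := S.Lv * mv / (1 - S.Dv)
  set cy := S.Ly * my / (1 - S.Dy)
  have hLh := S.hΦ.Lh_nonneg
  have ha := S.hΦ.a_nonneg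
  have hLℓ := S.Lℓ_nonneg
  have hC : 0 ≤ ∑ q, S.C q := Finset.sum_nonneg fun q _ =>
    (abs_nonneg _).trans (S.hΦ.coef_le (Classical.arbitrary ι) q)
  have h2 : 2 * (S.Lℓ * (S.Lh * S.r ^ τ + (S.Lh * (S.a * (τ * cv)) + cy) * ζ ^ τ)) ≤
      2 * S.Lℓ * (S.Lh + cy) / ζ * (1 / (m : ℝ)) +
      2 * S.Lℓ * S.Lh * S.a * cv / (ζ * Real.log ζ⁻¹) * (Real.log m / m) := by
    have h3 : S.r ^ τ ≤ ζ ^ τ := pow_le_pow_left₀ S.hΦ.r_nonneg hrζ τ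
    calc _ ≤ 2 * (S.Lℓ * (S.Lh * ζ ^ τ + (S.Lh * (S.a * (τ * cv)) + cy) * ζ ^ τ)) := by gcongr
      _ = 2 * S.Lℓ * (S.Lh + cy) * ζ ^ τ + 2 * S.Lℓ * S.Lh * S.a * cv * (τ * ζ ^ τ) := by ring
      _ ≤ 2 * S.Lℓ * (S.Lh + cy) * (1 / (ζ * m)) +
          2 * S.Lℓ * S.Lh * S.a * cv * (Real.log m / Real.log ζ⁻¹ * (1 / (ζ * m))) := by gcongr
      _ = _ := by field_simp
  have h4 : Real.sqrt (τ / m) ≤ Real.sqrt (Real.log m / m) / Real.sqrt (Real.log ζ⁻¹) := by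
    rw [← Real.sqrt_div' _ hl.le]
    refine Real.sqrt_le_sqrt ?_
    rw [div_right_comm]
    gcongr
  have h5 := mul_le_mul_of_nonneg_left h4 (by positivity : 0 ≤ 2 * S.Lℓ * (∑ q, S.C q))
  have h6 : 2 * S.Lℓ * (∑ q, S.C q) * (Real.sqrt (Real.log m / m) / Real.sqrt (Real.log ζ⁻¹)) =
      2 * S.Lℓ * (∑ q, S.C q) / Real.sqrt (Real.log ζ⁻¹) * Real.sqrt (Real.log m / m) := by ring
  rw [h6] at h5
  rw [meanBound]
  linarith

/-- The two-sided tail bound for the supremum of the generalisation gap over a finite family. -/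
theorem measure_abs_gap_gt_le (S : Setup E ι Q) (hX : ∀ t, Measurable (X t))
    (hind : iIndepFun X μ) (hid : ∀ t, μ.map (X t) = μ.map (X 0)) {e₀ : E} {mv my ζ : ℝ}
    (hmv : ∀ t, ∫ ω, S.dv (X t ω) e₀ ∂μ = mv) (hmy : ∀ t, ∫ ω, S.dy (X t ω) e₀ ∂μ = my)
    (hrζ : S.r ≤ ζ) (hvζ : S.Dv ≤ ζ) (hyζ : S.Dy ≤ ζ) (hζ0 : 0 < ζ) (hζ1 : ζ < 1)
    {m : ℕ} (hm : 0 < m) {R : ι → ℝ}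
    (hR : ∀ j k, |R j - ∫ ω, S.blockLoss j k (fun t => X t ω) ∂μ| ≤ S.Lℓ * (S.Lh * S.r ^ k))
    {δ : ℝ} (hδ : 0 < δ) (hδ1 : δ < 1) :
    μ.real {ω | ∃ j, S.meanBound mv my ζ m +
      S.totalInfluence * Real.sqrt (Real.log (1 / δ) / (2 * m)) <
        |R j - S.empLoss m j fun t => X t ω|} ≤ 2 * δ := by
  have h1 := S.measure_gap_gt_le hX hind hm
    (S.integral_iSup_gap_le_meanBound hX hind hid hmv hmy hrζ hvζ hyζ hζ0 hζ1 hm hR) hδ hδ1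
  have hR' : ∀ j k, |-R j - ∫ ω, S.negLoss.blockLoss j k (fun t => X t ω) ∂μ| ≤
      S.negLoss.Lℓ * (S.negLoss.Lh * S.negLoss.r ^ k) := fun j k => by
    simp only [negLoss_blockLoss, integral_neg]
    rw [neg_sub_neg, abs_sub_comm]
    exact hR j k
  -- Negating the loss changes neither the Lipschitz data nor the readouts, so both one-sided bounds
  -- have the same right-hand side.
  have h2 := S.negLoss.measure_gap_gt_le hX hind hm (S.negLoss.integral_iSup_gap_le_meanBound
    hX hind hid hmv hmy hrζ hvζ hyζ hζ0 hζ1 hm hR') hδ hδ1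
  refine (measureReal_mono (fun ω hω => ?_)).trans
    ((measureReal_union_le _ _).trans ((add_le_add h1 h2).trans (le_of_eq (by ring))))
  simp only [Set.mem_union, Set.mem_ofPred_eq] at hω ⊢
  obtain ⟨j, hj⟩ := hω
  rcases lt_abs.1 hj with h | h
  · exact Or.inl ⟨j, h⟩
  · refine Or.inr ⟨j, ?_⟩
    rw [negLoss_empLoss]
    have e : -R j - -S.empLoss m j (fun t => X t ω) = -(R j - S.empLoss m j fun t => X t ω) := by
      ring
    rw [e]
    exact h

end Setup
/-! ### Instantiation: Bernoulli shifts and reset-rate reservoirs -/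

section Shifts

variable {q : ℕ} {S : Shift q} {M : ℝ}

/-- Vectors of norm larger than `M` are replaced by zero. -/
def clip (M : ℝ) (x : EuclideanSpace ℝ (Fin q)) : EuclideanSpace ℝ (Fin q) :=
  if ‖x‖ ≤ M then x else 0

theorem norm_clip_le (hM : 0 ≤ M) (x : EuclideanSpace ℝ (Fin q)) : ‖clip M x‖ ≤ M := by
  unfold clip
  split_ifs with h
  · exact h
  · simpa using hM

theorem clip_of_le {x : EuclideanSpace ℝ (Fin q)} (h : ‖x‖ ≤ M) : clip M x = x := if_pos h

theorem clip_zero : clip M (0 : EuclideanSpace ℝ (Fin q)) = 0 := by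
  unfold clip
  split_ifs <;> rfl

theorem measurable_clip : Measurable (clip M : EuclideanSpace ℝ (Fin q) → _) :=
  Measurable.ite (measurableSet_le measurable_norm measurable_const) measurable_id measurable_const

namespace Shift.Valid

theorem w_succ_le (h : S.Valid M) (k : ℕ) : S.w (k + 1) ≤ S.D * S.w k := by
  have hb : BddAbove (Set.range fun k => S.w (k + 1) / S.w k) := by
    refine ⟨1, ?_⟩
    rintro _ ⟨k, rfl⟩
    exact (div_le_one (h.w_pos k)).2 (h.w_anti (Nat.le_succ k))
  rw [← div_le_iff₀ (h.w_pos k)]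
  exact le_ciSup hb k

/-- This keeps `ζ` positive even if `r = 0`, so that `log ζ⁻¹` is a genuine positive logarithm. -/
theorem D_pos (h : S.Valid M) : 0 < S.D := by
  have h1 := h.w_succ_le 0
  have h2 := h.w_pos 0
  have h3 := h.w_pos (0 + 1)
  by_contra hD
  nlinarith

theorem w_le_pow (h : S.Valid M) (k : ℕ) : S.w k ≤ S.D ^ k := by
  induction k with
  | zero => simpa using h.w_le_one 0
  | succ k ih =>
    rw [pow_succ']
    exact (h.w_succ_le k).trans (mul_le_mul_of_nonneg_left ih h.D_pos.le)

/-- After clipping, the Lipschitz condition holds for all sequences and the distance is bounded by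
`2 * M`. The 1-Lipschitz `φ` leaves room for clamping the inputs. -/
theorem isCausalShift (h : S.Valid M) (hM : 0 ≤ M) {E : Type*} [MeasurableSpace E]
    {p : E → EuclideanSpace ℝ (Fin q)} (hp : Measurable p) {φ : ℝ → ℝ} (hφ : Measurable φ)
    (hφ1 : ∀ a b, |φ a - φ b| ≤ |a - b|) :
    IsCausalShift (fun x : ℕ → E => φ (S.G fun k => clip M (p (x k))))
      (fun e e' => ‖clip M (p e) - clip M (p e')‖) S.w S.L S.D M where
  measurable := hφ.comp (h.measurable.comp (measurable_pi_lambda _ fun k =>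
    measurable_clip.comp (hp.comp (measurable_pi_apply k))))
  L_nonneg := h.L_nonneg
  w_nonneg k := (h.w_pos k).le
  w_le := h.w_le_pow
  D_nonneg := h.D_pos.le
  D_lt_one := h.D_lt_one
  M_nonneg := hM
  d_nonneg _ _ := norm_nonneg _
  d_le e e' := (norm_sub_le _ _).trans (by linarith [norm_clip_le hM (p e), norm_clip_le hM (p e')])
  d_self e := by simp
  d_measurable e' := ((measurable_clip.comp hp).sub_const _).norm
  lipschitz x x' := (hφ1 _ _).trans (h.lipschitz _ _ (fun _ => norm_clip_le hM _)
    fun _ => norm_clip_le hM _)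

end Shift.Valid

theorem abs_clamp_sub_le (b x y : ℝ) : |max 0 (min b x) - max 0 (min b y)| ≤ |x - y| :=
  (abs_max_sub_max_le_max 0 _ 0 _).trans (max_le (by simp) ((abs_min_sub_min_le_max b x b y).trans
    (max_le (by simp) le_rfl)))

end Shifts

/-! ### Reservoir readouts as linear functionals of bounded features -/

section Reservoir

variable {n R : ℕ} {αmin b r Cmax : ℝ}

theorem continuous_zExp (i : Fin n) : Continuous fun ρ : QMat n => zExp ρ i :=
  Complex.continuous_re.comp ((continuous_const.matrix_mul continuous_id).matrix_trace)

theorem measurable_val_run (θ : RRRParam n) (c : Coef n R) (k : ℕ) :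
    Measurable fun v => c.val (zExp (θ.run (maxMixed n) k v)) := by
  refine Continuous.measurable ?_
  have h : ∀ i, Continuous fun v => zExp (θ.run (maxMixed n) k v) i := fun i =>
    (continuous_zExp i).comp (θ.continuous_run (maxMixed n) k)
  unfold Coef.val monoVal
  exact continuous_const.add (continuous_finsetSum _ fun a _ =>
    continuous_const.mul (continuous_finsetProd _ fun i _ => (h i).pow _))

open Classical in
/-- The coefficients of a readout of reservoir `θ` with respect to the constant feature and the
monomial features of all reservoirs. -/
def featCoef {Θ : Finset (RRRParam n)} (θ : Θ) (c : Coef n R) : Option (Θ × expSet n R) → ℝ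
  | none => c.1
  | some p => if p.1 = θ then c.2 p.2 else 0

/-- The bounds on the coefficients. -/
def featBound {Θ : Finset (RRRParam n)} (Cmax : ℝ) : Option (Θ × expSet n R) → ℝ
  | none => Cmax
  | some _ => 1

/-- The constant feature and the monomials in the Pauli expectations. -/
def featVal {Θ : Finset (RRRParam n)} (k : ℕ) (v : ℕ → ℝ) : Option (Θ × expSet n R) → ℝ
  | none => 1
  | some p => monoVal (zExp (p.1.1.run (maxMixed n) k v)) p.2.1

theorem sum_featBound {Θ : Finset (RRRParam n)} (Cmax : ℝ) :
    ∑ q, featBound (R := R) (Θ := Θ) Cmax q = Cmax + Θ.card * (expSet n R).card := by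
  rw [Fintype.sum_option]
  simp [featBound]

/-- All reservoirs share one list of features, and a readout of `θ` has zero coefficients on the
monomials of the others. Suprema over `Θ` are thus absorbed by linearity, at the price of the factor
`Θ.card` in the sum of the coefficient bounds. -/
theorem isReadoutFamily_run {ι : Type*} {Θ : Finset (RRRParam n)}
    (hΘ : ∀ θ ∈ Θ, θ.Contracts αmin b r) (hα : αmin ≤ 1) (hr0 : 0 ≤ r) (hr1 : r < 1) (θ : ι → Θ)
    (c : ι → Coef n R) (hc : ∀ j, (c j).Bounded Cmax) :
    IsReadoutFamily (fun j k v => (c j).val (zExp ((θ j).1.run (maxMixed n) k v)))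
      (fun j => featCoef (θ j) (c j)) (featBound Cmax) featVal (lipPoly n R) (2 * (1 - αmin)) b r where
  measurable j k := measurable_val_run _ _ _
  Lh_nonneg := lipPoly_nonneg n R
  a_nonneg := by linarith
  r_nonneg := hr0
  r_lt_one := hr1
  coef_le j q := by
    rcases q with _ | p
    · exact (hc j).1
    · simp only [featCoef, featBound]
      split_ifs
      · exact (hc j).2 _
      · simp
  feat_le k v q hv := by
    rcases q with _ | p
    · simp [featVal]
    · exact abs_monoVal_le
        (((hΘ _ p.1.2).run_isDensity isDensity_maxMixed k hv).abs_zExp_le_one) _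
  eq_sum j k v hv := by
    classical
    rw [Fintype.sum_option, Fintype.sum_prod_type, Finset.sum_eq_single (θ j)]
    · simp [featCoef, featVal, Coef.val]
    · intro θ' _ hne
      simp [featCoef, hne]
    · simp
  lipschitz j k v v' hv hv' := by
    have h := hΘ _ (θ j).2
    refine ((hc j).abs_val_sub_le (h.run_isDensity isDensity_maxMixed k hv)
      (h.run_isDensity isDensity_maxMixed k hv')).trans
        (mul_le_mul_of_nonneg_left ?_ (lipPoly_nonneg n R))
    have h1 := h.run_sub_le isDensity_maxMixed isDensity_maxMixed k hv hv'
    have h2 : hsNorm (maxMixed n - maxMixed n) = 0 := by simp [hsNorm]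
    rwa [h2, mul_zero, zero_add] at h1
  forget j k l v v' hv hv' := by
    have h := hΘ _ (θ j).2
    exact ((hc j).abs_val_sub_le (h.run_isDensity isDensity_maxMixed (k + l) hv)
      (h.run_isDensity isDensity_maxMixed k hv')).trans
        (mul_le_mul_of_nonneg_left (h.run_sub_run_le hv hv' k l) (lipPoly_nonneg n R))

end Reservoir
/-! ### Countable families of readouts -/

namespace Setup

variable {E ι Q : Type*} [MeasurableSpace E] [Fintype Q]

/-- A reindexed family of readouts. -/
def reindex (S : Setup E ι Q) {κ : Type*} (f : κ → ι) : Setup E κ Q :=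
  { S with
    Φ := fun j => S.Φ (f j)
    c := fun j => S.c (f j)
    hΦ :=
      { measurable := fun j => S.hΦ.measurable (f j)
        Lh_nonneg := S.hΦ.Lh_nonneg
        a_nonneg := S.hΦ.a_nonneg
        r_nonneg := S.hΦ.r_nonneg
        r_lt_one := S.hΦ.r_lt_one
        coef_le := fun j => S.hΦ.coef_le (f j)
        feat_le := S.hΦ.feat_le
        eq_sum := fun j => S.hΦ.eq_sum (f j)
        lipschitz := fun j => S.hΦ.lipschitz (f j)
        forget := fun j => S.hΦ.forget (f j) } }

variable {Ω : Type*} [MeasurableSpace Ω] {μ : Measure Ω} [IsProbabilityMeasure μ]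
  {X : ℕ → Ω → E} [Countable ι] [Nonempty ι]

/-- The finite bound does not involve the number of readouts, so it persists along an increasing
union of finite subfamilies. -/
theorem measure_abs_gap_gt_le_of_countable (S : Setup E ι Q) (hX : ∀ t, Measurable (X t))
    (hind : iIndepFun X μ) (hid : ∀ t, μ.map (X t) = μ.map (X 0)) {e₀ : E} {mv my ζ : ℝ}
    (hmv : ∀ t, ∫ ω, S.dv (X t ω) e₀ ∂μ = mv) (hmy : ∀ t, ∫ ω, S.dy (X t ω) e₀ ∂μ = my)
    (hrζ : S.r ≤ ζ) (hvζ : S.Dv ≤ ζ) (hyζ : S.Dy ≤ ζ) (hζ0 : 0 < ζ) (hζ1 : ζ < 1)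
    {m : ℕ} (hm : 0 < m) {R : ι → ℝ}
    (hR : ∀ j k, |R j - ∫ ω, S.blockLoss j k (fun t => X t ω) ∂μ| ≤ S.Lℓ * (S.Lh * S.r ^ k))
    {δ : ℝ} (hδ : 0 < δ) (hδ1 : δ < 1) :
    μ {ω | ∃ j, S.meanBound mv my ζ m +
      S.totalInfluence * Real.sqrt (Real.log (1 / δ) / (2 * m)) <
        |R j - S.empLoss m j fun t => X t ω|} ≤ ENNReal.ofReal (2 * δ) := by
  obtain ⟨e, he⟩ := exists_surjective_nat ι
  set B := S.meanBound mv my ζ m + S.totalInfluence * Real.sqrt (Real.log (1 / δ) / (2 * m))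
  let A : ℕ → Set Ω := fun K =>
    {ω | ∃ j : Fin (K + 1), B < |R (e j) - S.empLoss m (e j) fun t => X t ω|}
  have hA : ∀ K, μ (A K) ≤ ENNReal.ofReal (2 * δ) := fun K => by
    have h := (S.reindex fun j : Fin (K + 1) => e j).measure_abs_gap_gt_le hX hind hid hmv hmy
      hrζ hvζ hyζ hζ0 hζ1 hm (R := fun j => R (e j)) (fun j k => hR (e j) k) hδ hδ1
    rw [ENNReal.le_ofReal_iff_toReal_le (measure_ne_top _ _) (by positivity)]
    exact h
  have hmono : Monotone A := by
    intro K K' hK ω hω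
    simp only [A, Set.mem_ofPred_eq] at hω ⊢
    obtain ⟨j, hj⟩ := hω
    exact ⟨⟨j, by omega⟩, hj⟩
  refine (measure_mono (t := ⋃ K, A K) fun ω hω => ?_).trans ?_
  · simp only [Set.mem_iUnion, A, Set.mem_ofPred_eq] at hω ⊢
    obtain ⟨j, hj⟩ := hω
    obtain ⟨K, rfl⟩ := he j
    exact ⟨K, ⟨K, by omega⟩, hj⟩
  · rw [hmono.measure_iUnion]
    exact iSup_le hA

end Setup

/-! ### Comparison with the risks of the reservoir class -/

section Risk

variable {Ω : Type*} [MeasurableSpace Ω] {μ : Measure Ω} [IsProbabilityMeasure μ]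

/-- Since `RRRParam.state` is defined by choice, measurability of the loss at the true state is
obtained from its being an almost sure limit of losses of finite runs. -/
theorem integrable_and_abs_integral_sub_le {f : ℕ → Ω → ℝ} {F : Ω → ℝ} {K D r : ℝ}
    (hf : ∀ k, Measurable (f k)) (hK : ∀ k ω, |f k ω| ≤ K) (hr0 : 0 ≤ r) (hr1 : r < 1)
    (hF : ∀ᵐ ω ∂μ, ∀ k, |F ω - f k ω| ≤ D * r ^ k) :
    Integrable F μ ∧ ∀ k, |∫ ω, F ω ∂μ - ∫ ω, f k ω ∂μ| ≤ D * r ^ k := by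
  have hlim : ∀ᵐ ω ∂μ, Filter.Tendsto (fun k => f k ω) Filter.atTop (nhds (F ω)) := by
    filter_upwards [hF] with ω hω
    have h0 : Filter.Tendsto (fun k => D * r ^ k) Filter.atTop (nhds 0) := by
      simpa using (tendsto_pow_atTop_nhds_zero_of_lt_one hr0 hr1).const_mul D
    rw [tendsto_iff_dist_tendsto_zero]
    refine squeeze_zero (fun _ => dist_nonneg) (fun k => ?_) h0
    rw [dist_comm, Real.dist_eq]
    exact hω k
  have hm : AEStronglyMeasurable F μ :=
    aestronglyMeasurable_of_tendsto_ae _ (fun k => (hf k).aestronglyMeasurable) hlim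
  have hi : Integrable F μ := by
    refine Integrable.mono' (integrable_const (K + D)) hm ?_
    filter_upwards [hF] with ω hω
    have h1 := hω 0
    have h2 := hK 0 ω
    have h3 : F ω = (F ω - f 0 ω) + f 0 ω := by ring
    rw [pow_zero, mul_one] at h1
    rw [Real.norm_eq_abs, h3]
    exact (abs_add_le _ _).trans (by linarith)
  refine ⟨hi, fun k => ?_⟩
  rw [← integral_sub hi (integrable_of_abs_le (hf k) (hK k)), ← Real.norm_eq_abs]
  refine (norm_integral_le_of_norm_le_const (C := D * r ^ k) ?_).trans (by simp)
  filter_upwards [hF] with ω hω using hω k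

variable {n R : ℕ} {θ : RRRParam n} {αmin b r Cmax : ℝ}

theorem Coef.Bounded.abs_val_state_sub_le {c : Coef n R} (hc : c.Bounded Cmax)
    (h : θ.Contracts αmin b r) {v v' : ℕ → ℝ} (hv : ∀ t, v t ∈ Set.Icc (0 : ℝ) b)
    (hv' : ∀ t, v' t ∈ Set.Icc (0 : ℝ) b) {k : ℕ} (hk : ∀ s < k, v s = v' s) :
    |c.val (zExp (θ.state v 0)) - c.val (zExp (θ.run (maxMixed n) k v'))| ≤
      lipPoly n R * r ^ k := by
  refine (hc.abs_val_sub_le (h.isTrajectory_state hv 0).1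
    (h.run_isDensity isDensity_maxMixed k hv')).trans
      (mul_le_mul_of_nonneg_left ?_ (lipPoly_nonneg n R))
  refine (h.state_sub_run_le hv hv' k).trans (le_of_eq ?_)
  rw [Finset.sum_eq_zero, mul_zero, add_zero]
  intro s hs
  rw [hk s (Finset.mem_range.1 hs)]
  simp

end Risk

/-! ### Reservoirs driven by Bernoulli shifts -/

section Pair

variable {qv qy n R : ℕ} {Sv : Shift qv} {Sy : Shift qy} {M b αmin r Cmax Lℓ : ℝ}
  {loss : ℝ → ℝ → ℝ} {Θ : Finset (RRRParam n)} {ι : Type*}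

/-- The setup of a family of reservoirs with polynomial readouts, driven by Bernoulli shifts whose
innovations are clipped to norm at most `M` and whose inputs are clamped to `[0, b]`. -/
def rrrSetup (hSv : Sv.Valid M) (hSy : Sy.Valid M) (hM : 0 ≤ M) (hb : 0 ≤ b)
    (hloss : ∀ x x' y y' : ℝ, |loss x y - loss x' y'| ≤ Lℓ * (|x - x'| + |y - y'|))
    (hΘ : ∀ θ ∈ Θ, θ.Contracts αmin b r) (hα : αmin ≤ 1) (hr0 : 0 ≤ r) (hr1 : r < 1)
    (θ : ι → Θ) (c : ι → Coef n R) (hc : ∀ j, (c j).Bounded Cmax) :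
    Setup (EuclideanSpace ℝ (Fin qv) × EuclideanSpace ℝ (Fin qy)) ι
      (Option (Θ × expSet n R)) where
  gv x := max 0 (min b (Sv.G fun k => clip M (x k).1))
  gy x := id (Sy.G fun k => clip M (x k).2)
  dv e e' := ‖clip M e.1 - clip M e'.1‖
  dy e e' := ‖clip M e.2 - clip M e'.2‖
  wv := Sv.w
  wy := Sy.w
  Lv := Sv.L
  Ly := Sy.L
  Dv := Sv.D
  Dy := Sy.D
  M := M
  Lℓ := Lℓ
  Lh := lipPoly n R
  a := 2 * (1 - αmin)
  b := b
  r := r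
  loss := loss
  Φ := fun j k v => (c j).val (zExp ((θ j).1.run (maxMixed n) k v))
  c := fun j => featCoef (θ j) (c j)
  C := featBound Cmax
  feat := featVal
  hv := hSv.isCausalShift hM measurable_fst (φ := fun x => max 0 (min b x))
    (measurable_const.max (measurable_const.min measurable_id)) (abs_clamp_sub_le b)
  hy := hSy.isCausalShift hM measurable_snd measurable_id fun _ _ => le_rfl
  gv_mem _ := ⟨le_max_left _ _, max_le hb (min_le_left _ _)⟩
  loss_lip := hloss
  hΦ := isReadoutFamily_run hΘ hα hr0 hr1 θ c hc

variable {Ω : Type*} {ξv : ℕ → Ω → EuclideanSpace ℝ (Fin qv)}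
  {ξy : ℕ → Ω → EuclideanSpace ℝ (Fin qy)}

/-- Outcomes for which the bounds on the innovations and on the inputs hold at all times. -/
def IsTypical (ξv : ℕ → Ω → EuclideanSpace ℝ (Fin qv)) (ξy : ℕ → Ω → EuclideanSpace ℝ (Fin qy))
    (Sv : Shift qv) (M b : ℝ) (ω : Ω) : Prop :=
  (∀ t, ‖ξv t ω‖ ≤ M) ∧ (∀ t, ‖ξy t ω‖ ≤ M) ∧ ∀ t, Sv.process ξv t ω ∈ Set.Icc (0 : ℝ) b

section Typical

variable (hSv : Sv.Valid M) (hSy : Sy.Valid M) (hM : 0 ≤ M) (hb : 0 ≤ b)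
  (hloss : ∀ x x' y y' : ℝ, |loss x y - loss x' y'| ≤ Lℓ * (|x - x'| + |y - y'|))
  (hΘ : ∀ θ ∈ Θ, θ.Contracts αmin b r) (hα : αmin ≤ 1) (hr0 : 0 ≤ r) (hr1 : r < 1)
  (θ : ι → Θ) (c : ι → Coef n R) (hc : ∀ j, (c j).Bounded Cmax)

theorem rrrSetup_inputs {ω : Ω} (hω : IsTypical ξv ξy Sv M b ω) (i : ℕ) :
    (rrrSetup hSv hSy hM hb hloss hΘ hα hr0 hr1 θ c hc).inputs
      (shiftSeq i fun t => (ξv t ω, ξy t ω)) = fun k => Sv.process ξv (i + k) ω := by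
  funext k
  have h : (rrrSetup hSv hSy hM hb hloss hΘ hα hr0 hr1 θ c hc).inputs
      (shiftSeq i fun t => (ξv t ω, ξy t ω)) k =
      max 0 (min b (Sv.G fun l => clip M (ξv (i + (k + l)) ω))) := rfl
  rw [h]
  simp only [clip_of_le (hω.1 _), ← add_assoc]
  have h1 := hω.2.2 (i + k)
  rw [Shift.process] at h1 ⊢
  rw [min_eq_right h1.2, max_eq_right h1.1]

theorem rrrSetup_blockLoss {ω : Ω} (hω : IsTypical ξv ξy Sv M b ω) (i : ℕ) (j : ι) (k : ℕ) :
    (rrrSetup hSv hSy hM hb hloss hΘ hα hr0 hr1 θ c hc).blockLoss j k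
      (shiftSeq i fun t => (ξv t ω, ξy t ω)) =
    loss ((c j).val (zExp ((θ j).1.run (maxMixed n) k fun l => Sv.process ξv (i + l) ω)))
      (Sy.process ξy i ω) := by
  have h1 := rrrSetup_inputs hSv hSy hM hb hloss hΘ hα hr0 hr1 θ c hc hω i
  have h2 : (rrrSetup hSv hSy hM hb hloss hΘ hα hr0 hr1 θ c hc).gy
      (shiftSeq i fun t => (ξv t ω, ξy t ω)) = Sy.process ξy i ω := by
    have h : (rrrSetup hSv hSy hM hb hloss hΘ hα hr0 hr1 θ c hc).gy
      (shiftSeq i fun t => (ξv t ω, ξy t ω)) = Sy.G fun l => clip M (ξy (i + l) ω) := rfl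
    rw [h]
    simp only [clip_of_le (hω.2.1 _)]
    rfl
  rw [Setup.blockLoss, h1, h2]
  rfl

/-- The state on the zero-padded input and the run of length `m - i` see the same last `m - i`
inputs, and the padding value 0 lies in `[0, b]`. This is one half of `constC0`; the other half
comes from the mean bound. -/
theorem abs_empRisk_sub_empLoss_le {ω : Ω} (hω : IsTypical ξv ξy Sv M b ω) (j : ι) (m : ℕ) :
    |empRisk loss (Sv.process ξv) (Sy.process ξy) m
        (fun v => (c j).val (zExp ((θ j).1.state v 0))) ω -
      (rrrSetup hSv hSy hM hb hloss hΘ hα hr0 hr1 θ c hc).empLoss m j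
        (fun t => (ξv t ω, ξy t ω))| ≤
      Lℓ * (lipPoly n R * ((1 - r ^ m) * r / (1 - r))) * (1 / (m : ℝ)) := by
  have hL := Setup.loss_nonneg_of_lip hloss
  rw [empRisk, Setup.empLoss, ← mul_sub, ← Finset.sum_sub_distrib, abs_mul,
    abs_of_nonneg (by positivity : (0 : ℝ) ≤ 1 / m), mul_comm]
  refine mul_le_mul_of_nonneg_right ?_ (by positivity)
  refine (Finset.abs_sum_le_sum_abs _ _).trans ?_
  rw [← Setup.sum_range_pow_sub hr1, Finset.mul_sum, Finset.mul_sum]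
  refine Finset.sum_le_sum fun i _ => ?_
  rw [rrrSetup_blockLoss hSv hSy hM hb hloss hΘ hα hr0 hr1 θ c hc hω]
  refine (hloss _ _ _ _).trans (mul_le_mul_of_nonneg_left ?_ hL)
  rw [sub_self, abs_zero, add_zero]
  refine (hc j).abs_val_state_sub_le (hΘ _ (θ j).2) (fun t => ?_) (fun t => hω.2.2 _) fun s hs => ?_
  · split_ifs
    · exact hω.2.2 _
    · exact ⟨le_rfl, hb⟩
  · rw [if_pos (by omega)]

variable [MeasurableSpace Ω] {μ : Measure Ω}

theorem IsInnovation.ae_isTypical (hξ : IsInnovation μ ξv ξy M)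
    (hV : ∀ t, ∀ᵐ ω ∂μ, Sv.process ξv t ω ∈ Set.Icc (0 : ℝ) b) :
    ∀ᵐ ω ∂μ, IsTypical ξv ξy Sv M b ω := by
  filter_upwards [ae_all_iff.2 hξ.bound_v, ae_all_iff.2 hξ.bound_y, ae_all_iff.2 hV]
    with ω h1 h2 h3 using ⟨h1, h2, h3⟩

variable [IsProbabilityMeasure μ]

theorem integrable_and_abs_risk_sub_le (hξ : IsInnovation μ ξv ξy M)
    (hω : ∀ᵐ ω ∂μ, IsTypical ξv ξy Sv M b ω) (j : ι) :
    Integrable (fun ω => loss ((c j).val (zExp ((θ j).1.state (fun k => Sv.process ξv k ω) 0)))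
      (Sy.process ξy 0 ω)) μ ∧
    ∀ k, |risk μ loss (Sv.process ξv) (Sy.process ξy)
        (fun v => (c j).val (zExp ((θ j).1.state v 0))) -
      ∫ ω, (rrrSetup hSv hSy hM hb hloss hΘ hα hr0 hr1 θ c hc).blockLoss j k
        (fun t => (ξv t ω, ξy t ω)) ∂μ| ≤ Lℓ * (lipPoly n R * r ^ k) := by
  have hL := Setup.loss_nonneg_of_lip hloss
  set S := rrrSetup hSv hSy hM hb hloss hΘ hα hr0 hr1 θ c hc with hS
  obtain ⟨K, hK⟩ := S.exists_blockLoss_bound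
  have h := integrable_and_abs_integral_sub_le (μ := μ)
    (f := fun k ω => S.blockLoss j k fun t => (ξv t ω, ξy t ω))
    (F := fun ω => loss ((c j).val (zExp ((θ j).1.state (fun k => Sv.process ξv k ω) 0)))
      (Sy.process ξy 0 ω)) (K := K) (D := Lℓ * lipPoly n R) (r := r)
    (fun k => (S.measurable_blockLoss j k).comp (measurable_pi_lambda _ fun t =>
      (hξ.measurable_v t).prodMk (hξ.measurable_y t))) (fun k ω => hK j k _) hr0 hr1 (by
        filter_upwards [hω] with ω hω k
        have e := rrrSetup_blockLoss hSv hSy hM hb hloss hΘ hα hr0 hr1 θ c hc hω 0 j k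
        have e0 : (shiftSeq 0 fun t => (ξv t ω, ξy t ω)) = fun t => (ξv t ω, ξy t ω) := by
          funext t; simp [shiftSeq]
        rw [e0] at e
        simp only [Nat.zero_add] at e
        rw [← hS] at e
        rw [e, mul_assoc]
        refine (hloss _ _ _ _).trans (mul_le_mul_of_nonneg_left ?_ hL)
        rw [sub_self, abs_zero, add_zero]
        exact (hc j).abs_val_state_sub_le (hΘ _ (θ j).2) hω.2.2 hω.2.2 fun _ _ => rfl)
  refine ⟨h.1, fun k => ?_⟩
  rw [← mul_assoc]
  exact h.2 k

end Typical

end Pair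
/-! ### The constants of the bound -/

section Constants

/-- The root splits into the parts of `log 4` and `log (1 / δ)`. The former is absorbed by `√(log m
/ m)` if `m ≥ 2`, and by `1 / m` if `m = 1`, where `log m` vanishes. -/
theorem sqrt_log_four_div_le {m : ℕ} (hm : 1 ≤ m) {δ : ℝ} (hδ : 0 < δ) (hδ1 : δ < 1) :
    Real.sqrt (Real.log (4 / δ) / (2 * m)) ≤ 2 * boundOrder m δ := by
  have hmp : (1 : ℝ) ≤ m := by exact_mod_cast hm
  have h0 : 0 ≤ Real.log m := Real.log_nonneg hmp
  have hl : 0 ≤ Real.log (1 / δ) := Real.log_nonneg ((one_le_div hδ).2 hδ1.le)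
  have h4 : 0 ≤ Real.log 4 := Real.log_nonneg (by norm_num)
  have e : Real.log (4 / δ) = Real.log 4 + Real.log (1 / δ) := by
    rw [← Real.log_mul (by norm_num) (by positivity)]
    congr 1
    ring
  have h1 : Real.log (4 / δ) / (2 * m) ≤ Real.log 4 / m + Real.log (1 / δ) / m := by
    rw [e, ← add_div]
    gcongr
    linarith
  have h2 : Real.sqrt (Real.log 4 / m) ≤ 2 * (1 / (m : ℝ)) + 2 * Real.sqrt (Real.log m / m) := by
    rw [Real.sqrt_le_left (by positivity)]
    have hlog4 : Real.log 4 = 2 * Real.log 2 := by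
      rw [show (4 : ℝ) = 2 ^ 2 by norm_num, Real.log_pow]
      norm_num
    have hlog2 := Real.log_two_lt_d9
    rcases hm.eq_or_lt with rfl | h
    · norm_num
      linarith
    · have hm2 : (2 : ℝ) ≤ m := by exact_mod_cast h
      have h3 : Real.log 2 ≤ Real.log m := Real.log_le_log (by norm_num) hm2
      have h5 : Real.sqrt (Real.log m / m) ^ 2 = Real.log m / m := Real.sq_sqrt (by positivity)
      have h6 : Real.log 4 / m ≤ 4 * (Real.log m / m) := by
        rw [← mul_div_assoc]
        gcongr
        linarith
      have h7 : 0 ≤ 1 / (m : ℝ) * Real.sqrt (Real.log m / m) := by positivity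
      nlinarith [sq_nonneg (1 / (m : ℝ))]
  have h3 : Real.sqrt (Real.log (4 / δ) / (2 * m)) ≤
      Real.sqrt (Real.log 4 / m) + Real.sqrt (Real.log (1 / δ) / m) := by
    refine (Real.sqrt_le_sqrt h1).trans ?_
    rw [Real.sqrt_le_left (by positivity), add_sq, Real.sq_sqrt (by positivity),
      Real.sq_sqrt (by positivity)]
    have : 0 ≤ 2 * Real.sqrt (Real.log 4 / m) * Real.sqrt (Real.log (1 / δ) / m) := by positivity
    linarith
  have h5 : 0 ≤ Real.log m / m := by positivity
  have h6 := Real.sqrt_nonneg (Real.log (1 / δ) / m)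
  rw [boundOrder]
  linarith

theorem exists_le_mul_boundOrder {Lℓ Lh r C1 C2 C3 C4 : ℝ} (hL : 0 ≤ Lℓ) (hLh : 0 ≤ Lh)
    (hr0 : 0 ≤ r) (hr1 : r < 1) :
    ∃ K, ∀ m : ℕ, 1 ≤ m → ∀ δ : ℝ, 0 < δ → δ < 1 →
      (constC0 Lℓ Lh r m + C1) * (1 / (m : ℝ)) + C2 * (Real.log m / m) +
        C3 * Real.sqrt (Real.log m / m) + C4 * Real.sqrt (Real.log (4 / δ) / (2 * m)) ≤
      K * boundOrder m δ := by
  refine ⟨2 * Lℓ * Lh * (r / (1 - r)) + |C1| + |C2| + |C3| + 2 * |C4|, fun m hm δ hδ hδ1 => ?_⟩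
  have hmp : (1 : ℝ) ≤ m := by exact_mod_cast hm
  have h0 : 0 ≤ Real.log m := Real.log_nonneg hmp
  have h1r : 0 < 1 - r := by linarith
  have hC0 : constC0 Lℓ Lh r m ≤ 2 * Lℓ * Lh * (r / (1 - r)) := by
    rw [constC0]
    gcongr
    have := pow_nonneg hr0 m
    nlinarith
  have a1 : 0 ≤ 1 / (m : ℝ) := by positivity
  have a2 : 0 ≤ Real.log m / m := by positivity
  have a3 := Real.sqrt_nonneg (Real.log m / m)
  have a4 := Real.sqrt_nonneg (Real.log (1 / δ) / m)
  have a5 := sqrt_log_four_div_le hm hδ hδ1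
  have a6 := Real.sqrt_nonneg (Real.log (4 / δ) / (2 * m))
  have b1 : 1 / (m : ℝ) ≤ boundOrder m δ := by rw [boundOrder]; linarith
  have b2 : Real.log m / m ≤ boundOrder m δ := by rw [boundOrder]; linarith
  have b3 : Real.sqrt (Real.log m / m) ≤ boundOrder m δ := by rw [boundOrder]; linarith
  have key : ∀ {x y C : ℝ}, 0 ≤ x → x ≤ y → C * x ≤ |C| * y := fun hx hxy =>
    mul_le_mul (le_abs_self _) hxy hx (abs_nonneg _)
  have c0 : constC0 Lℓ Lh r m * (1 / (m : ℝ)) ≤ 2 * Lℓ * Lh * (r / (1 - r)) * boundOrder m δ :=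
    mul_le_mul hC0 b1 a1 (by positivity)
  have c1 := key (C := C1) a1 b1
  have c2 := key (C := C2) a2 b2
  have c3 := key (C := C3) a3 b3
  have c4 := key (C := C4) a6 a5
  linarith

/-- The two geometric sums add up to `constC0`, and `constC1` is matched exactly. There is slack in
the first summand of `constC2`, the factor `R` in `constC3` and the summand `r` in `constC4`. -/
theorem bound_le_riskBound {n R card expCard m : ℕ} {Lℓ Lv Ly Dv Dy mv my ℓ0 Cmax αmin r ζ M wv1 wy1 q :
      ℝ}
    (hm : 1 ≤ m) (hL : 0 ≤ Lℓ) (hℓ0 : 0 ≤ ℓ0) (hC : 0 ≤ Cmax) (hr0 : 0 ≤ r) (hr1 : r < 1)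
    (hζ0 : 0 < ζ) (hζ1 : ζ < 1) (hexp : (expCard : ℝ) ≤ numMonomials n R) (hq : 0 ≤ q) :
    (Lℓ * (lipPoly n R * ((1 - r ^ m) * r / (1 - r))) * (1 / (m : ℝ)) +
      2 * Lℓ * (lipPoly n R + Ly * my / (1 - Dy)) / ζ * (1 / (m : ℝ)) +
      2 * Lℓ * lipPoly n R * (2 * (1 - αmin)) * (Lv * mv / (1 - Dv)) / (ζ * Real.log ζ⁻¹) *
        (Real.log m / m) +
      2 * Lℓ * (Cmax + card * expCard) / Real.sqrt (Real.log ζ⁻¹) * Real.sqrt (Real.log m / m)) +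
      2 * M * Lℓ * (lipPoly n R * (2 * (1 - αmin)) * Lv * wv1 / (1 - r) + Ly * wy1) * q +
      Lℓ * (lipPoly n R * ((1 - r ^ m) * r / (1 - r))) * (1 / (m : ℝ)) ≤
    (constC0 Lℓ (lipPoly n R) r m + constC1 Lℓ (lipPoly n R) (2 * Ly * my / (1 - Dy)) ζ) *
        (1 / (m : ℝ)) +
      constC2 Lℓ (lipPoly n R) ℓ0 Cmax αmin (2 * Lv * mv / (1 - Dv)) ζ * (Real.log m / m) +
      constC3 n R card Lℓ Cmax ζ * Real.sqrt (Real.log m / m) +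
      constC4 Lℓ (lipPoly n R) αmin r M Lv wv1 Ly wy1 * q := by
  have hLh := lipPoly_nonneg n R
  have hmp : (1 : ℝ) ≤ m := by exact_mod_cast hm
  have h0 : 0 ≤ Real.log m := Real.log_nonneg hmp
  have hl : 0 < Real.log ζ⁻¹ := Real.log_pos ((one_lt_inv₀ hζ0).2 hζ1)
  have hN : (expCard : ℝ) ≤ R * numMonomials n R := hexp.trans (numMonomials_le_mul n R)
  have h1r : 0 < 1 - r := by linarith
  have t2 : 0 ≤ 2 * (Lℓ * lipPoly n R + ℓ0 + Cmax * Lℓ) / Real.log ζ⁻¹ * (Real.log m / m) := by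
    positivity
  have t3 : 2 * Lℓ * (Cmax + card * expCard) / Real.sqrt (Real.log ζ⁻¹) *
      Real.sqrt (Real.log m / m) ≤ constC3 n R card Lℓ Cmax ζ * Real.sqrt (Real.log m / m) := by
    have h : Cmax + (card : ℝ) * expCard ≤ card * R * numMonomials n R + Cmax := by
      have := mul_le_mul_of_nonneg_left hN (Nat.cast_nonneg (α := ℝ) card)
      linarith
    rw [constC3]
    gcongr
  have t4 : 0 ≤ 2 * Lℓ * (lipPoly n R / (1 - r) * r) * q := by positivity
  have e1 : constC1 Lℓ (lipPoly n R) (2 * Ly * my / (1 - Dy)) ζ =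
      2 * Lℓ * (lipPoly n R + Ly * my / (1 - Dy)) / ζ := by rw [constC1]; ring
  have e2 : constC2 Lℓ (lipPoly n R) ℓ0 Cmax αmin (2 * Lv * mv / (1 - Dv)) ζ =
      2 * (Lℓ * lipPoly n R + ℓ0 + Cmax * Lℓ) / Real.log ζ⁻¹ +
      2 * Lℓ * lipPoly n R * (2 * (1 - αmin)) * (Lv * mv / (1 - Dv)) / (ζ * Real.log ζ⁻¹) := by
    rw [constC2]; ring
  have e4 : constC4 Lℓ (lipPoly n R) αmin r M Lv wv1 Ly wy1 =
      2 * Lℓ * (lipPoly n R / (1 - r) * r) +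
      2 * M * Lℓ * (lipPoly n R * (2 * (1 - αmin)) * Lv * wv1 / (1 - r) + Ly * wy1) := by
    rw [constC4]; ring
  have e0 : constC0 Lℓ (lipPoly n R) r m = 2 * (Lℓ * (lipPoly n R * ((1 - r ^ m) * r / (1 - r)))) := by
    rw [constC0]; ring
  rw [e0, e1, e2, e4]
  linarith

end Constants

/-! ### The uniform bound over the reservoir class -/

section Main

variable {qv qy n R : ℕ} {Sv : Shift qv} {Sy : Shift qy} {M b αmin r Cmax Lℓ : ℝ}
  {loss : ℝ → ℝ → ℝ} {Θ : Finset (RRRParam n)} {Ω : Type*} [MeasurableSpace Ω] {μ : Measure Ω}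
  [IsProbabilityMeasure μ] {ξv : ℕ → Ω → EuclideanSpace ℝ (Fin qv)}
  {ξy : ℕ → Ω → EuclideanSpace ℝ (Fin qy)}

theorem continuous_coef_val (z : Fin n → ℝ) : Continuous fun c : Coef n R => c.val z := by
  unfold Coef.val
  fun_prop

omit [MeasurableSpace Ω] in
theorem continuous_empRisk
    (hloss : ∀ x x' y y' : ℝ, |loss x y - loss x' y'| ≤ Lℓ * (|x - x'| + |y - y'|))
    (θ : RRRParam n) (V Y : ℕ → Ω → ℝ) (m : ℕ) (ω : Ω) :
    Continuous fun c : Coef n R => empRisk loss V Y m (fun v => c.val (zExp (θ.state v 0))) ω := by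
  unfold empRisk
  refine continuous_const.mul (continuous_finsetSum _ fun i _ => ?_)
  exact (Setup.continuous_of_lip hloss).comp ((continuous_coef_val _).prodMk continuous_const)

/-- Pauli expectations of density matrices lie in `[-1, 1]`, so the loss is Lipschitz in the
coefficients uniformly over typical outcomes. -/
theorem continuous_risk
    (hloss : ∀ x x' y y' : ℝ, |loss x y - loss x' y'| ≤ Lℓ * (|x - x'| + |y - y'|))
    {θ : RRRParam n} (h : θ.Contracts αmin b r) {V Y : ℕ → Ω → ℝ}
    (hV : ∀ᵐ ω ∂μ, ∀ t, V t ω ∈ Set.Icc (0 : ℝ) b)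
    (hint : ∀ c : {c : Coef n R // c.Bounded Cmax},
      Integrable (fun ω => loss (c.1.val (zExp (θ.state (fun k => V k ω) 0))) (Y 0 ω)) μ) :
    Continuous fun c : {c : Coef n R // c.Bounded Cmax} =>
      risk μ loss V Y fun v => c.1.val (zExp (θ.state v 0)) := by
  have hL := Setup.loss_nonneg_of_lip hloss
  have hb : ∀ c c' : {c : Coef n R // c.Bounded Cmax},
      dist (risk μ loss V Y fun v => c.1.val (zExp (θ.state v 0)))
        (risk μ loss V Y fun v => c'.1.val (zExp (θ.state v 0))) ≤
      Lℓ * (|c.1.1 - c'.1.1| + ∑ a, |c.1.2 a - c'.1.2 a|) := fun c c' => by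
    rw [dist_eq_norm, risk, risk, ← integral_sub (hint c) (hint c')]
    refine (norm_integral_le_of_norm_le_const
      (C := Lℓ * (|c.1.1 - c'.1.1| + ∑ a, |c.1.2 a - c'.1.2 a|)) ?_).trans (by simp)
    filter_upwards [hV] with ω hω
    refine (hloss _ _ _ _).trans (mul_le_mul_of_nonneg_left ?_ hL)
    rw [sub_self, abs_zero, add_zero]
    exact Coef.abs_val_sub_val_le _ _ (h.isTrajectory_state hω 0).1.abs_zExp_le_one
  rw [continuous_iff_continuousAt]
  intro c
  rw [ContinuousAt, tendsto_iff_dist_tendsto_zero]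
  refine squeeze_zero (fun _ => dist_nonneg) (fun c' => hb c' c) ?_
  have hc : Continuous fun c' : {c : Coef n R // c.Bounded Cmax} =>
      Lℓ * (|c'.1.1 - c.1.1| + ∑ a, |c'.1.2 a - c.1.2 a|) := by fun_prop
  simpa using hc.tendsto c

theorem generalisationBound_of_contracts (hξ : IsInnovation μ ξv ξy M) (hSv : Sv.Valid M)
    (hSy : Sy.Valid M) (hb : 0 ≤ b) (hV : ∀ t, ∀ᵐ ω ∂μ, Sv.process ξv t ω ∈ Set.Icc (0 : ℝ) b)
    (hloss : ∀ x x' y y' : ℝ, |loss x y - loss x' y'| ≤ Lℓ * (|x - x'| + |y - y'|))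
    (hα : αmin ≤ 1) (hr0 : 0 ≤ r) (hr1 : r < 1) (hΘ : ∀ θ ∈ Θ, θ.Contracts αmin b r) :
    GeneralisationBound μ loss (Sv.process ξv) (Sy.process ξy) (rrrClass Θ R Cmax)
      (zetaMax r Sy.D Sv.D)
      (riskBound μ ξv ξy Sv Sy M loss Lℓ n R Θ.card Cmax αmin r) := by
  have hL := Setup.loss_nonneg_of_lip hloss
  refine ⟨fun m hm _ δ hδ hδ1 => ?_, ?_⟩
  swap
  · obtain ⟨K, hK⟩ := exists_le_mul_boundOrder (r := r) hL (lipPoly_nonneg n R) hr0 hr1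
    exact ⟨K, fun m hm _ δ hδ hδ1 => hK m hm δ hδ hδ1⟩
  have hM : 0 ≤ M := by
    obtain ⟨ω, hω⟩ := (hξ.bound_v 0).exists
    exact (norm_nonneg _).trans hω
  -- Otherwise the class is empty and its supremum in `EReal` is `⊥`.
  by_cases hne : Θ.Nonempty ∧ 0 ≤ Cmax
  swap
  · have hempty : ∀ H, H ∉ rrrClass Θ R Cmax := by
      rintro H ⟨θ, hθ, p, hp, -⟩
      exact hne ⟨⟨θ, hθ⟩, (abs_nonneg _).trans hp.2.1⟩
    have : {ω | (⨆ H ∈ rrrClass Θ R Cmax, ((|risk μ loss (Sv.process ξv) (Sy.process ξy) H -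
        empRisk loss (Sv.process ξv) (Sy.process ξy) m H ω| : ℝ) : EReal)) ≤
        ((riskBound μ ξv ξy Sv Sy M loss Lℓ n R Θ.card Cmax αmin r m δ : ℝ) : EReal)} =
        Set.univ := by
      refine Set.eq_univ_of_forall fun ω => ?_
      simp only [Set.mem_ofPred_eq]
      exact iSup₂_le fun H hH => absurd hH (hempty H)
    rw [this, measure_univ]
    exact ENNReal.ofReal_le_one.2 (by linarith)
  obtain ⟨⟨θ₀, hθ₀⟩, hC⟩ := hne
  have : Nonempty Θ := ⟨⟨θ₀, hθ₀⟩⟩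
  have : Nonempty {c : Coef n R // c.Bounded Cmax} := ⟨⟨0, by simpa [Coef.Bounded] using hC⟩⟩
  set ζ := zetaMax r Sy.D Sv.D with hζ
  have hζ0 : 0 < ζ := hSy.D_pos.trans_le ((le_max_left _ _).trans (le_max_right _ _))
  have hζ1 : ζ < 1 := max_lt hr1 (max_lt hSy.D_lt_one hSv.D_lt_one)
  have htyp := hξ.ae_isTypical hV
  let u := TopologicalSpace.denseSeq {c : Coef n R // c.Bounded Cmax}
  let S := rrrSetup hSv hSy hM hb hloss hΘ hα hr0 hr1
    (fun p : Θ × {c : Coef n R // c.Bounded Cmax} => p.1) (fun p => p.2.1) fun p => p.2.2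
  let Rk : Θ × {c : Coef n R // c.Bounded Cmax} → ℝ := fun p =>
    risk μ loss (Sv.process ξv) (Sy.process ξy) fun v => p.2.1.val (zExp (p.1.1.state v 0))
  have hRk := integrable_and_abs_risk_sub_le hSv hSy hM hb hloss hΘ hα hr0 hr1
    (fun p : Θ × {c : Coef n R // c.Bounded Cmax} => p.1) (fun p => p.2.1) (fun p => p.2.2) hξ htyp
  have hmv : ∀ t, ∫ ω, ‖clip M (ξv t ω) - clip M 0‖ ∂μ = ∫ ω, ‖ξv 0 ω‖ ∂μ := fun t => by
    refine (integral_congr_ae ?_).trans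
      ((hξ.ident t).comp (measurable_norm.comp measurable_fst)).integral_eq
    filter_upwards [hξ.bound_v t] with ω hω
    simp [clip_of_le hω, clip_zero]
  have hmy : ∀ t, ∫ ω, ‖clip M (ξy t ω) - clip M 0‖ ∂μ = ∫ ω, ‖ξy 0 ω‖ ∂μ := fun t => by
    refine (integral_congr_ae ?_).trans
      ((hξ.ident t).comp (measurable_norm.comp measurable_snd)).integral_eq
    filter_upwards [hξ.bound_y t] with ω hω
    simp [clip_of_le hω, clip_zero]
  -- Level `δ / 4` on each side yields `log (4 / δ)` and total failure probability `δ / 2`, which is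
  -- more than enough. Padding by `e₀ = 0` makes the mean distances equal to `E‖ξ_0‖`.
  have hprob := (S.reindex fun p : Θ × ℕ => (p.1, u p.2)).measure_abs_gap_gt_le_of_countable
    (X := fun t ω => (ξv t ω, ξy t ω)) (e₀ := 0)
    (fun t => (hξ.measurable_v t).prodMk (hξ.measurable_y t)) hξ.indep
    (fun t => (hξ.ident t).map_eq) hmv hmy (ζ := ζ) (le_max_left _ _)
    ((le_max_right _ _).trans (le_max_right _ _)) ((le_max_left _ _).trans (le_max_right _ _))
    hζ0 hζ1 hm (R := fun p => Rk (p.1, u p.2)) (fun p k => (hRk (p.1, u p.2)).2 k)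
    (δ := δ / 4) (by linarith) (by linarith)
  set A := {ω | ∃ p : Θ × ℕ, (S.reindex fun p : Θ × ℕ => (p.1, u p.2)).meanBound
      (∫ ω, ‖ξv 0 ω‖ ∂μ) (∫ ω, ‖ξy 0 ω‖ ∂μ) ζ m +
    (S.reindex fun p : Θ × ℕ => (p.1, u p.2)).totalInfluence *
      Real.sqrt (Real.log (1 / (δ / 4)) / (2 * m)) <
    |Rk (p.1, u p.2) - (S.reindex fun p : Θ × ℕ => (p.1, u p.2)).empLoss m p
      fun t => (ξv t ω, ξy t ω)|} with hA
  set T := {ω | (⨆ H ∈ rrrClass Θ R Cmax, ((|risk μ loss (Sv.process ξv) (Sy.process ξy) H -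
        empRisk loss (Sv.process ξv) (Sy.process ξy) m H ω| : ℝ) : EReal)) ≤
        ((riskBound μ ξv ξy Sv Sy M loss Lℓ n R Θ.card Cmax αmin r m δ : ℝ) : EReal)} with hT
  have hsub : ∀ᵐ ω ∂μ, ω ∈ A ∪ T := by
    filter_upwards [htyp] with ω hω
    rw [Set.mem_union, or_iff_not_imp_left]
    intro hωA
    simp only [hA, Set.mem_ofPred_eq, not_exists, not_lt] at hωA
    simp only [hT, Set.mem_ofPred_eq]
    refine iSup₂_le fun H hH => EReal.coe_le_coe_iff.2 ?_
    obtain ⟨θ, hθ, p, hp, rfl⟩ := hH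
    obtain ⟨c, hc, hcp⟩ := hp.exists_coef
    simp only [hcp]
    -- With `ω` and the reservoir fixed, the bound is a closed condition on the coefficients; it
    -- holds on the dense sequence `u`, hence everywhere.
    have hclosed : IsClosed {c : {c : Coef n R // c.Bounded Cmax} |
        |risk μ loss (Sv.process ξv) (Sy.process ξy) (fun v => c.1.val (zExp (θ.state v 0))) -
          empRisk loss (Sv.process ξv) (Sy.process ξy) m
            (fun v => c.1.val (zExp (θ.state v 0))) ω| ≤
          riskBound μ ξv ξy Sv Sy M loss Lℓ n R Θ.card Cmax αmin r m δ} := by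
      refine isClosed_le (Continuous.abs ?_) continuous_const
      exact (continuous_risk hloss (hΘ θ hθ) (htyp.mono fun ω hω => hω.2.2)
        fun c => (hRk (⟨θ, hθ⟩, c)).1).sub
        ((continuous_empRisk hloss θ _ _ m ω).comp continuous_subtype_val)
    have hdense : ∀ k, u k ∈ {c : {c : Coef n R // c.Bounded Cmax} |
        |risk μ loss (Sv.process ξv) (Sy.process ξy) (fun v => c.1.val (zExp (θ.state v 0))) -
          empRisk loss (Sv.process ξv) (Sy.process ξy) m
            (fun v => c.1.val (zExp (θ.state v 0))) ω| ≤
          riskBound μ ξv ξy Sv Sy M loss Lℓ n R Θ.card Cmax αmin r m δ} := fun k => by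
      simp only [Set.mem_ofPred_eq]
      have h1 := hωA (⟨θ, hθ⟩, k)
      have h2 := abs_empRisk_sub_empLoss_le hSv hSy hM hb hloss hΘ hα hr0 hr1
        (fun p : Θ × {c : Coef n R // c.Bounded Cmax} => p.1) (fun p => p.2.1) (fun p => p.2.2)
        hω (⟨θ, hθ⟩, u k) m
      have h3 := bound_le_riskBound (n := n) (R := R) (card := Θ.card) (Lv := Sv.L) (Ly := Sy.L)
        (Dv := Sv.D) (Dy := Sy.D) (mv := ∫ ω, ‖ξv 0 ω‖ ∂μ) (my := ∫ ω, ‖ξy 0 ω‖ ∂μ)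
        (ℓ0 := ∫ ω, |loss 0 (Sy.process ξy 0 ω)| ∂μ) (αmin := αmin) (M := M) (wv1 := Sv.w1)
        (wy1 := Sy.w1) hm hL (integral_nonneg fun _ => abs_nonneg _) hC hr0 hr1 hζ0 hζ1
        (card_expSet_le n R) (Real.sqrt_nonneg (Real.log (4 / δ) / (2 * m)))
      rw [← sum_featBound, ← one_div_div δ 4] at h3
      rw [abs_sub_comm] at h2
      refine (abs_sub_le _ _ _).trans ((add_le_add h1 h2).trans ?_)
      rw [riskBound, ← one_div_div δ 4]
      exact h3
    have hall := hclosed.closure_subset_iff.2 (Set.range_subset_iff.2 hdense)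
    rw [(TopologicalSpace.denseRange_denseSeq _).closure_range] at hall
    exact hall (Set.mem_univ (⟨c, hc⟩ : {c : Coef n R // c.Bounded Cmax}))
  -- Subadditivity suffices here, so no measurability of the event `T` is required.
  have h1 : (1 : ENNReal) ≤ ENNReal.ofReal δ + μ T := by
    calc (1 : ENNReal) = μ (A ∪ T) := by
          rw [measure_congr (s := A ∪ T) (Filter.eventuallyEq_univ.2 hsub), measure_univ]
      _ ≤ μ A + μ T := measure_union_le _ _
      _ ≤ ENNReal.ofReal δ + μ T := by
          gcongr
          exact hprob.trans (ENNReal.ofReal_le_ofReal (by linarith))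
  rw [ENNReal.ofReal_sub _ hδ.le, ENNReal.ofReal_one]
  exact tsub_le_iff_left.2 h1

theorem RRRParam.Valid.contracts {θ : RRRParam n} {r0 r1 : ℝ} (hθ : θ.Valid αmin)
    (hα : 0 ≤ αmin) (h0 : HasRate θ.T0 r0) (h1 : HasRate θ.T1 r1) (hr0 : 0 ≤ r0) (hr1 : 0 ≤ r1)
    (hb : b ≤ 1) (hr : 0 ≤ r) (hr' : r < 1)
    (hrate : ∀ v ∈ Set.Icc (0 : ℝ) b, (1 - αmin) * (v * r0 + (1 - v) * r1) ≤ r) :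
    θ.Contracts αmin b r where
  valid := hθ
  α_nonneg := hα
  b_le_one := hb
  r_nonneg := hr
  r_lt_one := hr'
  contract v hv _ _ hρ hσ :=
    hθ.contract h0 h1 hr0 hr1 ⟨hv.1, hv.2.trans hb⟩ (hrate v hv) hρ hσ

/-- The bound `b` is the largest input in `[0, 1]` that meets the rate condition. As the rate is
nondecreasing in the input when `r1 ≤ r0`, the whole interval `[0, b]` is admissible, including the
padding value 0. -/
theorem exists_input_bound {V : ℕ → Ω → ℝ} {r0 r1 : ℝ} (hα : αmin ≤ 1) (h01 : r1 ≤ r0)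
    (hV : ∀ t, ∀ᵐ ω ∂μ, V t ω ∈ Set.Icc (0 : ℝ) 1)
    (hr : ∀ t, ∀ᵐ ω ∂μ, (1 - αmin) * (V t ω * r0 + (1 - V t ω) * r1) ≤ r) :
    ∃ b ∈ Set.Icc (0 : ℝ) 1, (∀ v ≤ b, (1 - αmin) * (v * r0 + (1 - v) * r1) ≤ r) ∧
      ∀ t, ∀ᵐ ω ∂μ, V t ω ∈ Set.Icc (0 : ℝ) b := by
  let s : Set ℝ := Set.Icc 0 1 ∩ {v | (1 - αmin) * (v * r0 + (1 - v) * r1) ≤ r}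
  have hs : IsCompact s :=
    isCompact_Icc.inter_right (isClosed_le (by fun_prop) continuous_const)
  obtain ⟨ω, h1, h2⟩ := ((hV 0).and (hr 0)).exists
  have hb := hs.sSup_mem ⟨V 0 ω, h1, h2⟩
  refine ⟨sSup s, hb.1, fun v hv => le_trans ?_ hb.2, fun t => ?_⟩
  · have := mul_le_mul_of_nonneg_left (mul_le_mul_of_nonneg_right hv (sub_nonneg.2 h01))
      (sub_nonneg.2 hα)
    linarith
  · filter_upwards [hV t, hr t] with ω h1 h2
    exact ⟨h1.1, le_csSup hs.bddAbove ⟨h1, h2⟩⟩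

end Main
end QRC

end

/-! ### The two cases of the theorem -/

theorem mainTheorem2
    {Ω : Type*} [MeasurableSpace Ω] (μ : Measure Ω) [IsProbabilityMeasure μ]
    {qv qy : ℕ} (ξv : ℕ → Ω → EuclideanSpace ℝ (Fin qv)) (ξy : ℕ → Ω → EuclideanSpace ℝ (Fin qy))
    (Sv : QRC.Shift qv) (Sy : QRC.Shift qy) (M : ℝ)
    (hξ : QRC.IsInnovation μ ξv ξy M) (hSv : Sv.Valid M) (hSy : Sy.Valid M)
    (V Y : ℕ → Ω → ℝ) (hV : V = Sv.process ξv) (hY : Y = Sy.process ξy)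
    (hV01 : ∀ t, ∀ᵐ ω ∂μ, V t ω ∈ Set.Icc (0 : ℝ) 1)
    (loss : ℝ → ℝ → ℝ) (Lℓ : ℝ)
    (hloss : ∀ x x' y y' : ℝ, |loss x y - loss x' y'| ≤ Lℓ * (|x - x'| + |y - y'|))
    (n Rmax : ℕ) (Cmax αmin r0 r1 : ℝ)
    (hα0 : 0 ≤ αmin) (hα1 : αmin ≤ 1) (hr0 : 0 ≤ r0) (hr1 : 0 ≤ r1)
    (Θ : Finset (QRC.RRRParam n)) (hΘ : ∀ θ ∈ Θ, θ.Valid αmin)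
    (hΘ0 : ∀ θ ∈ Θ, QRC.HasRate θ.T0 r0) (hΘ1 : ∀ θ ∈ Θ, QRC.HasRate θ.T1 r1) :
    (∀ r01 : ℝ, r0 = r01 → r1 = r01 → (1 - αmin) * r01 < 1 →
      QRC.GeneralisationBound μ loss V Y (QRC.rrrClass Θ Rmax Cmax)
        (QRC.zetaMax ((1 - αmin) * r01) Sy.D Sv.D)
        (QRC.riskBound μ ξv ξy Sv Sy M loss Lℓ n Rmax Θ.card Cmax αmin ((1 - αmin) * r01))) ∧
    (∀ ε : ℝ, r1 < r0 → 0 < ε →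
      (∀ t, ∀ᵐ ω ∂μ, (1 - αmin) * (V t ω * r0 + (1 - V t ω) * r1) ≤ 1 - ε) →
      QRC.GeneralisationBound μ loss V Y (QRC.rrrClass Θ Rmax Cmax)
        (QRC.zetaMax (1 - ε) Sy.D Sv.D)
        (QRC.riskBound μ ξv ξy Sv Sy M loss Lℓ n Rmax Θ.card Cmax αmin (1 - ε))) := by
  subst hV hY
  refine ⟨?_, fun ε h01 hε hrate => ?_⟩
  -- Equal rates make the contraction rate independent of the input, so all of `[0, 1]` is
  -- admissible.
  · rintro _ rfl h10 hlt
    subst h10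
    have hr : 0 ≤ (1 - αmin) * r1 := mul_nonneg (sub_nonneg.2 hα1) hr1
    refine QRC.generalisationBound_of_contracts hξ hSv hSy zero_le_one hV01 hloss hα1 hr hlt
      fun θ hθ => (hΘ θ hθ).contracts hα0 (hΘ0 θ hθ) (hΘ1 θ hθ) hr0 hr1 le_rfl hr hlt
        fun v _ => le_of_eq ?_
    ring
  · obtain ⟨b, hb, hle, hV⟩ := QRC.exists_input_bound hα1 h01.le hV01 hrate
    -- Nonnegativity of `1 - ε` follows from the rate condition at `b`, whose left side is
    -- nonnegative.
    have hr : 0 ≤ 1 - ε := (mul_nonneg (sub_nonneg.2 hα1) (add_nonneg (mul_nonneg hb.1 hr0)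
      (mul_nonneg (sub_nonneg.2 hb.2) hr1))).trans (hle b le_rfl)
    have hlt : 1 - ε < 1 := by linarith
    exact QRC.generalisationBound_of_contracts hξ hSv hSy hb.1 hV hloss hα1 hr hlt
      fun θ hθ => (hΘ θ hθ).contracts hα0 (hΘ0 θ hθ) (hΘ1 θ hθ) hr0 hr1 hb.2 hr hlt
        fun v hv => hle v hv.2
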